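/- Let $A,B,R$ be quantum systems described by complex separable Hilbert spaces $\mathcal H_A,\mathcal H_B,\mathcal H_R$ with $\dim\mathcal H_R=\infty$; write $\mathcal H_{AR}=\mathcal H_A\otimes\mathcal H_R$. Let $\mathfrak T(\mathcal H)$ be the space of trace-class operators with the trace norm $\|\cdot\|_1$, and $\mathfrak S(\mathcal H)$ the set of states (positive trace-class operators of unit trace). A channel from $A$ to $B$ is a completely positive trace-preserving linear map $\mathfrak T(\mathcal H_A)\to\mathfrak T(\mathcal H_B)$; $\mathfrak F(A,B)$ is the set of all channels. Let $H_A$ be a densely defined positive self-adjoint (possibly unbounded) operator in $\mathcal H_A$, let $E_0^A$ be the infimum of its spectrum, and for a positive trace-class operator $\rho$ put $\operatorname{Tr}H_A\rho=\sup_n\operatorname{Tr}P_nH_A\rho\in[0,\infty]$, where $P_n$ is the spectral projector of $H_A$ for $[0,n]$. For a Hermitian-preserving linear map $\Phi:\mathfrak T(\mathcal H_A)\to\mathfrak T(\mathcal H_B)$ and a real $E>E_0^A$ put $$\|\Phi\|_\diamond=\sup_{\rho\in\mathfrak S(\mathcal H_{AR})}\|\Phi\otimes\mathrm{id}_R(\rho)\|_1,\qquad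 \|\Phi\|_\diamond^E=\sup_{\rho\in\mathfrak S(\mathcal H_{AR}),\ \operatorname{Tr}H_A\rho_A\le E}\|\Phi\otimes\mathrm{id}_R(\rho)\|_1$$ with values in $[0,\infty]$, where $\|\Phi\otimes\mathrm{id}_R(\rho)\|_1=\infty$ if $\Phi\otimes\mathrm{id}_R(\rho)$ does not exist as a trace-class operator (this cannot happen when $\Phi$ is completely bounded, in particular not for differences of channels). Strong convergence $\Phi_n\to\Phi_0$ means $\|\Phi_n(\rho)-\Phi_0(\rho)\|_1\to0$ for every $\rho\in\mathfrak S(\mathcal H_A)$; the strong convergence topology is the one defined by the seminorms $\Phi\mapsto\|\Phi(\rho)\|_1$, $\rho\in\mathfrak S(\mathcal H_A)$. Then for every $E>E_0^A$ the following hold. 0) On Hermitian-preserving linear maps $\|\cdot\|_\diamond^E$ is subadditive and absolutely homogeneous (over $\mathbb R$), it is finite whenever $\|\Phi\|_\diamond<\infty$, and $\|\Phi\|_\diamond^E=0$ implies $\Phi=0$ for every Hermitian-preserving $\Phi$ that is bounded as a map between the Banach spaces $\mathfrak T(\mathcal H_A)$ and $\mathfrak T(\mathcal H_B)$. A) For $\Phi_n,\Phi_0\in\mathfrak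 F(A,B)$, $\lim_n\|\Phi_n-\Phi_0\|_\diamond^E=0$ implies that $\Phi_n$ converges strongly to $\Phi_0$. B) If $H_A$ has discrete spectrum $\{E_k\}_{k\ge0}$ of finite multiplicity with $E_k\to+\infty$, i.e. $\mathcal H_A$ has an orthonormal basis $(\tau_k)_{k\ge 0}$ with $H_A\tau_k=E_k\tau_k$ and $E_k\to+\infty$, then the converse implication in A) also holds, and the topology generated by $\|\cdot\|_\diamond^E$ on $\mathfrak F(A,B)$ coincides with the strong convergence topology. Moreover, the implication in A) holds for Hermitian-preserving linear maps $\Phi_n,\Phi_0$ whose operator norms $\mathfrak T(\mathcal H_A)\to\mathfrak T(\mathcal H_B)$ are uniformly bounded; and under the condition of B) the equivalence and the coincidence of topologies hold on every set of Hermitian-preserving linear maps on which $\|\cdot\|_\diamond$ is bounded. -/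

import Mathlib

open scoped ENNReal InnerProductSpace TensorProduct ComplexOrder

noncomputable section

namespace ECD

universe u v w

section TraceClass

variable {H : Type u} [NormedAddCommGroup H] [InnerProductSpace ℂ H] [CompleteSpace H]
variable {K : Type v} [NormedAddCommGroup K] [InnerProductSpace ℂ K] [CompleteSpace K]

/-- The index set of a fixed Hilbert basis of `H`. -/
def basisIndex (H : Type u) [NormedAddCommGroup H] [InnerProductSpace ℂ H] [CompleteSpace H] :
    Set H :=
  (exists_hilbertBasis ℂ H).choose

/-- A fixed Hilbert (complete orthonormal) basis of `H`. -/
def stdBasis (H : Type u) [NormedAddCommGroup H] [InnerProductSpace ℂ H] [CompleteSpace H] :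
    HilbertBasis (basisIndex H) ℂ H :=
  (exists_hilbertBasis ℂ H).choose_spec.choose

/-- The trace norm `‖T‖₁ = Tr |T| ∈ [0, ∞]`, where `|T| = √(T† T)`. -/
def traceNorm (T : H →L[ℂ] H) : ℝ≥0∞ :=
  ∑' i, ENNReal.ofReal (⟪stdBasis H i, CFC.abs T (stdBasis H i)⟫_ℂ).re

/-- The trace `Tr T = ∑ᵢ ⟨eᵢ, T eᵢ⟩` (used for trace-class operators only). -/
def trace (T : H →L[ℂ] H) : ℂ :=
  ∑' i, ⟪stdBasis H i, T (stdBasis H i)⟫_ℂ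

theorem norm_abs_apply (T : H →L[ℂ] H) (x : H) : ‖CFC.abs T x‖ = ‖T x‖ := by
  have h1 : ⟪CFC.abs T x, CFC.abs T x⟫_ℂ = ⟪T x, T x⟫_ℂ := by
    have hs : IsSelfAdjoint (CFC.abs T) := (CFC.abs_nonneg T).isSelfAdjoint
    have h2 := congrArg (fun S : H →L[ℂ] H => S x) (CFC.abs_mul_abs T)
    simp only [ContinuousLinearMap.mul_def, ContinuousLinearMap.comp_apply, ContinuousLinearMap.star_eq_adjoint] at h2
    rw [← ContinuousLinearMap.adjoint_inner_right, ← ContinuousLinearMap.star_eq_adjoint,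
      hs.star_eq, h2, ContinuousLinearMap.adjoint_inner_right]
  have h3 := congrArg Complex.re h1
  rw [inner_self_eq_norm_sq_to_K, inner_self_eq_norm_sq_to_K] at h3
  norm_cast at h3
  exact (sq_eq_sq₀ (norm_nonneg _) (norm_nonneg _)).1 h3

/-- Polar decomposition: `T = U |T|` and `|T| = U† T` with a contraction `U`. -/
theorem exists_polar (T : H →L[ℂ] H) :
    ∃ U : H →L[ℂ] H, U ∘L CFC.abs T = T ∧ ContinuousLinearMap.adjoint U ∘L T = CFC.abs T := by
  classical
  obtain ⟨U, hU1, hU⟩ : ∃ U : H →L[ℂ] H, ‖U‖ ≤ 1 ∧ ∀ x, U (CFC.abs T x) = T x := by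
    set A : H →L[ℂ] H := CFC.abs T with hA
    have hker : ∀ x y : H, A x = A y → T x = T y := by
      intro x y h
      have h0 : ‖A (x - y)‖ = 0 := by rw [map_sub, h, sub_self, norm_zero]
      rw [hA, norm_abs_apply, norm_eq_zero, map_sub, sub_eq_zero] at h0
      exact h0
    let M : Submodule ℂ H := LinearMap.range A.toLinearMap
    have hpre : ∀ y : M, ∃ x, A x = y := fun y => y.2
    choose p hp using hpre
    let f₀ : M →ₗ[ℂ] H :=
      { toFun := fun y => T (p y)
        map_add' := fun y z => by
          rw [← map_add]; apply hker; simp [hp]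
        map_smul' := fun c y => by
          rw [RingHom.id_apply, ← map_smul]; apply hker; simp [hp] }
    have hf₀ : ∀ y : M, ‖f₀ y‖ = ‖y‖ := by
      intro y
      change ‖T (p y)‖ = ‖(y : H)‖
      rw [← norm_abs_apply, ← hA, hp]
    let f : M →L[ℂ] H := f₀.mkContinuous 1 (fun y => by rw [hf₀, one_mul])
    let C : Submodule ℂ H := M.topologicalClosure
    have : CompleteSpace C := M.isClosed_topologicalClosure.completeSpace_coe
    let e : M →ₗᵢ[ℂ] C :=
      { toLinearMap := Submodule.inclusion M.le_topologicalClosure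
        norm_map' := fun y => rfl }
    have hed : DenseRange e := by
      intro y
      rw [Metric.mem_closure_iff]
      intro ε hε
      obtain ⟨z, hz, hd⟩ := Metric.mem_closure_iff.1
        (show (y : H) ∈ closure (M : Set H) from y.2) ε hε
      exact ⟨e ⟨z, hz⟩, ⟨_, rfl⟩, hd⟩
    have heu : IsUniformInducing e := e.isometry.isUniformInducing
    let g : C →L[ℂ] H := f.extend e.toContinuousLinearMap
    have hg : ‖g‖ ≤ 1 := by
      refine (ContinuousLinearMap.opNorm_extend_le (N := 1) f (e := e.toContinuousLinearMap) hed
        (fun y => ?_)).trans ?_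
      · simp
      · rw [NNReal.coe_one, one_mul]
        exact f₀.mkContinuous_norm_le zero_le_one _
    refine ⟨g ∘L C.orthogonalProjectionOnto, ?_, fun x => ?_⟩
    · refine (ContinuousLinearMap.opNorm_comp_le _ _).trans ?_
      exact mul_le_one₀ hg (norm_nonneg _) (C.orthogonalProjectionOnto_norm_le)
    · have hx : C.orthogonalProjectionOnto (A x) = e ⟨A x, ⟨x, rfl⟩⟩ := by
        have := Submodule.orthogonalProjectionOnto_mem_subspace_eq_self (K := C) (e ⟨A x, ⟨x, rfl⟩⟩)
        exact this
      rw [ContinuousLinearMap.comp_apply, hx]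
      have h5 := ContinuousLinearMap.extend_eq f (e := e.toContinuousLinearMap) hed heu
        ⟨A x, ⟨x, rfl⟩⟩
      refine Eq.trans h5 ?_
      exact hker _ _ (hp _)
  refine ⟨U, ContinuousLinearMap.ext hU, ContinuousLinearMap.ext fun x => ?_⟩
  have h1 : ‖ContinuousLinearMap.adjoint U (T x)‖ ≤ ‖T x‖ := by
    refine (ContinuousLinearMap.le_of_opNorm_le (c := 1) _ ?_ _).trans_eq (one_mul _)
    rwa [LinearIsometryEquiv.norm_map]
  have h2 : ⟪ContinuousLinearMap.adjoint U (T x), CFC.abs T x⟫_ℂ = (‖T x‖ : ℂ) ^ 2 := by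
    rw [ContinuousLinearMap.adjoint_inner_left, hU, inner_self_eq_norm_sq_to_K]; rfl
  have h3 : ‖ContinuousLinearMap.adjoint U (T x) - CFC.abs T x‖ ^ 2 ≤ 0 := by
    rw [@norm_sub_sq ℂ, h2, norm_abs_apply]
    have h4 : RCLike.re ((‖T x‖ : ℂ) ^ 2) = ‖T x‖ ^ 2 := by norm_cast
    rw [h4]
    nlinarith [norm_nonneg (ContinuousLinearMap.adjoint U (T x)), norm_nonneg (T x)]
  have h5 : ‖ContinuousLinearMap.adjoint U (T x) - CFC.abs T x‖ = 0 := by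
    nlinarith [norm_nonneg (ContinuousLinearMap.adjoint U (T x) - CFC.abs T x)]
  exact sub_eq_zero.1 (norm_eq_zero.1 h5)

theorem tsum_enorm_sq_inner {G : Type*} [NormedAddCommGroup G] [InnerProductSpace ℂ G]
    {ι : Type*} (b : HilbertBasis ι ℂ G) (x : G) :
    ∑' i, ‖⟪b i, x⟫_ℂ‖ₑ ^ 2 = ‖x‖ₑ ^ 2 := by
  have h := b.hasSum_inner_mul_inner x x
  have h' : HasSum (fun i => ‖⟪b i, x⟫_ℂ‖ ^ 2) (‖x‖ ^ 2) := by
    have h1 := Complex.hasSum_re h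
    rw [inner_self_eq_norm_sq_to_K] at h1
    convert h1 using 1
    · funext i
      rw [← inner_conj_symm x (b i), RCLike.conj_mul]
      norm_cast
    · norm_cast
  have h2 := ENNReal.ofReal_tsum_of_nonneg (fun i => by positivity) h'.summable
  rw [h'.tsum_eq] at h2
  rw [← ofReal_norm, ← ENNReal.ofReal_pow (norm_nonneg _), h2]
  congr 1
  funext i
  rw [ENNReal.ofReal_pow (norm_nonneg _), ofReal_norm]

/-- The Hilbert-Schmidt sums of `S` and of `S†` agree, in any two bases. -/
theorem tsum_enorm_sq_adjoint {ι κ : Type*} (b : HilbertBasis ι ℂ H) (c : HilbertBasis κ ℂ K)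
    (S : H →L[ℂ] K) :
    ∑' i, ‖S (b i)‖ₑ ^ 2 = ∑' j, ‖ContinuousLinearMap.adjoint S (c j)‖ₑ ^ 2 := by
  have h1 : ∀ i, ‖S (b i)‖ₑ ^ 2 = ∑' j, ‖⟪c j, S (b i)⟫_ℂ‖ₑ ^ 2 :=
    fun i => (tsum_enorm_sq_inner c _).symm
  have h2 : ∀ j, ‖ContinuousLinearMap.adjoint S (c j)‖ₑ ^ 2 = ∑' i, ‖⟪c j, S (b i)⟫_ℂ‖ₑ ^ 2 := by
    intro j
    rw [← tsum_enorm_sq_inner b]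
    congr 1
    funext i
    rw [ContinuousLinearMap.adjoint_inner_right, ← inner_conj_symm, RCLike.enorm_conj]
  simp_rw [h1, h2]
  exact ENNReal.tsum_comm

theorem ofReal_inner_abs (T : H →L[ℂ] H) (x : H) :
    ENNReal.ofReal (⟪x, CFC.abs T x⟫_ℂ).re = ‖CFC.sqrt (CFC.abs T) x‖ₑ ^ 2 := by
  have hs : IsSelfAdjoint (CFC.sqrt (CFC.abs T)) := (CFC.sqrt_nonneg _).isSelfAdjoint
  have h2 := congrArg (fun S : H →L[ℂ] H => S x)
    (CFC.sqrt_mul_sqrt_self (CFC.abs T) (CFC.abs_nonneg T))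
  simp only [ContinuousLinearMap.mul_def, ContinuousLinearMap.comp_apply] at h2
  rw [← h2, ← ContinuousLinearMap.adjoint_inner_left, ← ContinuousLinearMap.star_eq_adjoint,
    hs.star_eq, inner_self_eq_norm_sq_to_K, ← ofReal_norm,
    ← ENNReal.ofReal_pow (norm_nonneg _)]
  congr 1
  norm_cast

theorem tsum_enorm_sq_comp_le {ι : Type*} (b : HilbertBasis ι ℂ K) (T : H →L[ℂ] H)
    (X : K →L[ℂ] H) :
    ∑' i, ‖CFC.sqrt (CFC.abs T) (X (b i))‖ₑ ^ 2 ≤ ‖X‖ₑ ^ 2 * traceNorm T := by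
  have hs : IsSelfAdjoint (CFC.sqrt (CFC.abs T)) := (CFC.sqrt_nonneg _).isSelfAdjoint
  have h1 := tsum_enorm_sq_adjoint b (stdBasis H) (CFC.sqrt (CFC.abs T) ∘L X)
  simp only [ContinuousLinearMap.comp_apply] at h1
  rw [h1, traceNorm, ← ENNReal.tsum_mul_left]
  refine ENNReal.tsum_le_tsum fun i => ?_
  rw [ofReal_inner_abs, ContinuousLinearMap.adjoint_comp, ContinuousLinearMap.comp_apply,
    ← ContinuousLinearMap.star_eq_adjoint (CFC.sqrt (CFC.abs T)), hs.star_eq, ← mul_pow]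
  gcongr
  refine (ContinuousLinearMap.le_opENorm _ _).trans ?_
  gcongr
  rw [← ofReal_norm, ← ofReal_norm, LinearIsometryEquiv.norm_map]

theorem tsum_enorm_inner_lt_top {ι : Type*} (b : HilbertBasis ι ℂ K) {T : H →L[ℂ] H}
    (hT : traceNorm T < ⊤) (X Y : K →L[ℂ] H) :
    ∑' i, ‖⟪X (b i), T (Y (b i))⟫_ℂ‖ₑ < ⊤ := by
  obtain ⟨U, hU, -⟩ := exists_polar T
  have hs : IsSelfAdjoint (CFC.sqrt (CFC.abs T)) := (CFC.sqrt_nonneg _).isSelfAdjoint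
  have key : ∀ i, ‖⟪X (b i), T (Y (b i))⟫_ℂ‖ₑ ≤
      ‖CFC.sqrt (CFC.abs T) ((ContinuousLinearMap.adjoint U ∘L X) (b i))‖ₑ ^ 2 +
        ‖CFC.sqrt (CFC.abs T) (Y (b i))‖ₑ ^ 2 := by
    intro i
    have h2 := congrArg (fun S : H →L[ℂ] H => S (Y (b i)))
      (CFC.sqrt_mul_sqrt_self (CFC.abs T) (CFC.abs_nonneg T))
    simp only [ContinuousLinearMap.mul_def, ContinuousLinearMap.comp_apply] at h2
    have h3 : T (Y (b i)) = U (CFC.sqrt (CFC.abs T) (CFC.sqrt (CFC.abs T) (Y (b i)))) := by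
      rw [h2, ← ContinuousLinearMap.comp_apply U, hU]
    rw [h3, ← ContinuousLinearMap.adjoint_inner_left, ← ContinuousLinearMap.adjoint_inner_left,
      ← ContinuousLinearMap.star_eq_adjoint (CFC.sqrt (CFC.abs T)), hs.star_eq,
      ContinuousLinearMap.comp_apply]
    set p := CFC.sqrt (CFC.abs T) (ContinuousLinearMap.adjoint U (X (b i)))
    set q := CFC.sqrt (CFC.abs T) (Y (b i))
    rw [← ofReal_norm, ← ofReal_norm, ← ofReal_norm,
      ← ENNReal.ofReal_pow (norm_nonneg _), ← ENNReal.ofReal_pow (norm_nonneg _),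
      ← ENNReal.ofReal_add (by positivity) (by positivity)]
    refine ENNReal.ofReal_le_ofReal ((norm_inner_le_norm p q).trans ?_)
    nlinarith [sq_nonneg (‖p‖ - ‖q‖), sq_nonneg ‖p‖, sq_nonneg ‖q‖]
  refine (ENNReal.tsum_le_tsum key).trans_lt ?_
  rw [ENNReal.tsum_add, ENNReal.add_lt_top]
  exact ⟨(tsum_enorm_sq_comp_le b T _).trans_lt
      (ENNReal.mul_lt_top (ENNReal.pow_lt_top enorm_lt_top) hT),
    (tsum_enorm_sq_comp_le b T _).trans_lt
      (ENNReal.mul_lt_top (ENNReal.pow_lt_top enorm_lt_top) hT)⟩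

theorem ofReal_re_le_enorm (z : ℂ) : ENNReal.ofReal z.re ≤ ‖z‖ₑ := by
  rw [← ofReal_norm]
  exact ENNReal.ofReal_le_ofReal (Complex.re_le_norm z)

theorem traceNorm_add_lt_top {S T : H →L[ℂ] H} (hS : traceNorm S < ⊤) (hT : traceNorm T < ⊤) :
    traceNorm (S + T) < ⊤ := by
  obtain ⟨U, -, hU⟩ := exists_polar (S + T)
  refine lt_of_le_of_lt ?_ (ENNReal.add_lt_top.2
    ⟨tsum_enorm_inner_lt_top (stdBasis H) hS U (ContinuousLinearMap.id ℂ H),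
      tsum_enorm_inner_lt_top (stdBasis H) hT U (ContinuousLinearMap.id ℂ H)⟩)
  rw [← ENNReal.tsum_add, traceNorm]
  refine ENNReal.tsum_le_tsum fun i => (ofReal_re_le_enorm _).trans ?_
  rw [← hU, ContinuousLinearMap.comp_apply, ContinuousLinearMap.adjoint_inner_right,
    _root_.add_apply, inner_add_right]
  exact enorm_add_le _ _

/-- Compressions `V† T W` of trace-class operators are trace class. -/
theorem traceNorm_compression_lt_top {T : H →L[ℂ] H} (hT : traceNorm T < ⊤) (V W : K →L[ℂ] H) :
    traceNorm (ContinuousLinearMap.adjoint V ∘L T ∘L W) < ⊤ := by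
  obtain ⟨U, -, hU⟩ := exists_polar (ContinuousLinearMap.adjoint V ∘L T ∘L W)
  refine lt_of_le_of_lt ?_ (tsum_enorm_inner_lt_top (stdBasis K) hT (V ∘L U) W)
  rw [traceNorm]
  refine ENNReal.tsum_le_tsum fun i => (ofReal_re_le_enorm _).trans ?_
  rw [← hU]
  simp only [ContinuousLinearMap.comp_apply, ContinuousLinearMap.adjoint_inner_right]
  exact le_rfl

theorem traceNorm_zero : traceNorm (0 : H →L[ℂ] H) = 0 := by
  simp [traceNorm]

/-- The space `𝔗(H)` of trace-class operators on `H`. -/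
def TraceClass (H : Type u) [NormedAddCommGroup H] [InnerProductSpace ℂ H] [CompleteSpace H] :
    Submodule ℂ (H →L[ℂ] H) where
  carrier := {T | traceNorm T < ⊤}
  add_mem' := traceNorm_add_lt_top
  zero_mem' := by
    change traceNorm (0 : H →L[ℂ] H) < ⊤
    rw [traceNorm_zero]; exact ENNReal.zero_lt_top
  smul_mem' c T hT := by
    have h := traceNorm_compression_lt_top (T := T) hT (ContinuousLinearMap.id ℂ H)
      (c • ContinuousLinearMap.id ℂ H)
    have h2 : ContinuousLinearMap.adjoint (ContinuousLinearMap.id ℂ H) ∘L T ∘L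
        (c • ContinuousLinearMap.id ℂ H) = c • T := by
      have h3 : ContinuousLinearMap.adjoint (ContinuousLinearMap.id ℂ H) =
          ContinuousLinearMap.id ℂ H := by
        rw [← ContinuousLinearMap.one_def, ← ContinuousLinearMap.star_eq_adjoint, star_one]
      rw [h3]; ext x; simp
    rwa [h2] at h

/-- `ρ` is a quantum state: a positive trace-class operator with unit trace. -/
def IsState (ρ : TraceClass H) : Prop :=
  (ρ : H →L[ℂ] H).IsPositive ∧ trace (ρ : H →L[ℂ] H) = 1

end TraceClass

section Superoperators

variable (A : Type u) [NormedAddCommGroup A] [InnerProductSpace ℂ A] [CompleteSpace A]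
variable (B : Type v) [NormedAddCommGroup B] [InnerProductSpace ℂ B] [CompleteSpace B]

/-- Linear superoperators `𝔗(A) → 𝔗(B)`. -/
abbrev Superoperator : Type (max u v) := TraceClass A →ₗ[ℂ] TraceClass B

variable {A B}

/-- `Φ` maps Hermitian operators to Hermitian operators. -/
def HermitianPreserving (Φ : Superoperator A B) : Prop :=
  ∀ T : TraceClass A, IsSelfAdjoint (T : A →L[ℂ] A) → IsSelfAdjoint (Φ T : B →L[ℂ] B)

/-- The norm of `Φ` as an operator between the Banach spaces `𝔗(A)` and `𝔗(B)` is at most `C`. -/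
def OpNormLE (Φ : Superoperator A B) (C : ℝ≥0∞) : Prop :=
  ∀ T : TraceClass A, traceNorm (Φ T : B →L[ℂ] B) ≤ C * traceNorm (T : A →L[ℂ] A)

/-- The operator on `Hⁿ` with operator entries `T i j` is positive. -/
def BlockPositive {H : Type u} [NormedAddCommGroup H] [InnerProductSpace ℂ H] {n : ℕ}
    (T : Fin n → Fin n → (H →L[ℂ] H)) : Prop :=
  ∀ x : Fin n → H, 0 ≤ ∑ i, ∑ j, ⟪x i, T i j (x j)⟫_ℂ

/-- Complete positivity: every amplification `Φ ⊗ id` on `n × n` operator matrices preserves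
positivity. -/
def CompletelyPositive (Φ : Superoperator A B) : Prop :=
  ∀ (n : ℕ) (T : Fin n → Fin n → TraceClass A),
    BlockPositive (fun i j => (T i j : A →L[ℂ] A)) →
      BlockPositive (fun i j => (Φ (T i j) : B →L[ℂ] B))

def TracePreserving (Φ : Superoperator A B) : Prop :=
  ∀ T : TraceClass A, trace (Φ T : B →L[ℂ] B) = trace (T : A →L[ℂ] A)

/-- Quantum channels: completely positive trace-preserving superoperators. -/
def IsChannel (Φ : Superoperator A B) : Prop :=
  CompletelyPositive Φ ∧ TracePreserving Φ

end Superoperators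

section Composite

variable {A : Type u} [NormedAddCommGroup A] [InnerProductSpace ℂ A] [CompleteSpace A]
variable {B : Type v} [NormedAddCommGroup B] [InnerProductSpace ℂ B] [CompleteSpace B]
variable {R : Type w} [NormedAddCommGroup R] [InnerProductSpace ℂ R] [CompleteSpace R]

/-- The Hilbert space tensor product of `A` and `R`. -/
abbrev HilbertTensor (A : Type u) [NormedAddCommGroup A] [InnerProductSpace ℂ A]
    (R : Type w) [NormedAddCommGroup R] [InnerProductSpace ℂ R] : Type (max u w) :=
  UniformSpace.Completion (A ⊗[ℂ] R)

/-- The operator `I_A ⊗ |r⟩ : a ↦ a ⊗ r`. -/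
def tensorRight (A : Type u) [NormedAddCommGroup A] [InnerProductSpace ℂ A] (r : R) :
    A →L[ℂ] HilbertTensor A R :=
  UniformSpace.Completion.toComplL ∘L (TensorProduct.mkL ℂ A R).flip r

/-- The operator `|a⟩ ⊗ I_R : r ↦ a ⊗ r`. -/
def tensorLeft (R : Type w) [NormedAddCommGroup R] [InnerProductSpace ℂ R] (a : A) :
    R →L[ℂ] HilbertTensor A R :=
  UniformSpace.Completion.toComplL ∘L TensorProduct.mkL ℂ A R a

/-- The trace-class operator `(I_A ⊗ ⟨r|) T (I_A ⊗ |s⟩)` on `A`: the `(r, s)` entry of `T`. -/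
def entry (r s : R) (T : TraceClass (HilbertTensor A R)) : TraceClass A :=
  ⟨ContinuousLinearMap.adjoint (tensorRight A r) ∘L T.1 ∘L tensorRight A s,
    traceNorm_compression_lt_top T.2 (tensorRight A r) (tensorRight A s)⟩

/-- `σ = (Φ ⊗ id_R)(ρ)`. The map `Φ ⊗ id_R` acts on `ρ` entrywise, and a trace-class operator is
determined by its entries, so there is at most one such `σ`; on `ρ = X ⊗ Y` it is `Φ(X) ⊗ Y`. -/
def IsAmpliation (Φ : Superoperator A B) (ρ : TraceClass (HilbertTensor A R))
    (σ : TraceClass (HilbertTensor B R)) : Prop :=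
  ∀ r s : R, entry r s σ = Φ (entry r s ρ)

/-- `‖(Φ ⊗ id_R)(ρ)‖₁`, with the value `∞` if `(Φ ⊗ id_R)(ρ)` does not exist as a trace-class
operator (which can only happen if `Φ` is not completely bounded). -/
def ampliationNorm (Φ : Superoperator A B) (ρ : TraceClass (HilbertTensor A R)) : ℝ≥0∞ :=
  ⨅ (σ : TraceClass (HilbertTensor B R)) (_ : IsAmpliation Φ ρ σ),
    traceNorm (σ : HilbertTensor B R →L[ℂ] HilbertTensor B R)

/-- `ω = Tr_R ρ`, i.e. `⟨a, ω b⟩ = Tr (⟨a| ⊗ I_R) ρ (|b⟩ ⊗ I_R)` for all `a, b`. -/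
def IsPartialTrace (ρ : TraceClass (HilbertTensor A R)) (ω : TraceClass A) : Prop :=
  ∀ a b : A, ⟪a, (ω : A →L[ℂ] A) b⟫_ℂ =
    trace (ContinuousLinearMap.adjoint (tensorLeft R a) ∘L
      (ρ : HilbertTensor A R →L[ℂ] HilbertTensor A R) ∘L tensorLeft R b)

end Composite

section Energy

variable {A : Type u} [NormedAddCommGroup A] [InnerProductSpace ℂ A] [CompleteSpace A]

/-- A Hamiltonian: a densely defined positive self-adjoint operator, possibly unbounded. -/
structure IsHamiltonian (H : A →ₗ.[ℂ] A) : Prop where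
  dense_domain : Dense (H.domain : Set A)
  isSelfAdjoint : IsSelfAdjoint H
  nonneg : ∀ x : H.domain, 0 ≤ ⟪(x : A), H x⟫_ℂ

/-- The spectrum of `H`: those `z` for which `H - z` has no bounded everywhere defined inverse. -/
def unboundedSpectrum (H : A →ₗ.[ℂ] A) : Set ℂ :=
  {z | ¬ ∃ S : A →L[ℂ] A, (∀ y : A, (S y, y + z • S y) ∈ H.graph) ∧
      ∀ x : H.domain, S (H x - z • (x : A)) = x}

/-- The infimum of the (real) spectrum of `H`. -/
def groundEnergy (H : A →ₗ.[ℂ] A) : EReal :=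
  sInf {e : EReal | ∃ t : ℝ, (t : ℂ) ∈ unboundedSpectrum H ∧ e = (t : EReal)}

/-- `P` is the spectral projector of the positive self-adjoint operator `H` for the interval
`[0, t]`: the orthogonal projector that reduces `H`, with `H ≤ t` on its range and `H > t` on the
complement of its range. -/
structure IsSpectralProjector (H : A →ₗ.[ℂ] A) (t : ℝ) (P : A →L[ℂ] A) : Prop where
  isStarProjection : IsStarProjection P
  commutes : ∀ x y : A, (x, y) ∈ H.graph → (P x, P y) ∈ H.graph
  le_on_range : ∀ x : A, ∃ y : A, (P x, y) ∈ H.graph ∧ (⟪P x, y⟫_ℂ).re ≤ t * ‖P x‖ ^ 2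
  lt_off_range : ∀ x y : A, (x, y) ∈ H.graph → P x = 0 → x ≠ 0 →
    t * ‖x‖ ^ 2 < (⟪x, y⟫_ℂ).re

/-- The mean energy `Tr H ω = sup_n Tr (Pₙ H ω) ∈ [0, ∞]`, where `Pₙ` is the spectral projector of
`H` for `[0, n]`; here `K` is the bounded operator `H Pₙ`. -/
def energy (H : A →ₗ.[ℂ] A) (ω : A →L[ℂ] A) : ℝ≥0∞ :=
  ⨆ (n : ℕ) (P : A →L[ℂ] A) (K : A →L[ℂ] A) (_ : IsSpectralProjector H n P)
    (_ : ∀ x, (P x, K x) ∈ H.graph), ENNReal.ofReal (trace (K ∘L ω)).re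

/-- `H` has discrete spectrum of finite multiplicity tending to `+∞`: there is an orthonormal basis
of eigenvectors whose eigenvalues, listed with multiplicity, tend to `+∞`. -/
def HasDiscreteSpectrum (H : A →ₗ.[ℂ] A) : Prop :=
  ∃ (τ : HilbertBasis ℕ ℂ A) (e : ℕ → ℝ),
    (∀ k, (τ k, (e k : ℂ) • τ k) ∈ H.graph) ∧ Filter.Tendsto e Filter.atTop Filter.atTop

end Energy

section Norms

variable {A : Type u} [NormedAddCommGroup A] [InnerProductSpace ℂ A] [CompleteSpace A]
variable {B : Type v} [NormedAddCommGroup B] [InnerProductSpace ℂ B] [CompleteSpace B]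

/-- The diamond norm, with reference system `R`. -/
def diamondNorm (R : Type w) [NormedAddCommGroup R] [InnerProductSpace ℂ R] [CompleteSpace R]
    (Φ : Superoperator A B) : ℝ≥0∞ :=
  ⨆ (ρ : TraceClass (HilbertTensor A R)) (_ : IsState ρ), ampliationNorm Φ ρ

/-- The energy-constrained diamond norm: the supremum of `‖(Φ ⊗ id_R)(ρ)‖₁` over the states `ρ` of
`AR` with `Tr H ρ_A ≤ E`. -/
def ecdNorm (R : Type w) [NormedAddCommGroup R] [InnerProductSpace ℂ R] [CompleteSpace R]
    (H : A →ₗ.[ℂ] A) (E : ℝ) (Φ : Superoperator A B) : ℝ≥0∞ :=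
  ⨆ (ρ : TraceClass (HilbertTensor A R)) (_ : IsState ρ)
    (_ : ∃ ω : TraceClass A, IsPartialTrace ρ ω ∧ energy H ω ≤ ENNReal.ofReal E),
    ampliationNorm Φ ρ

/-- Strong convergence: `Φ n (ρ) → Φ₀(ρ)` in trace norm for every state `ρ`. -/
def StrongConvergence (Φ : ℕ → Superoperator A B) (Φ₀ : Superoperator A B) : Prop :=
  ∀ ρ : TraceClass A, IsState ρ →
    Filter.Tendsto (fun n => traceNorm ((Φ n ρ - Φ₀ ρ : TraceClass B) : B →L[ℂ] B))
      Filter.atTop (nhds 0)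

/-- Convergence in the energy-constrained diamond norm. -/
def EcdConvergence (R : Type w) [NormedAddCommGroup R] [InnerProductSpace ℂ R] [CompleteSpace R]
    (H : A →ₗ.[ℂ] A) (E : ℝ) (Φ : ℕ → Superoperator A B) (Φ₀ : Superoperator A B) : Prop :=
  Filter.Tendsto (fun n => ecdNorm R H E (Φ n - Φ₀)) Filter.atTop (nhds 0)

/-- The strong convergence topology, defined by the seminorms `Φ ↦ ‖Φ(ρ)‖₁`, `ρ` a state. -/
abbrev strongTopology (A : Type u) [NormedAddCommGroup A] [InnerProductSpace ℂ A] [CompleteSpace A]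
    (B : Type v) [NormedAddCommGroup B] [InnerProductSpace ℂ B] [CompleteSpace B] :
    TopologicalSpace (Superoperator A B) :=
  TopologicalSpace.generateFrom
    {U | ∃ (ρ : TraceClass A) (Φ₀ : Superoperator A B) (ε : ℝ≥0∞), IsState ρ ∧ 0 < ε ∧
      U = {Φ | traceNorm ((Φ ρ - Φ₀ ρ : TraceClass B) : B →L[ℂ] B) < ε}}

/-- The topology generated by the energy-constrained diamond norm (by its open balls). -/
abbrev ecdTopology (B : Type v) [NormedAddCommGroup B] [InnerProductSpace ℂ B] [CompleteSpace B]
    (R : Type w) [NormedAddCommGroup R] [InnerProductSpace ℂ R] [CompleteSpace R]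
    (H : A →ₗ.[ℂ] A) (E : ℝ) : TopologicalSpace (Superoperator A B) :=
  TopologicalSpace.generateFrom
    {U | ∃ (Φ₀ : Superoperator A B) (ε : ℝ≥0∞), 0 < ε ∧ U = {Φ | ecdNorm R H E (Φ - Φ₀) < ε}}

/-- The strong convergence topology and the topology of the energy-constrained diamond norm induce
the same topology on the set `𝓢` of superoperators. -/
def SameTopologyOn (R : Type w) [NormedAddCommGroup R] [InnerProductSpace ℂ R] [CompleteSpace R]
    (H : A →ₗ.[ℂ] A) (E : ℝ) (𝓢 : Set (Superoperator A B)) : Prop :=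
  TopologicalSpace.induced ((↑) : 𝓢 → Superoperator A B) (ecdTopology B R H E) =
    TopologicalSpace.induced ((↑) : 𝓢 → Superoperator A B) (strongTopology A B)

end Norms

end ECD

end

set_option linter.unusedSectionVars false

/-! Trace-norm estimates reduce to Hilbert-Schmidt sums. The bound `‖S†T‖₁² ≤ ‖S‖₂²‖T‖₂²`
(`traceNorm_adjoint_comp_sq_le`) and the factorization of every `T` as `S₁†S₂` with `‖S₁‖₂², ‖S₂‖₂²
≤ ‖T‖₁` (`exists_hs_factorization`) yield the triangle inequality, compressions, tensor products and
truncation errors.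

From energy-constrained to strong convergence: since `E` exceeds the bottom of the spectrum, some
unit vector `x₀` of the domain has energy below `E` (`exists_inner_lt`). For any unit `x` of the
domain, a mixture of `|x₀⟩⟨x₀|` with a small weight `p > 0` of `|x⟩⟨x|` obeys the constraint, so
`‖Φ(|x⟩⟨x|)‖₁` is at most a constant, depending on `x`, times the energy-constrained norm. Density
of the domain and finite-rank approximation of states extend this to all states, up to an error
proportional to the operator norm of `Φ` (`EcdControlled`, `ecdControlled_of_isPositive`). The same
control gives definiteness of the norm.

From strong to energy-constrained convergence, with an eigenbasis `τ`: by Markov's inequality an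
admissible state has marginal weight at most `E / N` on eigenvectors of energy at least `N`. Cutting
off to finitely many `τ k` therefore changes the state little in trace norm, uniformly over
admissible states. What remains is a finite sum of operators `|τ k⟩⟨τ l| ⊗ ρ_kl`, on which `Φ ⊗ id`
is explicit, and each `|τ k⟩⟨τ l|` is a linear combination of states (`ecdNorm_le_of_discrete`).

For channels both arguments need a finite diamond norm. As `Φ ⊗ id` is defined only through entries,
the image of a state must first be constructed: complete positivity makes the entries a positive
form on the algebraic tensor product, which is bounded and hence represented by a positive operator
of trace one (`IsChannel.diamondNorm_le`). -/

noncomputable section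

namespace ECD

universe u v w

/-! ### Hilbert-Schmidt sums and the calculus of the trace norm. -/

section HilbertSchmidt

variable {H : Type*} [NormedAddCommGroup H] [InnerProductSpace ℂ H] [CompleteSpace H]
variable {K : Type*} [NormedAddCommGroup K] [InnerProductSpace ℂ K] [CompleteSpace K]
variable {G : Type*} [NormedAddCommGroup G] [InnerProductSpace ℂ G] [CompleteSpace G]

theorem enorm_adjoint (S : H →L[ℂ] K) : ‖ContinuousLinearMap.adjoint S‖ₑ = ‖S‖ₑ := by
  rw [← ofReal_norm, ← ofReal_norm, LinearIsometryEquiv.norm_map]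

theorem enorm_inner_le_enorm (x y : H) : ‖⟪x, y⟫_ℂ‖ₑ ≤ ‖x‖ₑ * ‖y‖ₑ := by
  simp only [enorm_eq_nnnorm]
  exact_mod_cast nnnorm_inner_le_nnnorm x y

/-- The squared Hilbert-Schmidt norm. -/
def hsSq (S : H →L[ℂ] K) : ℝ≥0∞ := ∑' i, ‖S (stdBasis H i)‖ₑ ^ 2

theorem hsSq_eq {ι : Type*} (b : HilbertBasis ι ℂ H) (S : H →L[ℂ] K) :
    hsSq S = ∑' i, ‖S (b i)‖ₑ ^ 2 := by
  rw [hsSq, tsum_enorm_sq_adjoint (stdBasis H) (stdBasis K) S,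
    tsum_enorm_sq_adjoint b (stdBasis K) S]

theorem hsSq_adjoint (S : H →L[ℂ] K) : hsSq (ContinuousLinearMap.adjoint S) = hsSq S :=
  (tsum_enorm_sq_adjoint (stdBasis H) (stdBasis K) S).symm

theorem hsSq_comp_left_le (X : K →L[ℂ] G) (S : H →L[ℂ] K) :
    hsSq (X ∘L S) ≤ ‖X‖ₑ ^ 2 * hsSq S := by
  rw [hsSq, hsSq, ← ENNReal.tsum_mul_left]
  refine ENNReal.tsum_le_tsum fun i => ?_
  rw [← mul_pow]
  gcongr
  exact ContinuousLinearMap.le_opENorm _ _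

theorem hsSq_comp_right_le (S : K →L[ℂ] G) (X : H →L[ℂ] K) :
    hsSq (S ∘L X) ≤ ‖X‖ₑ ^ 2 * hsSq S := by
  rw [← hsSq_adjoint, ← hsSq_adjoint S, ContinuousLinearMap.adjoint_comp, ← enorm_adjoint X]
  exact hsSq_comp_left_le _ _

theorem tsum_enorm_inner_sq_le {ι : Type*} (x y : ι → H) :
    (∑' i, ‖⟪x i, y i⟫_ℂ‖ₑ) ^ 2 ≤ (∑' i, ‖x i‖ₑ ^ 2) * ∑' i, ‖y i‖ₑ ^ 2 := by
  have key : ∀ s : Finset ι, (∑ i ∈ s, ‖⟪x i, y i⟫_ℂ‖ₑ) ^ 2 ≤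
      (∑' i, ‖x i‖ₑ ^ 2) * ∑' i, ‖y i‖ₑ ^ 2 := by
    intro s
    have h1 : (∑ i ∈ s, ‖⟪x i, y i⟫_ℂ‖₊) ^ 2 ≤ (∑ i ∈ s, ‖x i‖₊ ^ 2) * ∑ i ∈ s, ‖y i‖₊ ^ 2 := by
      refine le_trans ?_ (Finset.sum_mul_sq_le_sq_mul_sq s _ _)
      gcongr with i
      exact nnnorm_inner_le_nnnorm _ _
    have h2 : (∑ i ∈ s, ‖⟪x i, y i⟫_ℂ‖ₑ) ^ 2 ≤ (∑ i ∈ s, ‖x i‖ₑ ^ 2) * ∑ i ∈ s, ‖y i‖ₑ ^ 2 := by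
      simp only [enorm_eq_nnnorm]
      exact_mod_cast h1
    refine h2.trans ?_
    gcongr <;> exact ENNReal.sum_le_tsum s
  have hlim : Filter.Tendsto (fun s : Finset ι => (∑ i ∈ s, ‖⟪x i, y i⟫_ℂ‖ₑ) ^ 2) Filter.atTop
      (nhds ((∑' i, ‖⟪x i, y i⟫_ℂ‖ₑ) ^ 2)) :=
    ((ENNReal.continuous_pow 2).tendsto _).comp ENNReal.summable.hasSum
  exact le_of_tendsto' hlim key

/-- `exists_polar` provides no norm bound. Its `U` is isometric on the closure of the range of
`|T|`, because `‖|T| x‖ = ‖T x‖`, so composing it with the projection onto that closure yields a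
contraction, and both identities survive. -/
theorem exists_contraction_polar (T : H →L[ℂ] H) :
    ∃ U : H →L[ℂ] H, ‖U‖ₑ ≤ 1 ∧ U ∘L CFC.abs T = T ∧
      ContinuousLinearMap.adjoint U ∘L T = CFC.abs T := by
  obtain ⟨U, hU1, hU2⟩ := exists_polar T
  let A : H →L[ℂ] H := CFC.abs T
  have hAs : ContinuousLinearMap.adjoint A = A := by
    rw [← ContinuousLinearMap.star_eq_adjoint]
    exact (CFC.abs_nonneg T).isSelfAdjoint.star_eq
  let M : Submodule ℂ H := (LinearMap.range A.toLinearMap).topologicalClosure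
  have : CompleteSpace M := (Submodule.isClosed_topologicalClosure _).completeSpace_coe
  have hPA : ∀ x, M.starProjection (A x) = A x := fun x =>
    Submodule.starProjection_eq_self_iff.2 (Submodule.le_topologicalClosure _ ⟨x, rfl⟩)
  have hiso : ∀ x ∈ M, ‖U x‖ = ‖x‖ := by
    intro x hx
    refine closure_minimal (s := (LinearMap.range A.toLinearMap : Set H))
      (t := {x | ‖U x‖ = ‖x‖}) ?_ (isClosed_eq (by fun_prop) (by fun_prop)) hx
    rintro _ ⟨y, rfl⟩
    change ‖U (A y)‖ = ‖A y‖
    rw [norm_abs_apply, ← ContinuousLinearMap.comp_apply U, hU1]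
  refine ⟨U ∘L M.starProjection, ?_, ?_, ?_⟩
  · rw [← ofReal_norm]
    refine ENNReal.ofReal_le_one.2 (ContinuousLinearMap.opNorm_le_bound _ zero_le_one fun x => ?_)
    rw [ContinuousLinearMap.comp_apply, hiso _ (M.starProjection_apply_mem x), one_mul]
    exact (M.starProjection.le_of_opNorm_le M.starProjection_norm_le x).trans_eq (one_mul _)
  · ext x
    change U (M.starProjection (A x)) = T x
    rw [hPA, ← ContinuousLinearMap.comp_apply U, hU1]
  · ext x
    rw [ContinuousLinearMap.adjoint_comp, ← ContinuousLinearMap.star_eq_adjoint M.starProjection,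
      isSelfAdjoint_starProjection, ContinuousLinearMap.comp_assoc, hU2]
    exact hPA x

theorem tsum_enorm_inner_le {ι : Type*} (b : HilbertBasis ι ℂ H) (S T : H →L[ℂ] K) :
    (∑' i, ‖⟪S (b i), T (b i)⟫_ℂ‖ₑ) ^ 2 ≤ hsSq S * hsSq T := by
  rw [hsSq_eq b S, hsSq_eq b T]
  exact tsum_enorm_inner_sq_le _ _

/-- Hölder's inequality with exponents 2 and 2: writing `|S†T| = U†S†T`, the diagonal sum becomes a
sum of `⟨S U b, T b⟩`, to which Cauchy-Schwarz applies. The squared form avoids square roots in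
`ℝ≥0∞`. -/
theorem traceNorm_adjoint_comp_sq_le (S T : H →L[ℂ] K) :
    traceNorm (ContinuousLinearMap.adjoint S ∘L T) ^ 2 ≤ hsSq S * hsSq T := by
  obtain ⟨U, hU, -, hU2⟩ := exists_contraction_polar (ContinuousLinearMap.adjoint S ∘L T)
  have h1 : traceNorm (ContinuousLinearMap.adjoint S ∘L T) ≤
      ∑' i, ‖⟪(S ∘L U) (stdBasis H i), T (stdBasis H i)⟫_ℂ‖ₑ := by
    refine ENNReal.tsum_le_tsum fun i => (ofReal_re_le_enorm _).trans ?_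
    rw [← hU2]
    simp only [ContinuousLinearMap.comp_apply, ContinuousLinearMap.adjoint_inner_right]
    exact le_rfl
  calc _ ≤ (∑' i, ‖⟪(S ∘L U) (stdBasis H i), T (stdBasis H i)⟫_ℂ‖ₑ) ^ 2 := by gcongr
    _ ≤ hsSq (S ∘L U) * hsSq T := tsum_enorm_inner_le _ _ _
    _ ≤ hsSq S * hsSq T := by
      gcongr
      refine (hsSq_comp_right_le S U).trans ?_
      calc _ ≤ 1 ^ 2 * hsSq S := by gcongr
        _ = _ := by simp

theorem traceNorm_eq_hsSq_sqrt (T : H →L[ℂ] H) :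
    traceNorm T = hsSq (CFC.sqrt (CFC.abs T)) := by
  rw [traceNorm, hsSq]
  simp_rw [ofReal_inner_abs]

theorem adjoint_sqrt (T : H →L[ℂ] H) :
    ContinuousLinearMap.adjoint (CFC.sqrt T) = CFC.sqrt T := by
  rw [← ContinuousLinearMap.star_eq_adjoint]
  exact (CFC.sqrt_nonneg T).isSelfAdjoint.star_eq

/-- A converse to the Hölder bound: from `T = U|T|`, take `S₁ = |T|^{1/2} U†` and `S₂ = |T|^{1/2}`.
-/
theorem exists_hs_factorization (T : H →L[ℂ] H) :
    ∃ S₁ S₂ : H →L[ℂ] H, T = ContinuousLinearMap.adjoint S₁ ∘L S₂ ∧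
      hsSq S₁ ≤ traceNorm T ∧ hsSq S₂ ≤ traceNorm T := by
  obtain ⟨U, hU, hU1, -⟩ := exists_contraction_polar T
  refine ⟨CFC.sqrt (CFC.abs T) ∘L ContinuousLinearMap.adjoint U, CFC.sqrt (CFC.abs T), ?_, ?_, ?_⟩
  · rw [ContinuousLinearMap.adjoint_comp, ContinuousLinearMap.adjoint_adjoint, adjoint_sqrt,
      ContinuousLinearMap.comp_assoc, ← ContinuousLinearMap.mul_def (CFC.sqrt _),
      CFC.sqrt_mul_sqrt_self _ (CFC.abs_nonneg T), hU1]
  · rw [traceNorm_eq_hsSq_sqrt]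
    refine (hsSq_comp_right_le _ _).trans ?_
    rw [enorm_adjoint]
    calc _ ≤ 1 ^ 2 * hsSq (CFC.sqrt (CFC.abs T)) := by gcongr
      _ = _ := by simp
  · rw [traceNorm_eq_hsSq_sqrt]

theorem le_of_sq_le_mul_self {a b : ℝ≥0∞} (h : a ^ 2 ≤ b * b) : a ≤ b := by
  rw [← sq] at h
  exact (ENNReal.pow_le_pow_left_iff two_ne_zero).1 h

theorem tsum_enorm_inner_le_traceNorm {ι : Type*} (b : HilbertBasis ι ℂ K) (T : H →L[ℂ] H)
    (X Y : K →L[ℂ] H) :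
    ∑' i, ‖⟪X (b i), T (Y (b i))⟫_ℂ‖ₑ ≤ ‖X‖ₑ * ‖Y‖ₑ * traceNorm T := by
  obtain ⟨S₁, S₂, hT, h1, h2⟩ := exists_hs_factorization T
  apply le_of_sq_le_mul_self
  have h3 := tsum_enorm_inner_le b (S₁ ∘L X) (S₂ ∘L Y)
  rw [hT]
  simp only [ContinuousLinearMap.comp_apply, ContinuousLinearMap.adjoint_inner_right] at h3 ⊢
  refine h3.trans ?_
  rw [← hT]
  calc _ ≤ (‖X‖ₑ ^ 2 * traceNorm T) * (‖Y‖ₑ ^ 2 * traceNorm T) := by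
        gcongr
        · exact (hsSq_comp_right_le _ _).trans (by gcongr)
        · exact (hsSq_comp_right_le _ _).trans (by gcongr)
    _ = _ := by ring

/-- With `tsum_enorm_inner_contraction_le` this describes `‖T‖₁` by testing against contractions.
Norm inequalities can then be checked term by term, without comparing the absolute values of
different operators. -/
theorem traceNorm_le_of_forall_contraction (T : H →L[ℂ] H) (c : ℝ≥0∞)
    (h : ∀ U : H →L[ℂ] H, ‖U‖ₑ ≤ 1 → ∑' i, ‖⟪U (stdBasis H i), T (stdBasis H i)⟫_ℂ‖ₑ ≤ c) :
    traceNorm T ≤ c := by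
  obtain ⟨U, hU, -, hU2⟩ := exists_contraction_polar T
  refine le_trans ?_ (h U hU)
  refine ENNReal.tsum_le_tsum fun i => (ofReal_re_le_enorm _).trans ?_
  rw [← hU2]
  simp only [ContinuousLinearMap.comp_apply, ContinuousLinearMap.adjoint_inner_right]
  exact le_rfl

theorem tsum_enorm_inner_contraction_le (T U : H →L[ℂ] H) (hU : ‖U‖ₑ ≤ 1) :
    ∑' i, ‖⟪U (stdBasis H i), T (stdBasis H i)⟫_ℂ‖ₑ ≤ traceNorm T := by
  refine (tsum_enorm_inner_le_traceNorm (stdBasis H) T U (ContinuousLinearMap.id ℂ H)).trans ?_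
  calc _ ≤ 1 * 1 * traceNorm T := by
        gcongr
        rw [← ofReal_norm]
        exact ENNReal.ofReal_le_one.2 ContinuousLinearMap.norm_id_le
    _ = _ := by simp

theorem traceNorm_compression_le (T : H →L[ℂ] H) (V W : K →L[ℂ] H) :
    traceNorm (ContinuousLinearMap.adjoint V ∘L T ∘L W) ≤ ‖V‖ₑ * ‖W‖ₑ * traceNorm T := by
  refine traceNorm_le_of_forall_contraction _ _ fun U hU => ?_
  have h := tsum_enorm_inner_le_traceNorm (stdBasis K) T (V ∘L U) W
  simp only [ContinuousLinearMap.comp_apply, ContinuousLinearMap.adjoint_inner_right] at h ⊢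
  refine h.trans ?_
  gcongr
  calc ‖V ∘L U‖ₑ ≤ ‖V‖ₑ * ‖U‖ₑ := ContinuousLinearMap.opENorm_comp_le _ _
    _ ≤ ‖V‖ₑ * 1 := by gcongr
    _ = _ := mul_one _

theorem traceNorm_add_le (S T : H →L[ℂ] H) :
    traceNorm (S + T) ≤ traceNorm S + traceNorm T := by
  refine traceNorm_le_of_forall_contraction _ _ fun U hU => ?_
  refine le_trans ?_ (add_le_add (tsum_enorm_inner_contraction_le S U hU)
    (tsum_enorm_inner_contraction_le T U hU))
  rw [← ENNReal.tsum_add]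
  refine ENNReal.tsum_le_tsum fun i => ?_
  rw [_root_.add_apply, inner_add_right]
  exact enorm_add_le _ _

theorem traceNorm_smul_le (c : ℂ) (T : H →L[ℂ] H) : traceNorm (c • T) ≤ ‖c‖ₑ * traceNorm T := by
  refine traceNorm_le_of_forall_contraction _ _ fun U hU => ?_
  refine le_trans ?_ (mul_le_mul_right (tsum_enorm_inner_contraction_le T U hU) _)
  rw [← ENNReal.tsum_mul_left]
  refine ENNReal.tsum_le_tsum fun i => ?_
  rw [_root_.smul_apply, inner_smul_right, enorm_mul]

theorem traceNorm_neg (T : H →L[ℂ] H) : traceNorm (-T) = traceNorm T := by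
  have h : ∀ T : H →L[ℂ] H, traceNorm (-T) ≤ traceNorm T := fun T => by
    simpa using traceNorm_smul_le (-1) T
  exact le_antisymm (h T) (by simpa using h (-T))

theorem traceNorm_sub_le (S T : H →L[ℂ] H) :
    traceNorm (S - T) ≤ traceNorm S + traceNorm T := by
  rw [sub_eq_add_neg, ← traceNorm_neg T]
  exact traceNorm_add_le _ _

/-- The trace norm dominates the operator norm, since each factor in `T = S₁†S₂` satisfies `‖S x‖ ≤
‖x‖ ‖S‖₂`. -/
theorem enorm_inner_le_traceNorm (T : H →L[ℂ] H) (x y : H) :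
    ‖⟪x, T y⟫_ℂ‖ₑ ≤ ‖x‖ₑ * ‖y‖ₑ * traceNorm T := by
  have hS : ∀ S : H →L[ℂ] H, ∀ x, ‖S x‖ₑ ^ 2 ≤ ‖x‖ₑ ^ 2 * hsSq S := by
    intro S x
    rw [← hsSq_adjoint, hsSq, ← tsum_enorm_sq_inner (stdBasis H), ← ENNReal.tsum_mul_left]
    refine ENNReal.tsum_le_tsum fun i => ?_
    rw [← ContinuousLinearMap.adjoint_inner_left, ← mul_pow]
    gcongr
    rw [mul_comm]
    exact enorm_inner_le_enorm _ _
  obtain ⟨S₁, S₂, hT, h1, h2⟩ := exists_hs_factorization T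
  apply le_of_sq_le_mul_self
  rw [hT, ContinuousLinearMap.comp_apply, ContinuousLinearMap.adjoint_inner_right, ← hT]
  calc ‖⟪S₁ x, S₂ y⟫_ℂ‖ₑ ^ 2 ≤ (‖S₁ x‖ₑ * ‖S₂ y‖ₑ) ^ 2 := by
        gcongr; exact enorm_inner_le_enorm _ _
    _ = ‖S₁ x‖ₑ ^ 2 * ‖S₂ y‖ₑ ^ 2 := by ring
    _ ≤ (‖x‖ₑ ^ 2 * traceNorm T) * (‖y‖ₑ ^ 2 * traceNorm T) := by
      gcongr
      · exact (hS _ _).trans (by gcongr)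
      · exact (hS _ _).trans (by gcongr)
    _ = _ := by ring

theorem eq_zero_of_traceNorm_eq_zero {T : H →L[ℂ] H} (hT : traceNorm T = 0) : T = 0 := by
  ext x
  have h := enorm_inner_le_traceNorm T (T x) x
  rw [hT, mul_zero, nonpos_iff_eq_zero, enorm_eq_zero] at h
  exact inner_self_eq_zero.1 h

theorem traceNorm_adjoint_comp_self (S : H →L[ℂ] K) :
    traceNorm (ContinuousLinearMap.adjoint S ∘L S) = hsSq S := by
  have hp : (0 : H →L[ℂ] H) ≤ ContinuousLinearMap.adjoint S ∘L S :=
    (ContinuousLinearMap.nonneg_iff_isPositive _).2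
      (ContinuousLinearMap.isPositive_adjoint_comp_self S)
  rw [traceNorm, CFC.abs_of_nonneg _ hp, hsSq]
  congr 1
  funext i
  rw [ContinuousLinearMap.comp_apply, ContinuousLinearMap.adjoint_inner_right,
    inner_self_eq_norm_sq_to_K, ← ofReal_norm, ← ENNReal.ofReal_pow (norm_nonneg _)]
  congr 1
  norm_cast

theorem exists_adjoint_comp_self {T : H →L[ℂ] H} (hT : T.IsPositive) :
    ∃ S : H →L[ℂ] H, ContinuousLinearMap.adjoint S = S ∧ S ∘L S = T :=
  ⟨CFC.sqrt T, adjoint_sqrt T, CFC.sqrt_mul_sqrt_self T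
    ((ContinuousLinearMap.nonneg_iff_isPositive _).2 hT)⟩

/-- With `T = S²` and `S` self-adjoint, the diagonal sum is the Hilbert-Schmidt sum of `S`, which
does not depend on the basis. This allows bases adapted to a tensor product or to a Hamiltonian. -/
theorem traceNorm_of_isPositive {T : H →L[ℂ] H} (hT : T.IsPositive) {ι : Type*}
    (b : HilbertBasis ι ℂ H) :
    traceNorm T = ∑' i, ENNReal.ofReal (⟪b i, T (b i)⟫_ℂ).re := by
  obtain ⟨S, hS, rfl⟩ := exists_adjoint_comp_self hT
  have h := traceNorm_adjoint_comp_self S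
  rw [hS] at h
  rw [h, hsSq_eq b]
  congr 1
  funext i
  rw [ContinuousLinearMap.comp_apply, ← ContinuousLinearMap.adjoint_inner_left, hS,
    inner_self_eq_norm_sq_to_K, ← ofReal_norm, ← ENNReal.ofReal_pow (norm_nonneg _)]
  congr 1
  norm_cast

theorem hasSum_trace {T : H →L[ℂ] H} (hT : traceNorm T < ⊤) :
    HasSum (fun i => ⟪stdBasis H i, T (stdBasis H i)⟫_ℂ) (trace T) := by
  apply Summable.hasSum
  apply Summable.of_enorm
  exact (tsum_enorm_inner_lt_top (stdBasis H) hT (ContinuousLinearMap.id ℂ H)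
    (ContinuousLinearMap.id ℂ H)).ne

theorem trace_add {S T : H →L[ℂ] H} (hS : traceNorm S < ⊤) (hT : traceNorm T < ⊤) :
    trace (S + T) = trace S + trace T := by
  rw [← ((hasSum_trace hS).add (hasSum_trace hT)).tsum_eq]
  simp [trace]

theorem trace_smul (c : ℂ) (T : H →L[ℂ] H) : trace (c • T) = c * trace T := by
  simp [trace, tsum_mul_left]

theorem trace_of_isPositive {T : H →L[ℂ] H} (hT : T.IsPositive) :
    trace T = ((traceNorm T).toReal : ℂ) := by
  have hre : ∀ i, ⟪stdBasis H i, T (stdBasis H i)⟫_ℂ =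
      ((⟪stdBasis H i, T (stdBasis H i)⟫_ℂ).re : ℂ) := fun i =>
    Complex.eq_re_of_ofReal_le (r := 0) (by simpa using hT.inner_nonneg_right (stdBasis H i))
  rw [traceNorm_of_isPositive hT (stdBasis H), ENNReal.tsum_toReal_eq (fun i => by simp)]
  rw [trace]
  conv_lhs => enter [1, i]; rw [hre]
  rw [← Complex.ofReal_tsum]
  congr 2
  funext i
  rw [ENNReal.toReal_ofReal]
  exact hT.re_inner_nonneg_right _

theorem trace_rankOne (x y : H) : trace (InnerProductSpace.rankOne ℂ x y) = ⟪y, x⟫_ℂ := by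
  rw [trace, ← ((stdBasis H).hasSum_inner_mul_inner y x).tsum_eq]
  simp

theorem hsSq_rankOne (x : H) (y : K) :
    hsSq (InnerProductSpace.rankOne ℂ x y) = ‖x‖ₑ ^ 2 * ‖y‖ₑ ^ 2 := by
  rw [hsSq, ← tsum_enorm_sq_inner (stdBasis K) y, ← ENNReal.tsum_mul_left]
  congr 1
  funext i
  rw [InnerProductSpace.rankOne_apply, enorm_smul, mul_pow, mul_comm, ← inner_conj_symm,
    RCLike.enorm_conj]

theorem traceNorm_rankOne_le (x y : H) :
    traceNorm (InnerProductSpace.rankOne ℂ x y) ≤ ‖x‖ₑ * ‖y‖ₑ := by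
  rcases eq_or_ne x 0 with rfl | hx
  · simp [traceNorm_zero]
  let e : H := (‖x‖⁻¹ : ℂ) • x
  have hen' : ‖e‖ = 1 := norm_smul_inv_norm hx
  have he : ⟪e, e⟫_ℂ = 1 := inner_self_eq_one_of_norm_eq_one hen'
  have hen : ‖e‖ₑ = 1 := by rw [← ofReal_norm, hen', ENNReal.ofReal_one]
  -- Passing through the unit vector `e` writes `|x⟩⟨y|` as `(|e⟩⟨x|)† |e⟩⟨y|`, whose factors have
  -- Hilbert-Schmidt norms `‖x‖` and `‖y‖`.
  have hxy : InnerProductSpace.rankOne ℂ x y = ContinuousLinearMap.adjoint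
      (InnerProductSpace.rankOne ℂ e x) ∘L InnerProductSpace.rankOne ℂ e y := by
    rw [InnerProductSpace.adjoint_rankOne, InnerProductSpace.rankOne_comp_rankOne, he, one_smul]
  apply le_of_sq_le_mul_self
  rw [hxy]
  refine (traceNorm_adjoint_comp_sq_le _ _).trans_eq ?_
  rw [hsSq_rankOne, hsSq_rankOne, hen]
  ring

end HilbertSchmidt

/-! ### Hilbert space tensor products: simple tensors, product bases, operator entries. -/

section Tensor

variable {A : Type u} [NormedAddCommGroup A] [InnerProductSpace ℂ A] [CompleteSpace A]
variable {B : Type v} [NormedAddCommGroup B] [InnerProductSpace ℂ B] [CompleteSpace B]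
variable {R : Type w} [NormedAddCommGroup R] [InnerProductSpace ℂ R] [CompleteSpace R]

/-- The simple tensor `a ⊗ r` in the Hilbert space tensor product. -/
def simple (a : A) (r : R) : HilbertTensor A R := ((a ⊗ₜ[ℂ] r : A ⊗[ℂ] R) : HilbertTensor A R)

theorem tensorRight_apply (a : A) (r : R) : tensorRight A r a = simple a r := rfl

theorem tensorLeft_apply (a : A) (r : R) : tensorLeft R a r = simple a r := rfl

theorem inner_simple (a b : A) (r s : R) :
    ⟪simple a r, simple b s⟫_ℂ = ⟪a, b⟫_ℂ * ⟪r, s⟫_ℂ := by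
  rw [simple, simple, UniformSpace.Completion.inner_coe, TensorProduct.inner_tmul]

theorem norm_simple (a : A) (r : R) : ‖simple a r‖ = ‖a‖ * ‖r‖ := by
  rw [simple, UniformSpace.Completion.norm_coe, TensorProduct.norm_tmul]

theorem enorm_simple (a : A) (r : R) : ‖simple a r‖ₑ = ‖a‖ₑ * ‖r‖ₑ := by
  rw [← ofReal_norm, norm_simple, ENNReal.ofReal_mul (norm_nonneg _), ofReal_norm, ofReal_norm]

theorem enorm_le_of_bound {X Y : Type*} [NormedAddCommGroup X] [NormedSpace ℂ X]
    [NormedAddCommGroup Y] [NormedSpace ℂ Y] (S : X →L[ℂ] Y) (c : ℝ) (hc : 0 ≤ c)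
    (h : ∀ x, ‖S x‖ ≤ c * ‖x‖) : ‖S‖ₑ ≤ ENNReal.ofReal c := by
  rw [← ofReal_norm]
  exact ENNReal.ofReal_le_ofReal (S.opNorm_le_bound hc h)

theorem enorm_tensorRight_le (r : R) : ‖tensorRight A r‖ₑ ≤ ‖r‖ₑ := by
  rw [← ofReal_norm r]
  refine enorm_le_of_bound _ _ (norm_nonneg _) fun a => ?_
  rw [tensorRight_apply, norm_simple, mul_comm]

theorem enorm_tensorLeft_le (a : A) : ‖tensorLeft R a‖ₑ ≤ ‖a‖ₑ := by
  rw [← ofReal_norm a]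
  refine enorm_le_of_bound _ _ (norm_nonneg _) fun r => ?_
  rw [tensorLeft_apply, norm_simple]

theorem tensorRight_add (r s : R) : tensorRight A (r + s) = tensorRight A r + tensorRight A s := by
  simp only [tensorRight, map_add, ContinuousLinearMap.comp_add]

theorem tensorRight_smul (c : ℂ) (r : R) : tensorRight A (c • r) = c • tensorRight A r := by
  simp only [tensorRight, map_smul, ContinuousLinearMap.comp_smul]

theorem adjoint_tensorRight_comp (r s : R) :
    ContinuousLinearMap.adjoint (tensorRight A r) ∘L tensorRight A s =
      ⟪r, s⟫_ℂ • ContinuousLinearMap.id ℂ A := by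
  refine ContinuousLinearMap.ext fun a => ext_inner_left ℂ fun b => ?_
  rw [ContinuousLinearMap.comp_apply, ContinuousLinearMap.adjoint_inner_right, tensorRight_apply,
    tensorRight_apply, inner_simple, _root_.smul_apply, inner_smul_right, mul_comm]
  rfl

theorem adjoint_tensorLeft_comp_tensorRight (a : A) (r : R) :
    ContinuousLinearMap.adjoint (tensorLeft R a) ∘L tensorRight A r =
      InnerProductSpace.rankOne ℂ r a := by
  refine ContinuousLinearMap.ext fun b => ext_inner_left ℂ fun s => ?_
  rw [ContinuousLinearMap.comp_apply, ContinuousLinearMap.adjoint_inner_right, tensorLeft_apply,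
    tensorRight_apply, inner_simple, InnerProductSpace.rankOne_apply, inner_smul_right]

theorem adjoint_tensorRight_comp_tensorLeft (a : A) (r : R) :
    ContinuousLinearMap.adjoint (tensorRight A r) ∘L tensorLeft R a =
      InnerProductSpace.rankOne ℂ a r := by
  rw [← ContinuousLinearMap.adjoint_adjoint (tensorLeft R a), ← ContinuousLinearMap.adjoint_comp,
    adjoint_tensorLeft_comp_tensorRight, InnerProductSpace.adjoint_rankOne]

theorem ext_simple {X : Type*} [NormedAddCommGroup X] [NormedSpace ℂ X]
    {S T : HilbertTensor A R →L[ℂ] X} (h : ∀ a r, S (simple a r) = T (simple a r)) : S = T := by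
  have h1 : (S ∘L (UniformSpace.Completion.toComplL : (A ⊗[ℂ] R) →L[ℂ] _)).toLinearMap =
      (T ∘L (UniformSpace.Completion.toComplL : (A ⊗[ℂ] R) →L[ℂ] _)).toLinearMap :=
    TensorProduct.ext' h
  ext x
  refine UniformSpace.Completion.induction_on x (isClosed_eq (by fun_prop) (by fun_prop))
    fun y => ?_
  exact LinearMap.congr_fun h1 y

theorem ext_inner_simple {S T : HilbertTensor A R →L[ℂ] HilbertTensor B R}
    (h : ∀ a r b s, ⟪simple b s, S (simple a r)⟫_ℂ = ⟪simple b s, T (simple a r)⟫_ℂ) : S = T := by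
  refine ext_simple fun a r => ext_inner_right ℂ fun v => ?_
  have h1 : innerSL ℂ (S (simple a r)) = innerSL ℂ (T (simple a r)) :=
    ext_simple fun b s => by
      rw [innerSL_apply_apply, innerSL_apply_apply, ← inner_conj_symm, h, inner_conj_symm]
  exact congrArg (fun f : HilbertTensor B R →L[ℂ] ℂ => f v) h1

section Basis

variable {ι κ : Type*} (b : HilbertBasis ι ℂ A) (c : HilbertBasis κ ℂ R)

theorem orthonormal_simple {b : ι → A} {c : κ → R} (hb : Orthonormal ℂ b) (hc : Orthonormal ℂ c) :
    Orthonormal ℂ (fun p : ι × κ => simple (b p.1) (c p.2)) := by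
  refine ⟨fun p => by rw [norm_simple, hb.1, hc.1, one_mul], fun p q hpq => ?_⟩
  change ⟪simple (b p.1) (c p.2), simple (b q.1) (c q.2)⟫_ℂ = 0
  rw [inner_simple]
  by_cases h : p.1 = q.1
  · rw [hc.2 (fun h' => hpq (Prod.ext h h')), mul_zero]
  · rw [hb.2 h, zero_mul]

theorem _root_.HilbertBasis.eq_zero_of_forall_inner {H ι : Type*} [NormedAddCommGroup H]
    [InnerProductSpace ℂ H] (e : HilbertBasis ι ℂ H) (x : H) (hx : ∀ i, ⟪e i, x⟫_ℂ = 0) :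
    x = 0 := by
  have := tsum_enorm_sq_inner e x
  simpa [hx] using this.symm

/-- The product of two Hilbert bases. -/
def productBasis : HilbertBasis (ι × κ) ℂ (HilbertTensor A R) :=
  HilbertBasis.mkOfOrthogonalEqBot (orthonormal_simple b.orthonormal c.orthonormal) (by
    rw [Submodule.eq_bot_iff]
    intro v hv
    -- Orthogonality to all basis products is upgraded one slot at a time to orthogonality to all
    -- simple tensors, which are total.
    have h0 : ∀ i j, ⟪simple (b i) (c j), v⟫_ℂ = 0 := fun i j =>
      (Submodule.mem_orthogonal _ _).1 hv _ (Submodule.subset_span ⟨(i, j), rfl⟩)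
    have h1 : ∀ a j, ⟪simple a (c j), v⟫_ℂ = 0 := by
      intro a j
      have h2 : ContinuousLinearMap.adjoint (tensorRight A (c j)) v = 0 := by
        refine b.eq_zero_of_forall_inner _ fun i => ?_
        rw [ContinuousLinearMap.adjoint_inner_right]
        exact h0 i j
      rw [← tensorRight_apply, ← ContinuousLinearMap.adjoint_inner_right, h2, inner_zero_right]
    have h3 : ∀ a r, ⟪simple a r, v⟫_ℂ = 0 := by
      intro a r
      have h2 : ContinuousLinearMap.adjoint (tensorLeft R a) v = 0 := by
        refine c.eq_zero_of_forall_inner _ fun i => ?_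
        rw [ContinuousLinearMap.adjoint_inner_right]
        exact h1 a i
      rw [← tensorLeft_apply, ← ContinuousLinearMap.adjoint_inner_right, h2, inner_zero_right]
    have h4 : innerSL ℂ v = 0 := ext_simple fun a r => by
      rw [innerSL_apply_apply, ← inner_conj_symm, h3, map_zero]; rfl
    have h5 := congrArg (fun f : HilbertTensor A R →L[ℂ] ℂ => f v) h4
    exact inner_self_eq_zero.1 h5)

theorem productBasis_apply (p : ι × κ) : productBasis b c p = simple (b p.1) (c p.2) := by
  rw [productBasis, HilbertBasis.coe_mkOfOrthogonalEqBot]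

end Basis

/-- The tensor product of two bounded operators. -/
def opTensor (X : A →L[ℂ] B) (Y : R →L[ℂ] R) : HilbertTensor A R →L[ℂ] HilbertTensor B R :=
  (UniformSpace.Completion.toComplL ∘L TensorProduct.mapL X Y).extend
    UniformSpace.Completion.toComplL

theorem opTensor_simple (X : A →L[ℂ] B) (Y : R →L[ℂ] R) (a : A) (r : R) :
    opTensor X Y (simple a r) = simple (X a) (Y r) := by
  have h := ContinuousLinearMap.extend_eq
    (UniformSpace.Completion.toComplL ∘L TensorProduct.mapL X Y)
    (e := (UniformSpace.Completion.toComplL : (A ⊗[ℂ] R) →L[ℂ] HilbertTensor A R))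
    (UniformSpace.Completion.denseRange_coe) (UniformSpace.Completion.isUniformInducing_coe _)
    (a ⊗ₜ r)
  exact h

theorem hsSq_opTensor (X : A →L[ℂ] A) (Y : R →L[ℂ] R) :
    hsSq (opTensor X Y) = hsSq X * hsSq Y := by
  rw [hsSq_eq (productBasis (stdBasis A) (stdBasis R)), ENNReal.tsum_prod', hsSq, hsSq,
    ← ENNReal.tsum_mul_right]
  congr 1
  funext i
  rw [← ENNReal.tsum_mul_left]
  congr 1
  funext j
  rw [productBasis_apply, opTensor_simple, enorm_simple, mul_pow]

theorem opTensor_adjoint_comp (S₁ S₂ : A →L[ℂ] A) (T₁ T₂ : R →L[ℂ] R) :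
    opTensor (ContinuousLinearMap.adjoint S₁ ∘L S₂) (ContinuousLinearMap.adjoint T₁ ∘L T₂) =
      ContinuousLinearMap.adjoint (opTensor S₁ T₁) ∘L opTensor S₂ T₂ := by
  refine ext_inner_simple fun a r b s => ?_
  rw [ContinuousLinearMap.comp_apply, ContinuousLinearMap.adjoint_inner_right, opTensor_simple,
    opTensor_simple, opTensor_simple, inner_simple, inner_simple]
  simp only [ContinuousLinearMap.comp_apply, ContinuousLinearMap.adjoint_inner_right]

/-- Factor `X` and `Y` into Hilbert-Schmidt operators. Such factorizations are compatible with
tensor products, and Hilbert-Schmidt sums multiply. -/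
theorem traceNorm_opTensor_le (X : A →L[ℂ] A) (Y : R →L[ℂ] R) :
    traceNorm (opTensor X Y) ≤ traceNorm X * traceNorm Y := by
  obtain ⟨S₁, S₂, hX, hS₁, hS₂⟩ := exists_hs_factorization X
  obtain ⟨T₁, T₂, hY, hT₁, hT₂⟩ := exists_hs_factorization Y
  apply le_of_sq_le_mul_self
  have h := traceNorm_adjoint_comp_sq_le (opTensor S₁ T₁) (opTensor S₂ T₂)
  rw [← opTensor_adjoint_comp, ← hX, ← hY, hsSq_opTensor, hsSq_opTensor] at h
  exact h.trans (by gcongr)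

theorem adjoint_tensorRight_comp_opTensor (X : A →L[ℂ] A) (Y : R →L[ℂ] R) (r s : R) :
    ContinuousLinearMap.adjoint (tensorRight A r) ∘L opTensor X Y ∘L tensorRight A s =
      ⟪r, Y s⟫_ℂ • X := by
  refine ContinuousLinearMap.ext fun a => ext_inner_left ℂ fun b => ?_
  rw [ContinuousLinearMap.comp_apply, ContinuousLinearMap.adjoint_inner_right, tensorRight_apply,
    ContinuousLinearMap.comp_apply, tensorRight_apply, opTensor_simple, inner_simple,
    _root_.smul_apply, inner_smul_right, mul_comm]

/-- The trace-class operator `X ⊗ Y`. -/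
def tcTensor (X : TraceClass A) (Y : TraceClass R) : TraceClass (HilbertTensor A R) :=
  ⟨opTensor X.1 Y.1, (traceNorm_opTensor_le _ _).trans_lt (ENNReal.mul_lt_top X.2 Y.2)⟩

theorem entry_tcTensor (X : TraceClass A) (Y : TraceClass R) (r s : R) :
    entry r s (tcTensor X Y) = ⟪r, (Y : R →L[ℂ] R) s⟫_ℂ • X :=
  Subtype.ext (adjoint_tensorRight_comp_opTensor _ _ _ _)

/-- The operator `V† T W` as a trace-class operator. -/
def compression {H : Type*} [NormedAddCommGroup H] [InnerProductSpace ℂ H] [CompleteSpace H]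
    {K : Type*} [NormedAddCommGroup K] [InnerProductSpace ℂ K] [CompleteSpace K]
    (V W : K →L[ℂ] H) (T : TraceClass H) : TraceClass K :=
  ⟨ContinuousLinearMap.adjoint V ∘L T.1 ∘L W, traceNorm_compression_lt_top T.2 V W⟩

/-- The rank-one operator `|x⟩⟨y|` as a trace-class operator. -/
def tcRankOne {H : Type*} [NormedAddCommGroup H] [InnerProductSpace ℂ H] [CompleteSpace H]
    (x y : H) : TraceClass H :=
  ⟨InnerProductSpace.rankOne ℂ x y, (traceNorm_rankOne_le x y).trans_lt
    (ENNReal.mul_lt_top enorm_lt_top enorm_lt_top)⟩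

theorem entry_add (r s : R) (S T : TraceClass (HilbertTensor A R)) :
    entry r s (S + T) = entry r s S + entry r s T :=
  Subtype.ext (by
    simp only [entry, Submodule.coe_add, ContinuousLinearMap.add_comp,
      ContinuousLinearMap.comp_add])

theorem entry_smul (r s : R) (c : ℂ) (T : TraceClass (HilbertTensor A R)) :
    entry r s (c • T) = c • entry r s T :=
  Subtype.ext (by
    simp only [entry, Submodule.coe_smul, ContinuousLinearMap.smul_comp,
      ContinuousLinearMap.comp_smul])

theorem entry_zero (r s : R) : entry r s (0 : TraceClass (HilbertTensor A R)) = 0 := by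
  simpa using entry_smul r s 0 (0 : TraceClass (HilbertTensor A R))

theorem entry_add_right (r s s' : R) (T : TraceClass (HilbertTensor A R)) :
    entry r (s + s') T = entry r s T + entry r s' T :=
  Subtype.ext (by
    simp only [entry, Submodule.coe_add, tensorRight_add, ContinuousLinearMap.comp_add])

theorem entry_smul_right (r s : R) (c : ℂ) (T : TraceClass (HilbertTensor A R)) :
    entry r (c • s) T = c • entry r s T :=
  Subtype.ext (by
    simp only [entry, Submodule.coe_smul, tensorRight_smul, ContinuousLinearMap.comp_smul])

theorem traceNorm_entry_le (r s : R) (T : TraceClass (HilbertTensor A R)) :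
    traceNorm (entry r s T : A →L[ℂ] A) ≤
      ‖r‖ₑ * ‖s‖ₑ * traceNorm (T : HilbertTensor A R →L[ℂ] HilbertTensor A R) := by
  refine (traceNorm_compression_le _ _ _).trans ?_
  gcongr <;> exact enorm_tensorRight_le _

end Tensor

/-! ### Seminorm properties of the ampliation norm and of the diamond norms. -/

section Ampliation

variable {A : Type u} [NormedAddCommGroup A] [InnerProductSpace ℂ A] [CompleteSpace A]
variable {B : Type v} [NormedAddCommGroup B] [InnerProductSpace ℂ B] [CompleteSpace B]
variable {R : Type w} [NormedAddCommGroup R] [InnerProductSpace ℂ R] [CompleteSpace R]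

variable {Φ Ψ : Superoperator A B} {ρ ρ' : TraceClass (HilbertTensor A R)}
  {σ σ' : TraceClass (HilbertTensor B R)}

theorem IsAmpliation.add (h : IsAmpliation Φ ρ σ) (h' : IsAmpliation Φ ρ' σ') :
    IsAmpliation Φ (ρ + ρ') (σ + σ') := fun r s => by
  rw [entry_add, entry_add, map_add, h, h']

theorem IsAmpliation.smul (c : ℂ) (h : IsAmpliation Φ ρ σ) :
    IsAmpliation Φ (c • ρ) (c • σ) := fun r s => by
  rw [entry_smul, entry_smul, map_smul, h]

theorem IsAmpliation.add_map (h : IsAmpliation Φ ρ σ) (h' : IsAmpliation Ψ ρ σ') :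
    IsAmpliation (Φ + Ψ) ρ (σ + σ') := fun r s => by
  rw [entry_add, h, h']; rfl

theorem IsAmpliation.smul_map (c : ℂ) (h : IsAmpliation Φ ρ σ) :
    IsAmpliation (c • Φ) ρ (c • σ) := fun r s => by
  rw [entry_smul, h]; rfl

theorem ampliationNorm_le (h : IsAmpliation Φ ρ σ) :
    ampliationNorm Φ ρ ≤ traceNorm (σ : HilbertTensor B R →L[ℂ] HilbertTensor B R) :=
  iInf₂_le _ h

theorem ampliationNorm_add_map_le (Φ Ψ : Superoperator A B) (ρ : TraceClass (HilbertTensor A R)) :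
    ampliationNorm (Φ + Ψ) ρ ≤ ampliationNorm Φ ρ + ampliationNorm Ψ ρ := by
  simp only [ampliationNorm, ENNReal.iInf_add, ENNReal.add_iInf]
  refine le_iInf₂ fun σ hσ => le_iInf₂ fun τ hτ => ?_
  exact (ampliationNorm_le (hτ.add_map hσ)).trans (traceNorm_add_le _ _)

theorem ampliationNorm_add_le (Φ : Superoperator A B) (ρ ρ' : TraceClass (HilbertTensor A R)) :
    ampliationNorm Φ (ρ + ρ') ≤ ampliationNorm Φ ρ + ampliationNorm Φ ρ' := by
  simp only [ampliationNorm, ENNReal.iInf_add, ENNReal.add_iInf]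
  refine le_iInf₂ fun σ hσ => le_iInf₂ fun τ hτ => ?_
  exact (ampliationNorm_le (hτ.add hσ)).trans (traceNorm_add_le _ _)

theorem ampliationNorm_zero (Φ : Superoperator A B) :
    ampliationNorm Φ (0 : TraceClass (HilbertTensor A R)) = 0 := by
  have h : IsAmpliation Φ (0 : TraceClass (HilbertTensor A R)) 0 := fun r s => by
    rw [entry_zero, entry_zero, map_zero]
  exact le_antisymm ((ampliationNorm_le h).trans_eq traceNorm_zero) bot_le

theorem ampliationNorm_zero_map (ρ : TraceClass (HilbertTensor A R)) :
    ampliationNorm (0 : Superoperator A B) ρ = 0 := by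
  have h : IsAmpliation (0 : Superoperator A B) ρ 0 := fun r s => by
    rw [entry_zero]; rfl
  exact le_antisymm ((ampliationNorm_le h).trans_eq traceNorm_zero) bot_le

theorem ampliationNorm_smul_le (Φ : Superoperator A B) (c : ℂ)
    (ρ : TraceClass (HilbertTensor A R)) :
    ampliationNorm Φ (c • ρ) ≤ ‖c‖ₑ * ampliationNorm Φ ρ := by
  -- Since `0 * ⊤ = 0`, the case `c = 0` needs the explicit ampliation `0`. For `c ≠ 0` the factor
  -- passes through the infimum, even when no ampliation exists.
  rcases eq_or_ne c 0 with rfl | hc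
  · simp [ampliationNorm_zero]
  · simp only [ampliationNorm]
    rw [ENNReal.mul_iInf_of_ne (by simpa using hc) enorm_ne_top]
    refine le_iInf fun σ => ?_
    rw [ENNReal.mul_iInf_of_ne (by simpa using hc) enorm_ne_top]
    exact le_iInf fun hσ => (ampliationNorm_le (hσ.smul c)).trans (traceNorm_smul_le _ _)

theorem ampliationNorm_smul_map_le (Φ : Superoperator A B) (c : ℂ)
    (ρ : TraceClass (HilbertTensor A R)) :
    ampliationNorm (c • Φ) ρ ≤ ‖c‖ₑ * ampliationNorm Φ ρ := by
  rcases eq_or_ne c 0 with rfl | hc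
  · simp [ampliationNorm_zero_map]
  · simp only [ampliationNorm]
    rw [ENNReal.mul_iInf_of_ne (by simpa using hc) enorm_ne_top]
    refine le_iInf fun σ => ?_
    rw [ENNReal.mul_iInf_of_ne (by simpa using hc) enorm_ne_top]
    exact le_iInf fun hσ => (ampliationNorm_le (hσ.smul_map c)).trans (traceNorm_smul_le _ _)

theorem ampliationNorm_sum_le {ι : Type*} (F : Finset ι) (Φ : Superoperator A B)
    (ρ : ι → TraceClass (HilbertTensor A R)) :
    ampliationNorm Φ (∑ i ∈ F, ρ i) ≤ ∑ i ∈ F, ampliationNorm Φ (ρ i) := by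
  classical
  induction F using Finset.induction_on with
  | empty => simp [ampliationNorm_zero]
  | insert i F hi ih =>
    rw [Finset.sum_insert hi, Finset.sum_insert hi]
    exact (ampliationNorm_add_le _ _ _).trans (by gcongr)

theorem isAmpliation_tcTensor (Φ : Superoperator A B) (X : TraceClass A) (Y : TraceClass R) :
    IsAmpliation Φ (tcTensor X Y) (tcTensor (Φ X) Y) := fun r s => by
  rw [entry_tcTensor, entry_tcTensor, map_smul]

theorem ampliationNorm_tcTensor_le (Φ : Superoperator A B) (X : TraceClass A) (Y : TraceClass R) :
    ampliationNorm Φ (tcTensor X Y) ≤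
      traceNorm (Φ X : B →L[ℂ] B) * traceNorm (Y : R →L[ℂ] R) :=
  (ampliationNorm_le (isAmpliation_tcTensor Φ X Y)).trans (traceNorm_opTensor_le _ _)

/-- Taking entries commutes with `Φ`, and the entry at a unit vector is a compression by a
contraction. The bound is trivial when no ampliation exists, the infimum then being `⊤`. -/
theorem traceNorm_map_entry_le (Φ : Superoperator A B) (ρ : TraceClass (HilbertTensor A R)) {r : R}
    (hr : ‖r‖ = 1) : traceNorm (Φ (entry r r ρ) : B →L[ℂ] B) ≤ ampliationNorm Φ ρ := by
  refine le_iInf₂ fun σ hσ => ?_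
  rw [← hσ]
  refine (traceNorm_entry_le _ _ _).trans_eq ?_
  rw [← ofReal_norm, hr]
  simp

theorem diamondNorm_add_le (Φ Ψ : Superoperator A B) :
    diamondNorm R (Φ + Ψ) ≤ diamondNorm R Φ + diamondNorm R Ψ := by
  refine iSup₂_le fun ρ hρ => (ampliationNorm_add_map_le Φ Ψ ρ).trans ?_
  exact add_le_add (le_iSup₂_of_le ρ hρ le_rfl) (le_iSup₂_of_le ρ hρ le_rfl)

theorem sub_eq_add_neg_one_smul (Φ Ψ : Superoperator A B) : Φ - Ψ = Φ + (-1 : ℂ) • Ψ := by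
  refine LinearMap.ext fun T => ?_
  change Φ T - Ψ T = Φ T + (-1 : ℂ) • Ψ T
  refine Subtype.ext ?_
  rw [Submodule.coe_add, Submodule.coe_smul, Submodule.coe_sub]
  module

theorem diamondNorm_sub_le (Φ Ψ : Superoperator A B) :
    diamondNorm R (Φ - Ψ) ≤ diamondNorm R Φ + diamondNorm R Ψ := by
  rw [sub_eq_add_neg_one_smul]
  refine (diamondNorm_add_le _ _).trans ?_
  gcongr
  refine iSup₂_le fun ρ hρ => (ampliationNorm_smul_map_le Ψ (-1) ρ).trans ?_
  rw [enorm_neg, enorm_one, one_mul]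
  exact le_iSup₂_of_le ρ hρ le_rfl

theorem ecdNorm_le_diamondNorm (H : A →ₗ.[ℂ] A) (E : ℝ) (Φ : Superoperator A B) :
    ecdNorm R H E Φ ≤ diamondNorm R Φ :=
  iSup₂_le fun ρ hρ => iSup_le fun _ => le_iSup₂_of_le ρ hρ le_rfl

theorem le_ecdNorm {H : A →ₗ.[ℂ] A} {E : ℝ} (hρ : IsState ρ) {ω : TraceClass A}
    (hω : IsPartialTrace ρ ω) (hE : energy H ω ≤ ENNReal.ofReal E) :
    ampliationNorm Φ ρ ≤ ecdNorm R H E Φ :=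
  le_iSup₂_of_le ρ hρ (le_iSup_of_le ⟨ω, hω, hE⟩ le_rfl)

theorem ecdNorm_add_le (H : A →ₗ.[ℂ] A) (E : ℝ) (Φ Ψ : Superoperator A B) :
    ecdNorm R H E (Φ + Ψ) ≤ ecdNorm R H E Φ + ecdNorm R H E Ψ := by
  refine iSup₂_le fun ρ hρ => iSup_le fun ⟨ω, hω, hE⟩ =>
    (ampliationNorm_add_map_le Φ Ψ ρ).trans ?_
  exact add_le_add (le_ecdNorm hρ hω hE) (le_ecdNorm hρ hω hE)

theorem ecdNorm_smul_le (H : A →ₗ.[ℂ] A) (E : ℝ) (c : ℂ) (Φ : Superoperator A B) :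
    ecdNorm R H E (c • Φ) ≤ ‖c‖ₑ * ecdNorm R H E Φ := by
  refine iSup₂_le fun ρ hρ => iSup_le fun ⟨ω, hω, hE⟩ =>
    (ampliationNorm_smul_map_le Φ c ρ).trans ?_
  gcongr
  exact le_ecdNorm hρ hω hE

theorem ecdNorm_smul (H : A →ₗ.[ℂ] A) (E : ℝ) (c : ℂ) (Φ : Superoperator A B) :
    ecdNorm R H E (c • Φ) = ‖c‖ₑ * ecdNorm R H E Φ := by
  refine le_antisymm (ecdNorm_smul_le H E c Φ) ?_
  rcases eq_or_ne c 0 with rfl | hc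
  · simp
  · have h := ecdNorm_smul_le (R := R) H E c⁻¹ (c • Φ)
    rw [inv_smul_smul₀ hc] at h
    calc _ ≤ ‖c‖ₑ * (‖c⁻¹‖ₑ * ecdNorm R H E (c • Φ)) := by gcongr
      _ = _ := by rw [← mul_assoc, ← enorm_mul, mul_inv_cancel₀ hc, enorm_one, one_mul]

end Ampliation

/-! ### Decomposition of trace-class operators into states. -/

section Decomposition

variable {H : Type*} [NormedAddCommGroup H] [InnerProductSpace ℂ H] [CompleteSpace H]

theorem traceNorm_adjoint_le (T : H →L[ℂ] H) :
    traceNorm (ContinuousLinearMap.adjoint T) ≤ traceNorm T := by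
  obtain ⟨S₁, S₂, hT, h1, h2⟩ := exists_hs_factorization T
  apply le_of_sq_le_mul_self
  have h := traceNorm_adjoint_comp_sq_le S₂ S₁
  have h3 : ContinuousLinearMap.adjoint S₂ ∘L S₁ = ContinuousLinearMap.adjoint T := by
    rw [hT, ContinuousLinearMap.adjoint_comp, ContinuousLinearMap.adjoint_adjoint]
  rw [h3] at h
  exact h.trans (by gcongr)

theorem exists_isSelfAdjoint_decomposition (T : TraceClass H) :
    ∃ T₁ T₂ : TraceClass H, IsSelfAdjoint (T₁ : H →L[ℂ] H) ∧ IsSelfAdjoint (T₂ : H →L[ℂ] H) ∧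
      T = T₁ + Complex.I • T₂ ∧ traceNorm (T₁ : H →L[ℂ] H) ≤ traceNorm (T : H →L[ℂ] H) ∧
      traceNorm (T₂ : H →L[ℂ] H) ≤ traceNorm (T : H →L[ℂ] H) := by
  let T' : TraceClass H := ⟨star T.1, (traceNorm_adjoint_le T.1).trans_lt T.2⟩
  have hT' : traceNorm (T' : H →L[ℂ] H) ≤ traceNorm (T : H →L[ℂ] H) := traceNorm_adjoint_le T.1
  have half : (2⁻¹ : ℝ≥0∞) * (traceNorm T.1 + traceNorm T.1) = traceNorm T.1 := by
    rw [← two_mul, ← mul_assoc, ENNReal.inv_mul_cancel two_ne_zero ENNReal.ofNat_ne_top, one_mul]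
  have h2 : ‖(2⁻¹ : ℂ)‖ₑ = 2⁻¹ := by
    rw [← ofReal_norm, norm_inv, Complex.norm_ofNat, ENNReal.ofReal_inv_of_pos two_pos]
    norm_num
  have h3 : ‖(-Complex.I * 2⁻¹ : ℂ)‖ₑ = 2⁻¹ := by
    rw [enorm_mul, h2, enorm_neg, ← ofReal_norm, Complex.norm_I]; simp
  refine ⟨(2⁻¹ : ℂ) • (T + T'), (-Complex.I * 2⁻¹ : ℂ) • (T - T'), ?_, ?_, ?_, ?_, ?_⟩
  · rw [IsSelfAdjoint, Submodule.coe_smul, Submodule.coe_add, star_smul, star_add]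
    change star (2⁻¹ : ℂ) • (star T.1 + star (star T.1)) = (2⁻¹ : ℂ) • (T.1 + star T.1)
    rw [star_star, add_comm]
    simp
  · rw [IsSelfAdjoint, Submodule.coe_smul, Submodule.coe_sub, star_smul, star_sub]
    change star (-Complex.I * 2⁻¹ : ℂ) • (star T.1 - star (star T.1)) =
      (-Complex.I * 2⁻¹ : ℂ) • (T.1 - star T.1)
    rw [star_star, ← neg_sub T.1, smul_neg, ← neg_smul]
    simp
  · refine Subtype.ext ?_
    simp only [Submodule.coe_add, Submodule.coe_smul, Submodule.coe_sub, smul_smul]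
    rw [show Complex.I * (-Complex.I * 2⁻¹) = (2⁻¹ : ℂ) by
      rw [← mul_assoc, mul_neg, Complex.I_mul_I]; norm_num]
    module
  · refine (traceNorm_smul_le _ _).trans ?_
    rw [h2]
    calc _ ≤ 2⁻¹ * (traceNorm T.1 + traceNorm T.1) := by
          gcongr
          exact (traceNorm_add_le _ _).trans (by gcongr)
      _ = _ := half
  · refine (traceNorm_smul_le _ _).trans ?_
    rw [h3]
    calc _ ≤ 2⁻¹ * (traceNorm T.1 + traceNorm T.1) := by
          gcongr
          exact (traceNorm_sub_le _ _).trans (by gcongr)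
      _ = _ := half

/-- Because `|T| = T⁺ + T⁻`, the trace norms add exactly, so bounds on states pass to Hermitian
operators without loss of constant. -/
theorem exists_isPositive_decomposition (T : TraceClass H) (hT : IsSelfAdjoint (T : H →L[ℂ] H)) :
    ∃ T₁ T₂ : TraceClass H, (T₁ : H →L[ℂ] H).IsPositive ∧ (T₂ : H →L[ℂ] H).IsPositive ∧
      T = T₁ + (-1 : ℂ) • T₂ ∧
      traceNorm (T₁ : H →L[ℂ] H) + traceNorm (T₂ : H →L[ℂ] H) = traceNorm (T : H →L[ℂ] H) := by
  have h1 : (T.1⁺).IsPositive :=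
    (ContinuousLinearMap.nonneg_iff_isPositive _).1 (CFC.posPart_nonneg T.1)
  have h2 : (T.1⁻).IsPositive :=
    (ContinuousLinearMap.nonneg_iff_isPositive _).1 (CFC.negPart_nonneg T.1)
  have h3 : traceNorm T.1⁺ + traceNorm T.1⁻ = traceNorm T.1 := by
    rw [traceNorm_of_isPositive h1 (stdBasis H), traceNorm_of_isPositive h2 (stdBasis H),
      ← ENNReal.tsum_add, traceNorm, ← CFC.posPart_add_negPart T.1 hT]
    congr 1
    funext i
    have h5 : 0 ≤ (⟪stdBasis H i, T.1⁺ (stdBasis H i)⟫_ℂ).re := h1.re_inner_nonneg_right _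
    have h6 : 0 ≤ (⟪stdBasis H i, T.1⁻ (stdBasis H i)⟫_ℂ).re := h2.re_inner_nonneg_right _
    rw [← ENNReal.ofReal_add h5 h6, _root_.add_apply, inner_add_right, Complex.add_re]
  have h4 : traceNorm T.1⁺ + traceNorm T.1⁻ < ⊤ := h3 ▸ T.2
  rw [ENNReal.add_lt_top] at h4
  refine ⟨⟨T.1⁺, h4.1⟩, ⟨T.1⁻, h4.2⟩, h1, h2, Subtype.ext ?_, h3⟩
  rw [Submodule.coe_add, Submodule.coe_smul]
  change T.1 = T.1⁺ + (-1 : ℂ) • T.1⁻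
  conv_lhs => rw [← CFC.posPart_sub_negPart T.1 hT]
  module

theorem IsState.traceNorm_eq {ρ : TraceClass H} (hρ : IsState ρ) :
    traceNorm (ρ : H →L[ℂ] H) = 1 := by
  have h := trace_of_isPositive hρ.1
  rw [hρ.2] at h
  have h2 : (traceNorm (ρ : H →L[ℂ] H)).toReal = 1 := by exact_mod_cast h.symm
  exact (ENNReal.toReal_eq_one_iff _).1 h2

theorem isState_of_traceNorm_eq_one {ρ : TraceClass H} (hρ : (ρ : H →L[ℂ] H).IsPositive)
    (h : traceNorm (ρ : H →L[ℂ] H) = 1) : IsState ρ :=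
  ⟨hρ, by rw [trace_of_isPositive hρ, h]; simp⟩

theorem exists_isState_smul {ρ : TraceClass H} (hρ : (ρ : H →L[ℂ] H).IsPositive) (h0 : ρ ≠ 0) :
    ∃ ρ₀ : TraceClass H, IsState ρ₀ ∧
      ρ = ((traceNorm (ρ : H →L[ℂ] H)).toReal : ℂ) • ρ₀ := by
  set t := (traceNorm (ρ : H →L[ℂ] H)).toReal with ht
  have ht0 : 0 < t := ENNReal.toReal_pos
    (fun h => h0 (Subtype.ext (eq_zero_of_traceNorm_eq_zero h))) (ne_of_lt ρ.2)
  have htc : (t : ℂ) ≠ 0 := by exact_mod_cast ht0.ne'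
  refine ⟨(t : ℂ)⁻¹ • ρ, ⟨?_, ?_⟩, (smul_inv_smul₀ htc ρ).symm⟩
  · refine ContinuousLinearMap.IsPositive.smul_of_nonneg hρ ?_
    rw [← Complex.ofReal_inv]
    exact_mod_cast (inv_pos.2 ht0).le
  · rw [Submodule.coe_smul, trace_smul, trace_of_isPositive hρ, ← ht, inv_mul_cancel₀ htc]

theorem span_isState_eq_top : Submodule.span ℂ {ρ : TraceClass H | IsState ρ} = ⊤ := by
  rw [eq_top_iff]
  have hpos : ∀ T : TraceClass H, (T : H →L[ℂ] H).IsPositive →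
      T ∈ Submodule.span ℂ {ρ : TraceClass H | IsState ρ} := by
    intro T hT
    rcases eq_or_ne T 0 with rfl | h0
    · exact Submodule.zero_mem _
    · obtain ⟨ρ, hρ, h⟩ := exists_isState_smul hT h0
      rw [h]
      exact Submodule.smul_mem _ _ (Submodule.subset_span hρ)
  have hsa : ∀ T : TraceClass H, IsSelfAdjoint (T : H →L[ℂ] H) →
      T ∈ Submodule.span ℂ {ρ : TraceClass H | IsState ρ} := by
    intro T hT
    obtain ⟨T₁, T₂, h1, h2, rfl, -⟩ := exists_isPositive_decomposition T hT
    exact Submodule.add_mem _ (hpos _ h1) (Submodule.smul_mem _ _ (hpos _ h2))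
  intro T _
  obtain ⟨T₁, T₂, h1, h2, rfl, -⟩ := exists_isSelfAdjoint_decomposition T
  exact Submodule.add_mem _ (hsa _ h1) (Submodule.smul_mem _ _ (hsa _ h2))

/-- A seminorm-like functional on trace-class operators that is at most `C` on states is at most
`C ‖T‖₁` on Hermitian `T`. -/
theorem le_mul_traceNorm_of_isSelfAdjoint {p : TraceClass H → ℝ≥0∞} {C : ℝ≥0∞}
    (hadd : ∀ S T, p (S + T) ≤ p S + p T) (hsmul : ∀ (c : ℂ) T, p (c • T) ≤ ‖c‖ₑ * p T)
    (h : ∀ ρ, IsState ρ → p ρ ≤ C) (T : TraceClass H) (hT : IsSelfAdjoint (T : H →L[ℂ] H)) :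
    p T ≤ C * traceNorm (T : H →L[ℂ] H) := by
  have hpos : ∀ T : TraceClass H, (T : H →L[ℂ] H).IsPositive →
      p T ≤ C * traceNorm (T : H →L[ℂ] H) := by
    intro T hT
    rcases eq_or_ne T 0 with rfl | h0
    · have := hsmul 0 0
      simp only [zero_smul, enorm_zero, zero_mul, nonpos_iff_eq_zero] at this
      rw [this]; exact bot_le
    · obtain ⟨ρ, hρ, h1⟩ := exists_isState_smul hT h0
      calc p T = p (((traceNorm (T : H →L[ℂ] H)).toReal : ℂ) • ρ) := by rw [← h1]
        _ ≤ ‖((traceNorm (T : H →L[ℂ] H)).toReal : ℂ)‖ₑ * p ρ := hsmul _ _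
        _ ≤ traceNorm (T : H →L[ℂ] H) * C := by
          gcongr
          · rw [← ofReal_norm, Complex.norm_real, Real.norm_of_nonneg ENNReal.toReal_nonneg]
            exact ENNReal.ofReal_toReal_le
          · exact h ρ hρ
        _ = _ := mul_comm _ _
  obtain ⟨T₁, T₂, h1, h2, hT', hn⟩ := exists_isPositive_decomposition T hT
  calc p T ≤ p T₁ + ‖(-1 : ℂ)‖ₑ * p T₂ := by
        rw [hT']; exact (hadd _ _).trans (by gcongr; exact hsmul _ _)
    _ ≤ C * traceNorm (T₁ : H →L[ℂ] H) + C * traceNorm (T₂ : H →L[ℂ] H) := by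
        rw [enorm_neg, enorm_one, one_mul]
        exact add_le_add (hpos _ h1) (hpos _ h2)
    _ = _ := by rw [← mul_add, hn]

/-- On Hermitian operators the constant is `C`; the factor 2 comes from treating real and imaginary
parts separately. -/
theorem opNormLE_of_isState {K : Type*} [NormedAddCommGroup K] [InnerProductSpace ℂ K]
    [CompleteSpace K] {Φ : Superoperator H K} {C : ℝ≥0∞}
    (h : ∀ ρ, IsState ρ → traceNorm (Φ ρ : K →L[ℂ] K) ≤ C) : OpNormLE Φ (2 * C) := by
  have hsa := le_mul_traceNorm_of_isSelfAdjoint (p := fun T => traceNorm (Φ T : K →L[ℂ] K))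
    (fun S T => by rw [map_add]; exact traceNorm_add_le _ _)
    (fun c T => by rw [map_smul]; exact traceNorm_smul_le _ _) h
  intro T
  obtain ⟨T₁, T₂, h1, h2, hT, h3, h4⟩ := exists_isSelfAdjoint_decomposition T
  calc traceNorm (Φ T : K →L[ℂ] K) ≤ traceNorm (Φ T₁ : K →L[ℂ] K) +
        ‖Complex.I‖ₑ * traceNorm (Φ T₂ : K →L[ℂ] K) := by
        rw [hT, map_add, map_smul]
        exact (traceNorm_add_le _ _).trans (by gcongr; exact traceNorm_smul_le _ _)
    _ ≤ C * traceNorm (T : H →L[ℂ] H) + C * traceNorm (T : H →L[ℂ] H) := by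
        rw [← ofReal_norm, Complex.norm_I, ENNReal.ofReal_one, one_mul]
        exact add_le_add ((hsa _ h1).trans (by gcongr)) ((hsa _ h2).trans (by gcongr))
    _ = _ := by ring

/-- The states span, and an expansion of `T` in states does not involve `Φ`. Hence `Φ ↦ ‖Φ(T)‖₁` is
dominated by finitely many seminorms of the strong topology, for arbitrary `T`. -/
theorem exists_finset_isState (T : TraceClass H) :
    ∃ (F : Finset (TraceClass H)) (M : NNReal), (∀ ρ ∈ F, IsState ρ) ∧
      ∀ {K : Type v} [NormedAddCommGroup K] [InnerProductSpace ℂ K] [CompleteSpace K]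
        (Φ : Superoperator H K), traceNorm (Φ T : K →L[ℂ] K) ≤
          M * ∑ ρ ∈ F, traceNorm (Φ ρ : K →L[ℂ] K) := by
  classical
  have hT : T ∈ Submodule.span ℂ {ρ : TraceClass H | IsState ρ} := by
    rw [span_isState_eq_top]; trivial
  induction hT using Submodule.span_induction with
  | mem T hT => exact ⟨{T}, 1, by simpa using hT, fun Φ => by simp⟩
  | zero => exact ⟨∅, 0, by simp, fun Φ => by simp [traceNorm_zero]⟩
  | add S T _ _ hS hT =>
    obtain ⟨F, M, hF, h⟩ := hS
    obtain ⟨F', M', hF', h'⟩ := hT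
    refine ⟨F ∪ F', M + M', fun ρ hρ => (Finset.mem_union.1 hρ).elim (hF ρ) (hF' ρ), fun Φ => ?_⟩
    rw [map_add, ENNReal.coe_add, add_mul]
    refine (traceNorm_add_le _ _).trans (add_le_add ((h Φ).trans ?_) ((h' Φ).trans ?_))
    · gcongr; exact Finset.subset_union_left
    · gcongr; exact Finset.subset_union_right
  | smul c T _ hT =>
    obtain ⟨F, M, hF, h⟩ := hT
    refine ⟨F, ‖c‖₊ * M, hF, fun Φ => ?_⟩
    rw [map_smul, ENNReal.coe_mul, mul_assoc]
    exact (traceNorm_smul_le _ _).trans (mul_le_mul_right (h Φ) _)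

end Decomposition

/-! ### Product states with a pure reference state. -/

section Embedding

variable {A : Type u} [NormedAddCommGroup A] [InnerProductSpace ℂ A] [CompleteSpace A]
variable {B : Type v} [NormedAddCommGroup B] [InnerProductSpace ℂ B] [CompleteSpace B]
variable {R : Type w} [NormedAddCommGroup R] [InnerProductSpace ℂ R] [CompleteSpace R]

/-- The operator `ω ⊗ |r⟩⟨r|` on the composite system. -/
def withPure (r : R) (ω : TraceClass A) : TraceClass (HilbertTensor A R) :=
  compression (ContinuousLinearMap.adjoint (tensorRight A r))
    (ContinuousLinearMap.adjoint (tensorRight A r)) ω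

theorem withPure_coe (r : R) (ω : TraceClass A) :
    (withPure r ω : HilbertTensor A R →L[ℂ] HilbertTensor A R) =
      tensorRight A r ∘L (ω : A →L[ℂ] A) ∘L ContinuousLinearMap.adjoint (tensorRight A r) := by
  change ContinuousLinearMap.adjoint (ContinuousLinearMap.adjoint (tensorRight A r)) ∘L _ = _
  rw [ContinuousLinearMap.adjoint_adjoint]

theorem entry_withPure {r : R} (hr : ‖r‖ = 1) (ω : TraceClass A) :
    entry r r (withPure r ω) = ω := by
  have h : ContinuousLinearMap.adjoint (tensorRight A r) ∘L tensorRight A r =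
      ContinuousLinearMap.id ℂ A := by
    rw [adjoint_tensorRight_comp, inner_self_eq_one_of_norm_eq_one hr, one_smul]
  refine Subtype.ext ?_
  change ContinuousLinearMap.adjoint (tensorRight A r) ∘L (withPure r ω).1 ∘L
    tensorRight A r = ω.1
  rw [withPure_coe]
  change ContinuousLinearMap.adjoint (tensorRight A r) ∘L (tensorRight A r ∘L ω.1 ∘L
    ContinuousLinearMap.adjoint (tensorRight A r)) ∘L tensorRight A r = ω.1
  rw [ContinuousLinearMap.comp_assoc, ContinuousLinearMap.comp_assoc, h,
    ← ContinuousLinearMap.comp_assoc, h]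
  rfl

theorem isPartialTrace_withPure {r : R} (hr : ‖r‖ = 1) (ω : TraceClass A) :
    IsPartialTrace (withPure r ω) ω := by
  intro a b
  have h : ContinuousLinearMap.adjoint (tensorLeft R a) ∘L
      (withPure r ω : HilbertTensor A R →L[ℂ] HilbertTensor A R) ∘L tensorLeft R b =
      ⟪a, (ω : A →L[ℂ] A) b⟫_ℂ • InnerProductSpace.rankOne ℂ r r := by
    rw [withPure_coe]
    have h1 : ContinuousLinearMap.adjoint (tensorLeft R a) ∘L (tensorRight A r ∘L ω.1 ∘L
      ContinuousLinearMap.adjoint (tensorRight A r)) ∘L tensorLeft R b =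
        (ContinuousLinearMap.adjoint (tensorLeft R a) ∘L tensorRight A r) ∘L ω.1 ∘L
      (ContinuousLinearMap.adjoint (tensorRight A r) ∘L tensorLeft R b) := rfl
    rw [h1, adjoint_tensorLeft_comp_tensorRight, adjoint_tensorRight_comp_tensorLeft]
    ext s
    simp only [ContinuousLinearMap.comp_apply, InnerProductSpace.rankOne_apply,
      _root_.smul_apply, map_smul, smul_smul]
    rw [mul_comm]
  rw [h, trace_smul, trace_rankOne, inner_self_eq_one_of_norm_eq_one hr, mul_one]

theorem isState_withPure {r : R} (hr : ‖r‖ = 1) {ω : TraceClass A} (hω : IsState ω) :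
    IsState (withPure r ω) := by
  have hr' : ‖r‖ₑ = 1 := by rw [← ofReal_norm, hr, ENNReal.ofReal_one]
  refine isState_of_traceNorm_eq_one ?_ (le_antisymm ?_ ?_)
  · exact hω.1.adjoint_conj _
  · refine (traceNorm_compression_le _ _ _).trans ?_
    rw [hω.traceNorm_eq, enorm_adjoint, mul_one]
    have := enorm_tensorRight_le (A := A) r
    rw [hr'] at this
    exact mul_le_one' this this
  -- The lower bound on the norm: the `(r, r)` entry returns `ω`, which has trace norm one.
  · have h := traceNorm_entry_le r r (withPure r ω)
    rwa [entry_withPure hr, hω.traceNorm_eq, hr', one_mul, one_mul] at h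

theorem traceNorm_map_le_ampliationNorm (Φ : Superoperator A B) {r : R} (hr : ‖r‖ = 1)
    (ω : TraceClass A) : traceNorm (Φ ω : B →L[ℂ] B) ≤ ampliationNorm Φ (withPure r ω) := by
  have h := traceNorm_map_entry_le Φ (withPure r ω) hr
  rwa [entry_withPure hr] at h

theorem opNormLE_of_diamondNorm_le {r : R} (hr : ‖r‖ = 1) {Φ : Superoperator A B} {C : ℝ≥0∞}
    (h : diamondNorm R Φ ≤ C) : OpNormLE Φ (2 * C) :=
  opNormLE_of_isState fun ρ hρ => (traceNorm_map_le_ampliationNorm Φ hr ρ).trans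
    ((le_iSup₂_of_le (withPure r ρ) (isState_withPure hr hρ) le_rfl).trans h)

theorem ampliationNorm_le_mul_traceNorm {Φ : Superoperator A B} {C : ℝ≥0∞}
    (h : diamondNorm R Φ ≤ C) (T : TraceClass (HilbertTensor A R))
    (hT : IsSelfAdjoint (T : HilbertTensor A R →L[ℂ] HilbertTensor A R)) :
    ampliationNorm Φ T ≤ C * traceNorm (T : HilbertTensor A R →L[ℂ] HilbertTensor A R) :=
  le_mul_traceNorm_of_isSelfAdjoint (ampliationNorm_add_le Φ) (ampliationNorm_smul_le Φ)
    (fun ρ hρ => (le_iSup₂_of_le ρ hρ le_rfl).trans h) T hT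

/-- `ω ⊗ |r⟩⟨r|` has marginal `ω`, so it is admissible in the supremum, and compression by `r`
recovers `Φ(ω)` from its image. -/
theorem traceNorm_map_le_ecdNorm (Φ : Superoperator A B) {r : R} (hr : ‖r‖ = 1)
    (H : A →ₗ.[ℂ] A) {E : ℝ} {ω : TraceClass A} (hω : IsState ω)
    (hE : energy H ω ≤ ENNReal.ofReal E) :
    traceNorm (Φ ω : B →L[ℂ] B) ≤ ecdNorm R H E Φ :=
  (traceNorm_map_le_ampliationNorm Φ hr ω).trans
    (le_ecdNorm (isState_withPure hr hω) (isPartialTrace_withPure hr ω) hE)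

end Embedding

/-! ### Finite basis projections and finite-rank approximation of positive operators. -/

section BasisProjection

variable {H : Type*} [NormedAddCommGroup H] [InnerProductSpace ℂ H] [CompleteSpace H]
variable {ι : Type*} (b : HilbertBasis ι ℂ H) (F : Finset ι)

/-- The orthogonal projection onto the span of the basis vectors `b i` with `i ∈ F`. -/
def basisProj : H →L[ℂ] H := ∑ i ∈ F, InnerProductSpace.rankOne ℂ (b i) (b i)

theorem basisProj_apply (x : H) : basisProj b F x = ∑ i ∈ F, ⟪b i, x⟫_ℂ • b i := by
  simp [basisProj]

theorem adjoint_basisProj : ContinuousLinearMap.adjoint (basisProj b F) = basisProj b F := by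
  simp [basisProj, map_sum]

theorem inner_basisProj [DecidableEq ι] (i : ι) (x : H) :
    ⟪b i, basisProj b F x⟫_ℂ = if i ∈ F then ⟪b i, x⟫_ℂ else 0 := by
  rw [basisProj_apply, inner_sum]
  simp_rw [inner_smul_right, orthonormal_iff_ite.1 b.orthonormal i]
  simp

theorem basisProj_self [DecidableEq ι] (i : ι) :
    basisProj b F (b i) = if i ∈ F then b i else 0 := by
  rw [basisProj_apply]
  simp_rw [orthonormal_iff_ite.1 b.orthonormal _ i]
  simp

/-- Truncating the resolution of the identity inside `ρ = S 1 S` replaces diagonalization of `ρ`.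
The error is `S Q S` with `Q` the complementary projection, and Hölder bounds it by `‖S‖₂` times the
tail of the convergent sum for `‖S‖₂²`. -/
theorem exists_finset_traceNorm_sub_le {ρ S : H →L[ℂ] H}
    (hS : ContinuousLinearMap.adjoint S = S) (hρ : S ∘L S = ρ) (hfin : traceNorm ρ < ⊤)
    {ε : ℝ≥0∞} (hε : 0 < ε) :
    ∃ F : Finset ι, traceNorm (ρ - ∑ i ∈ F, InnerProductSpace.rankOne ℂ (S (b i)) (S (b i))) ≤
      ε := by
  classical
  have hSρ : hsSq S = traceNorm ρ := by
    rw [← traceNorm_adjoint_comp_self, hS, hρ]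
  have hsum : ∑' i, ‖S (b i)‖ₑ ^ 2 ≠ ⊤ := by
    rw [← hsSq_eq, hSρ]; exact hfin.ne
  have hlim := ENNReal.Tendsto.const_mul (a := traceNorm ρ)
    (ENNReal.tendsto_tsum_compl_atTop_zero hsum) (Or.inr hfin.ne)
  rw [mul_zero] at hlim
  have hε2 : 0 < ε ^ 2 := pos_iff_ne_zero.2 (pow_ne_zero 2 hε.ne')
  obtain ⟨F, hF⟩ := (hlim.eventually (ge_mem_nhds hε2)).exists
  refine ⟨F, ?_⟩
  let Q : H →L[ℂ] H := ContinuousLinearMap.id ℂ H - basisProj b F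
  have hQ : ContinuousLinearMap.adjoint Q = Q := by
    rw [map_sub, adjoint_basisProj, ContinuousLinearMap.adjoint_id]
  have hid : ρ - ∑ i ∈ F, InnerProductSpace.rankOne ℂ (S (b i)) (S (b i)) =
      ContinuousLinearMap.adjoint S ∘L (Q ∘L S) := by
    ext x
    have h1 : ∀ i, ⟪b i, S x⟫_ℂ = ⟪S (b i), x⟫_ℂ := fun i => by
      rw [← ContinuousLinearMap.adjoint_inner_left, hS]
    simp [Q, hS, ← hρ, basisProj_apply, h1, map_sum]
  have h2 : traceNorm (ρ - ∑ i ∈ F, InnerProductSpace.rankOne ℂ (S (b i)) (S (b i))) ^ 2 ≤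
      ε ^ 2 := by
    rw [hid]
    refine (traceNorm_adjoint_comp_sq_le _ _).trans (le_trans ?_ hF)
    rw [hSρ]
    gcongr
    rw [← hsSq_adjoint, ContinuousLinearMap.adjoint_comp, hS, hQ, hsSq_eq b]
    refine le_of_le_of_eq ?_ (tsum_subtype {i | i ∉ F} (fun i => ‖S (b i)‖ₑ ^ 2)).symm
    refine ENNReal.tsum_le_tsum fun i => ?_
    by_cases hi : i ∈ F
    · simp [Q, basisProj_self, hi]
    · simp [Q, basisProj_self, hi]
  exact (ENNReal.pow_le_pow_left_iff two_ne_zero).1 h2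

end BasisProjection

/-! ### Vectors of low energy and the bottom of the spectrum. -/

section GroundEnergy

variable {A : Type u} [NormedAddCommGroup A] [InnerProductSpace ℂ A] [CompleteSpace A]

theorem graph_adjoint_of_forall {H : A →ₗ.[ℂ] A} (hd : Dense (H.domain : Set A)) {y w : A}
    (h : ∀ x : H.domain, ⟪w, (x : A)⟫_ℂ = ⟪y, H x⟫_ℂ) : (y, w) ∈ H.adjoint.graph := by
  rw [LinearPMap.mem_graph_iff]
  exact ⟨⟨y, LinearPMap.mem_adjoint_domain_of_exists y ⟨w, h⟩⟩, rfl,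
    LinearPMap.adjoint_apply_eq hd _ h⟩

theorem IsHamiltonian.mem_graph_of_forall {H : A →ₗ.[ℂ] A} (hH : IsHamiltonian H) {y w : A}
    (h : ∀ x : H.domain, ⟪w, (x : A)⟫_ℂ = ⟪y, H x⟫_ℂ) : (y, w) ∈ H.graph := by
  have h1 := graph_adjoint_of_forall hH.dense_domain h
  rwa [LinearPMap.isSelfAdjoint_def.1 hH.isSelfAdjoint] at h1

theorem IsHamiltonian.inner_graph_comm {H : A →ₗ.[ℂ] A} (hH : IsHamiltonian H) {x x' y y' : A}
    (h : (x, x') ∈ H.graph) (h' : (y, y') ∈ H.graph) : ⟪x', y⟫_ℂ = ⟪x, y'⟫_ℂ := by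
  have hf := LinearPMap.adjoint_isFormalAdjoint hH.dense_domain
  rw [LinearPMap.isSelfAdjoint_def.1 hH.isSelfAdjoint] at hf
  obtain ⟨p, rfl, rfl⟩ := H.mem_graph_iff.1 h
  obtain ⟨q, rfl, rfl⟩ := H.mem_graph_iff.1 h'
  exact hf p q

theorem IsHamiltonian.re_inner_graph_nonneg {H : A →ₗ.[ℂ] A} (hH : IsHamiltonian H) {x y : A}
    (h : (x, y) ∈ H.graph) : 0 ≤ (⟪x, y⟫_ℂ).re := by
  obtain ⟨p, rfl, rfl⟩ := H.mem_graph_iff.1 h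
  exact (Complex.le_def.1 (hH.nonneg p)).1

/-- The form bound makes `H - t` bounded below, so its range is closed. A vector orthogonal to the
range is, by self-adjointness, an eigenvector for `t` or zero, and the lower bound excludes
eigenvectors. So `H - t` is bijective with bounded inverse. -/
theorem IsHamiltonian.notMem_unboundedSpectrum {H : A →ₗ.[ℂ] A} (hH : IsHamiltonian H) {t δ : ℝ}
    (hδ : 0 < δ)
    (hb : ∀ x y : A, (x, y) ∈ H.graph → (t + δ) * ‖x‖ ^ 2 ≤ (⟪x, y⟫_ℂ).re) :
    (t : ℂ) ∉ unboundedSpectrum H := by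
  have hlow : ∀ x y : A, (x, y) ∈ H.graph → δ * ‖x‖ ≤ ‖y - (t : ℂ) • x‖ := by
    intro x y hxy
    have h1 : (⟪x, y - (t : ℂ) • x⟫_ℂ).re ≤ ‖x‖ * ‖y - (t : ℂ) • x‖ :=
      (Complex.re_le_norm _).trans (norm_inner_le_norm _ _)
    have h3 : (⟪x, x⟫_ℂ).re = ‖x‖ ^ 2 := inner_self_eq_norm_sq (𝕜 := ℂ) x
    have h2 : (⟪x, y - (t : ℂ) • x⟫_ℂ).re = (⟪x, y⟫_ℂ).re - t * ‖x‖ ^ 2 := by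
      rw [inner_sub_right, inner_smul_right, Complex.sub_re, Complex.re_ofReal_mul, h3]
    rcases (norm_nonneg x).eq_or_lt with h0 | h0
    · rw [← h0, mul_zero]; exact norm_nonneg _
    · have h4 := hb x y hxy
      refine le_of_mul_le_mul_left ?_ h0
      nlinarith
  -- `H - t` as a bounded operator on the graph of `H`, which is complete because a self-adjoint
  -- operator is closed.
  let g : H.graph →L[ℂ] A :=
    (ContinuousLinearMap.snd ℂ A A - (t : ℂ) • ContinuousLinearMap.fst ℂ A A) ∘L H.graph.subtypeL
  have hg : ∀ z : H.graph, g z = z.1.2 - (t : ℂ) • z.1.1 := fun z => rfl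
  have hcl : IsClosed (H.graph : Set (A × A)) := hH.isSelfAdjoint.isClosed
  have : CompleteSpace H.graph := hcl.completeSpace_coe
  have hzb : ∀ z : H.graph, ‖z‖ ≤ (1 + (|t| + 1) * δ⁻¹) * ‖g z‖ := by
    intro z
    have h1 : δ * ‖z.1.1‖ ≤ ‖g z‖ := hlow _ _ z.2
    have h2 : ‖z.1.1‖ ≤ δ⁻¹ * ‖g z‖ := by
      rw [inv_mul_eq_div, le_div_iff₀ hδ]; linarith
    have h3 : ‖z.1.2‖ ≤ ‖g z‖ + |t| * ‖z.1.1‖ := by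
      have : z.1.2 = g z + (t : ℂ) • z.1.1 := by rw [hg]; abel
      calc ‖z.1.2‖ = ‖g z + (t : ℂ) • z.1.1‖ := by rw [← this]
        _ ≤ ‖g z‖ + ‖(t : ℂ) • z.1.1‖ := norm_add_le _ _
        _ = _ := by rw [norm_smul, Complex.norm_real, Real.norm_eq_abs]
    have h5 : |t| * ‖z.1.1‖ ≤ |t| * (δ⁻¹ * ‖g z‖) := by gcongr
    have h6 : 0 ≤ δ⁻¹ * ‖g z‖ := by positivity
    have h7 : 0 ≤ |t| * (δ⁻¹ * ‖g z‖) := by positivity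
    have h4 : ‖z‖ = max ‖z.1.1‖ ‖z.1.2‖ := rfl
    rw [h4]
    refine max_le ?_ ?_ <;> nlinarith [norm_nonneg (g z)]
  have hanti : AntilipschitzWith ⟨1 + (|t| + 1) * δ⁻¹, by positivity⟩ g :=
    AddMonoidHomClass.antilipschitz_of_bound g hzb
  have hrcl : IsClosed (LinearMap.range g.toLinearMap : Set A) :=
    hanti.isClosed_range g.uniformContinuous
  have hsurj : LinearMap.range g.toLinearMap = ⊤ := by
    have : CompleteSpace (LinearMap.range g.toLinearMap) := hrcl.completeSpace_coe
    rw [← Submodule.orthogonal_eq_bot_iff, Submodule.eq_bot_iff]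
    intro y hy
    have h1 : (y, (t : ℂ) • y) ∈ H.graph := by
      refine hH.mem_graph_of_forall fun x => ?_
      have h2 := (Submodule.mem_orthogonal' _ _).1 hy (g ⟨_, H.mem_graph x⟩) ⟨_, rfl⟩
      rw [hg, inner_sub_right, inner_smul_right, sub_eq_zero] at h2
      rw [h2, inner_smul_left, Complex.conj_ofReal]
    have h3 := hlow _ _ h1
    rw [sub_self, norm_zero] at h3
    have h4 : ‖y‖ ≤ 0 := by
      by_contra h; push Not at h; nlinarith [mul_pos hδ h]
    exact norm_le_zero_iff.1 h4
  have hker : LinearMap.ker g.toLinearMap = ⊥ := LinearMap.ker_eq_bot.2 hanti.injective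
  let e := ContinuousLinearEquiv.ofBijective g hker hsurj
  have he : ∀ z, e z = g z := fun z => rfl
  intro hmem
  refine hmem ⟨ContinuousLinearMap.fst ℂ A A ∘L H.graph.subtypeL ∘L e.symm.toContinuousLinearMap,
    fun y => ?_, fun x => ?_⟩
  · have h1 : y = (e.symm y).1.2 - (t : ℂ) • (e.symm y).1.1 := by
      rw [← hg, ← he, e.apply_symm_apply]
    change ((e.symm y).1.1, y + (t : ℂ) • (e.symm y).1.1) ∈ H.graph
    have h2 : y + (t : ℂ) • (e.symm y).1.1 = (e.symm y).1.2 := by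
      conv_lhs => rw [h1]
      rw [← h1]; nth_rewrite 1 [h1]; abel
    rw [h2]
    exact (e.symm y).2
  · change (e.symm (H x - (t : ℂ) • (x : A))).1.1 = x
    have h1 : H x - (t : ℂ) • (x : A) = e ⟨_, H.mem_graph x⟩ := rfl
    rw [h1, e.symm_apply_apply]

/-- There is a spectral point `t < E`; if all unit vectors had energy at least `E`, the previous
criterion with `δ = E - t` would exclude `t`. An empty spectrum has infimum `⊤`, which contradicts
the hypothesis. -/
theorem IsHamiltonian.exists_inner_lt {H : A →ₗ.[ℂ] A} (hH : IsHamiltonian H) {E : ℝ}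
    (hE : groundEnergy H < (E : EReal)) :
    ∃ x y : A, (x, y) ∈ H.graph ∧ ‖x‖ = 1 ∧ (⟪x, y⟫_ℂ).re < E := by
  obtain ⟨_, ⟨t, ht, rfl⟩, htE⟩ := sInf_lt_iff.1 hE
  have htE : t < E := by exact_mod_cast htE
  by_contra hcon
  push Not at hcon
  refine hH.notMem_unboundedSpectrum (δ := E - t) (by linarith) (fun x y hxy => ?_) ht
  rcases eq_or_ne x 0 with rfl | hx
  · simp
  have h0 : 0 < ‖x‖ := norm_pos_iff.2 hx
  have h1 := hcon (((‖x‖⁻¹ : ℝ) : ℂ) • x) (((‖x‖⁻¹ : ℝ) : ℂ) • y) (H.graph.smul_mem _ hxy)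
    (by rw [norm_smul, Complex.norm_real, norm_inv, norm_norm, inv_mul_cancel₀ h0.ne'])
  rw [inner_smul_left, inner_smul_right, Complex.conj_ofReal, Complex.re_ofReal_mul,
    Complex.re_ofReal_mul] at h1
  have h2 := mul_le_mul_of_nonneg_left h1 (sq_nonneg ‖x‖)
  have h3 : ‖x‖ ^ 2 * (‖x‖⁻¹ * (‖x‖⁻¹ * (⟪x, y⟫_ℂ).re)) = (⟪x, y⟫_ℂ).re := by
    field_simp
  rw [h3] at h2
  linarith

end GroundEnergy

/-! ### Mean energy of mixtures of two pure states. -/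

section EnergyBound

variable {A : Type u} [NormedAddCommGroup A] [InnerProductSpace ℂ A] [CompleteSpace A]

theorem TraceClass.traceNorm_lt_top (T : TraceClass A) : traceNorm (T : A →L[ℂ] A) < ⊤ := T.2

/-- As `P` reduces `H`, the difference of the two sides is the energy of `x - P x`, hence
nonnegative. -/
theorem IsHamiltonian.re_inner_spectral_le {H : A →ₗ.[ℂ] A} (hH : IsHamiltonian H) {t : ℝ}
    {P K : A →L[ℂ] A} (hP : IsSpectralProjector H t P) (hK : ∀ x, (P x, K x) ∈ H.graph)
    {x y : A} (hxy : (x, y) ∈ H.graph) : (⟪x, K x⟫_ℂ).re ≤ (⟪x, y⟫_ℂ).re := by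
  have hKx : K x = P y := LinearPMap.mem_graph_snd_inj H (hK x) (hP.commutes x y hxy) rfl
  have hPs : ContinuousLinearMap.adjoint P = P := by
    rw [← ContinuousLinearMap.star_eq_adjoint]
    exact hP.isStarProjection.isSelfAdjoint.star_eq
  have hPP : ∀ z, P (P z) = P z := fun z =>
    congrArg (fun S : A →L[ℂ] A => S z) hP.isStarProjection.isIdempotentElem
  have hz : (x - P x, y - P y) ∈ H.graph := H.graph.sub_mem hxy (hP.commutes x y hxy)
  have h1 := hH.re_inner_graph_nonneg hz
  have h2 : ⟪x - P x, y - P y⟫_ℂ = ⟪x, y⟫_ℂ - ⟪x, P y⟫_ℂ := by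
    have h3 : ⟪P x, y - P y⟫_ℂ = 0 := by
      rw [← ContinuousLinearMap.adjoint_inner_right, hPs, map_sub, hPP, sub_self,
        inner_zero_right]
    rw [inner_sub_left, h3, sub_zero, inner_sub_right]
  rw [h2, Complex.sub_re] at h1
  rw [hKx]
  linarith

/-- The mixture `(1 - p)|x₀⟩⟨x₀| + p|x⟩⟨x|`. -/
def mixture (p : ℝ) (x₀ x : A) : TraceClass A :=
  ((1 - p : ℝ) : ℂ) • tcRankOne x₀ x₀ + (p : ℂ) • tcRankOne x x

theorem tcRankOne_coe (x y : A) :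
    (tcRankOne x y : A →L[ℂ] A) = InnerProductSpace.rankOne ℂ x y := rfl

theorem isState_mixture {p : ℝ} (h0 : 0 ≤ p) (h1 : p ≤ 1) {x₀ x : A} (hx₀ : ‖x₀‖ = 1)
    (hx : ‖x‖ = 1) : IsState (mixture p x₀ x) := by
  constructor
  · refine ContinuousLinearMap.IsPositive.add
      (ContinuousLinearMap.IsPositive.smul_of_nonneg (InnerProductSpace.isPositive_rankOne_self _)
        (by exact_mod_cast sub_nonneg.2 h1))
      (ContinuousLinearMap.IsPositive.smul_of_nonneg (InnerProductSpace.isPositive_rankOne_self _)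
        (by exact_mod_cast h0))
  · rw [mixture, Submodule.coe_add, trace_add (TraceClass.traceNorm_lt_top _) (TraceClass.traceNorm_lt_top _),
      Submodule.coe_smul, Submodule.coe_smul, trace_smul, trace_smul, tcRankOne_coe, tcRankOne_coe,
      trace_rankOne, trace_rankOne, inner_self_eq_one_of_norm_eq_one hx₀,
      inner_self_eq_one_of_norm_eq_one hx]
    push_cast
    ring

/-- Each term of the supremum is bounded separately, so the existence of spectral projectors is not
needed. -/
theorem IsHamiltonian.energy_mixture_le {H : A →ₗ.[ℂ] A} (hH : IsHamiltonian H) {p : ℝ}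
    (h0 : 0 ≤ p) (h1 : p ≤ 1) {x₀ y₀ x y : A} (hx₀ : (x₀, y₀) ∈ H.graph) (hx : (x, y) ∈ H.graph)
    {E : ℝ} (hE : (1 - p) * (⟪x₀, y₀⟫_ℂ).re + p * (⟪x, y⟫_ℂ).re ≤ E) :
    energy H (mixture p x₀ x) ≤ ENNReal.ofReal E := by
  refine iSup_le fun n => iSup_le fun P => iSup_le fun K => iSup_le fun hP => iSup_le fun hK => ?_
  refine ENNReal.ofReal_le_ofReal (le_trans ?_ hE)
  have h2 : K ∘L (mixture p x₀ x : A →L[ℂ] A) =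
      (((1 - p : ℝ) : ℂ) • tcRankOne (K x₀) x₀ + (p : ℂ) • tcRankOne (K x) x : TraceClass A).1 := by
    rw [mixture]
    change K ∘L (((1 - p : ℝ) : ℂ) • InnerProductSpace.rankOne ℂ x₀ x₀ +
      (p : ℂ) • InnerProductSpace.rankOne ℂ x x) =
      (((1 - p : ℝ) : ℂ) • InnerProductSpace.rankOne ℂ (K x₀) x₀ +
        (p : ℂ) • InnerProductSpace.rankOne ℂ (K x) x)
    rw [ContinuousLinearMap.comp_add, ContinuousLinearMap.comp_smul,
      ContinuousLinearMap.comp_smul, InnerProductSpace.comp_rankOne,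
      InnerProductSpace.comp_rankOne]
  rw [h2, Submodule.coe_add, trace_add (TraceClass.traceNorm_lt_top _) (TraceClass.traceNorm_lt_top _), Submodule.coe_smul,
    Submodule.coe_smul, trace_smul, trace_smul, tcRankOne_coe, tcRankOne_coe, trace_rankOne,
    trace_rankOne, Complex.add_re, Complex.re_ofReal_mul, Complex.re_ofReal_mul]
  have h3 := hH.re_inner_spectral_le hP hK hx₀
  have h4 := hH.re_inner_spectral_le hP hK hx
  have h5 : 0 ≤ 1 - p := sub_nonneg.2 h1
  gcongr

end EnergyBound

/-! ### Operators whose image is controlled by the energy-constrained norm. -/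

section Controlled

variable {A : Type u} [NormedAddCommGroup A] [InnerProductSpace ℂ A] [CompleteSpace A]
variable {B : Type v} [NormedAddCommGroup B] [InnerProductSpace ℂ B] [CompleteSpace B]
variable {R : Type w} [NormedAddCommGroup R] [InnerProductSpace ℂ R] [CompleteSpace R]

/-- On norm-bounded sets of superoperators, `‖Φ(T)‖₁` is controlled by the energy-constrained
diamond norm. -/
def EcdControlled (B : Type v) [NormedAddCommGroup B] [InnerProductSpace ℂ B] [CompleteSpace B]
    (R : Type w) [NormedAddCommGroup R] [InnerProductSpace ℂ R] [CompleteSpace R]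
    (H : A →ₗ.[ℂ] A) (E : ℝ) (T : TraceClass A) : Prop :=
  ∀ ε : NNReal, 0 < ε → ∃ M : NNReal, ∀ (Φ : Superoperator A B) (C : NNReal), OpNormLE Φ C →
    traceNorm (Φ T : B →L[ℂ] B) ≤ M * ecdNorm R H E Φ + C * ε

variable {H : A →ₗ.[ℂ] A} {E : ℝ}

theorem EcdControlled.zero : EcdControlled B R H E 0 := fun ε _ =>
  ⟨0, fun Φ C _ => by rw [map_zero]; exact traceNorm_zero.trans_le bot_le⟩

theorem EcdControlled.add {S T : TraceClass A} (hS : EcdControlled B R H E S)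
    (hT : EcdControlled B R H E T) : EcdControlled B R H E (S + T) := by
  intro ε hε
  obtain ⟨M, hM⟩ := hS (ε / 2) (half_pos hε)
  obtain ⟨N, hN⟩ := hT (ε / 2) (half_pos hε)
  refine ⟨M + N, fun Φ C hΦ => ?_⟩
  rw [map_add]
  refine (traceNorm_add_le _ _).trans ((add_le_add (hM Φ C hΦ) (hN Φ C hΦ)).trans_eq ?_)
  have h : (ε : ℝ≥0∞) = (ε / 2 : NNReal) + (ε / 2 : NNReal) := by
    rw [← ENNReal.coe_add, add_halves]
  rw [h, ENNReal.coe_add]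
  ring

theorem EcdControlled.smul (c : ℂ) {T : TraceClass A} (hT : EcdControlled B R H E T) :
    EcdControlled B R H E (c • T) := by
  intro ε hε
  obtain ⟨M, hM⟩ := hT (ε / (‖c‖₊ + 1)) (by positivity)
  refine ⟨‖c‖₊ * M, fun Φ C hΦ => ?_⟩
  rw [map_smul]
  refine (traceNorm_smul_le _ _).trans ((mul_le_mul_right (hM Φ C hΦ) _).trans ?_)
  rw [mul_add, ENNReal.coe_mul, mul_assoc, enorm_eq_nnnorm]
  refine add_le_add le_rfl ?_
  rw [mul_left_comm, ← ENNReal.coe_mul]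
  refine mul_le_mul_right ?_ _
  refine ENNReal.coe_le_coe.2 ?_
  rw [mul_div_assoc', div_le_iff₀ (by positivity), mul_comm]
  gcongr
  exact le_self_add

theorem EcdControlled.sum {ι : Type*} (F : Finset ι) {T : ι → TraceClass A}
    (hT : ∀ i ∈ F, EcdControlled B R H E (T i)) : EcdControlled B R H E (∑ i ∈ F, T i) :=
  Finset.sum_induction _ _ (fun _ _ => EcdControlled.add) EcdControlled.zero hT

/-- Closure under trace-norm limits is what the error term `C * ε` in `EcdControlled` is for: the
operator norm bound absorbs `Φ (T - S)`, while `M` may grow as `ε` shrinks. -/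
theorem EcdControlled.of_approx {T : TraceClass A}
    (h : ∀ ε : NNReal, 0 < ε → ∃ S : TraceClass A, EcdControlled B R H E S ∧
      traceNorm ((T - S : TraceClass A) : A →L[ℂ] A) ≤ ε) : EcdControlled B R H E T := by
  intro ε hε
  obtain ⟨S, hS, hST⟩ := h (ε / 2) (half_pos hε)
  obtain ⟨M, hM⟩ := hS (ε / 2) (half_pos hε)
  refine ⟨M, fun Φ C hΦ => ?_⟩
  have h1 : Φ T = Φ S + Φ (T - S) := by rw [← map_add]; congr 1; abel
  rw [h1]
  refine (traceNorm_add_le _ _).trans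
    ((add_le_add (hM Φ C hΦ) ((hΦ (T - S)).trans (mul_le_mul_right hST _))).trans_eq ?_)
  have h : (ε : ℝ≥0∞) = (ε / 2 : NNReal) + (ε / 2 : NNReal) := by
    rw [← ENNReal.coe_add, add_halves]
  rw [h]
  ring

theorem exists_mixture_weight {E e₀ e : ℝ} (h : e₀ < E) :
    ∃ p : ℝ, 0 < p ∧ p ≤ 1 ∧ (1 - p) * e₀ + p * e ≤ E := by
  -- The requirement is `p (e - e₀) ≤ E - e₀`; the `+ 1` keeps the denominator positive when `e =
  -- e₀`.
  refine ⟨min 1 ((E - e₀) / (|e - e₀| + 1)), ?_, min_le_left _ _, ?_⟩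
  · exact lt_min one_pos (div_pos (by linarith) (by positivity))
  · have h1 : min 1 ((E - e₀) / (|e - e₀| + 1)) ≤ (E - e₀) / (|e - e₀| + 1) := min_le_right _ _
    rw [le_div_iff₀ (by positivity)] at h1
    have h2 : 0 ≤ min 1 ((E - e₀) / (|e - e₀| + 1)) :=
      le_min zero_le_one (div_nonneg (by linarith) (by positivity))
    nlinarith [le_abs_self (e - e₀)]

/-- The energy of `x` may exceed `E`, but `|x⟩⟨x|` is a linear combination of two admissible states:
a mixture with small weight `p` on `x`, and `|x₀⟩⟨x₀|`, which is the mixture of weight `0`. No error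
term arises here. -/
theorem IsHamiltonian.ecdControlled_of_norm_eq_one (hH : IsHamiltonian H)
    (hE : groundEnergy H < (E : EReal)) {r : R} (hr : ‖r‖ = 1) {x y : A}
    (hxy : (x, y) ∈ H.graph) (hx : ‖x‖ = 1) : EcdControlled B R H E (tcRankOne x x) := by
  obtain ⟨x₀, y₀, h₀, hx₀, he₀⟩ := hH.exists_inner_lt hE
  obtain ⟨p, hp0, hp1, hp⟩ := exists_mixture_weight (e := (⟪x, y⟫_ℂ).re) he₀
  have hpc : (p : ℂ) ≠ 0 := by exact_mod_cast hp0.ne'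
  intro ε _
  refine ⟨‖(p : ℂ)⁻¹‖₊ + ‖(p : ℂ)⁻¹ * ((p - 1 : ℝ) : ℂ)‖₊, fun Φ C _ => ?_⟩
  have h1 : tcRankOne x x =
      (p : ℂ)⁻¹ • mixture p x₀ x + ((p : ℂ)⁻¹ * ((p - 1 : ℝ) : ℂ)) • mixture 0 x₀ x := by
    have h2 : (p : ℂ)⁻¹ * ((1 - p : ℝ) : ℂ) + (p : ℂ)⁻¹ * ((p - 1 : ℝ) : ℂ) = 0 := by
      push_cast; ring
    rw [mixture, mixture]
    simp only [smul_add, smul_smul, sub_zero, Complex.ofReal_one, Complex.ofReal_zero,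
      zero_smul, add_zero, inv_mul_cancel₀ hpc, one_smul]
    rw [add_right_comm, ← add_smul, h2, zero_smul, zero_add]
  rw [h1, map_add, map_smul, map_smul, ENNReal.coe_add, add_mul]
  refine le_trans ?_ le_self_add
  refine (traceNorm_add_le _ _).trans (add_le_add ?_ ?_)
  · refine (traceNorm_smul_le _ _).trans ?_
    rw [enorm_eq_nnnorm]
    gcongr
    exact traceNorm_map_le_ecdNorm Φ hr H (isState_mixture hp0.le hp1 hx₀ hx)
      (hH.energy_mixture_le hp0.le hp1 h₀ hxy hp)
  · refine (traceNorm_smul_le _ _).trans ?_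
    rw [enorm_eq_nnnorm]
    gcongr
    exact traceNorm_map_le_ecdNorm Φ hr H (isState_mixture le_rfl zero_le_one hx₀ hx)
      (hH.energy_mixture_le le_rfl zero_le_one h₀ hxy (by linarith))

theorem tcRankOne_smul_smul (c : ℝ) (x : A) :
    tcRankOne ((c : ℂ) • x) ((c : ℂ) • x) = ((c ^ 2 : ℝ) : ℂ) • tcRankOne x x := by
  refine Subtype.ext ?_
  rw [Submodule.coe_smul, tcRankOne_coe, tcRankOne_coe]
  ext z
  simp only [InnerProductSpace.rankOne_apply, _root_.smul_apply, inner_smul_left,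
    Complex.conj_ofReal, smul_smul]
  push_cast
  congr 1
  ring

theorem IsHamiltonian.ecdControlled_of_mem_graph (hH : IsHamiltonian H)
    (hE : groundEnergy H < (E : EReal)) {r : R} (hr : ‖r‖ = 1) {x y : A}
    (hxy : (x, y) ∈ H.graph) : EcdControlled B R H E (tcRankOne x x) := by
  rcases eq_or_ne x 0 with rfl | hx
  · have : tcRankOne (0 : A) 0 = 0 := Subtype.ext (by rw [tcRankOne_coe]; simp)
    rw [this]
    exact EcdControlled.zero
  have h0 : ‖x‖ ≠ 0 := norm_ne_zero_iff.2 hx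
  have h1 : x = ((‖x‖ : ℝ) : ℂ) • (((‖x‖⁻¹ : ℝ) : ℂ) • x) := by
    rw [smul_smul, ← Complex.ofReal_mul, mul_inv_cancel₀ h0, Complex.ofReal_one, one_smul]
  rw [h1, tcRankOne_smul_smul]
  refine EcdControlled.smul _ (hH.ecdControlled_of_norm_eq_one hE hr
    (H.graph.smul_mem ((‖x‖⁻¹ : ℝ) : ℂ) hxy) ?_)
  rw [norm_smul, Complex.norm_real, norm_inv, norm_norm, inv_mul_cancel₀ h0]

theorem IsHamiltonian.ecdControlled_tcRankOne (hH : IsHamiltonian H)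
    (hE : groundEnergy H < (E : EReal)) {r : R} (hr : ‖r‖ = 1) (z : A) :
    EcdControlled B R H E (tcRankOne z z) := by
  refine EcdControlled.of_approx fun ε hε => ?_
  -- This function bounds the trace norm of `|z⟩⟨z| - |x⟩⟨x| = |z - x⟩⟨z| + |x⟩⟨z - x|`; the
  -- approximating `x` is taken in the domain of `H`.
  have hlim : Filter.Tendsto (fun x : A => ‖z - x‖ * ‖z‖ + ‖x‖ * ‖z - x‖) (nhds z) (nhds 0) := by
    have : Continuous (fun x : A => ‖z - x‖ * ‖z‖ + ‖x‖ * ‖z - x‖) := by fun_prop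
    simpa using this.tendsto z
  obtain ⟨x, hx, hxε⟩ := mem_closure_iff_nhds.1 (hH.dense_domain z) _
    (hlim.eventually (ge_mem_nhds (NNReal.coe_pos.2 hε)))
  refine ⟨tcRankOne x x, hH.ecdControlled_of_mem_graph hE hr (H.mem_graph ⟨x, hxε⟩), ?_⟩
  have h1 : ((tcRankOne z z - tcRankOne x x : TraceClass A) : A →L[ℂ] A) =
      InnerProductSpace.rankOne ℂ (z - x) z + InnerProductSpace.rankOne ℂ x (z - x) := by
    rw [Submodule.coe_sub, tcRankOne_coe, tcRankOne_coe]
    simp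
  rw [h1]
  calc _ ≤ ‖z - x‖ₑ * ‖z‖ₑ + ‖x‖ₑ * ‖z - x‖ₑ := (traceNorm_add_le _ _).trans
        (add_le_add (traceNorm_rankOne_le _ _) (traceNorm_rankOne_le _ _))
    _ = ENNReal.ofReal (‖z - x‖ * ‖z‖ + ‖x‖ * ‖z - x‖) := by
      rw [ENNReal.ofReal_add (by positivity) (by positivity), ENNReal.ofReal_mul (by positivity),
        ENNReal.ofReal_mul (by positivity), ofReal_norm, ofReal_norm, ofReal_norm]
    _ ≤ ENNReal.ofReal ε := ENNReal.ofReal_le_ofReal hx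
    _ = ε := ENNReal.ofReal_coe_nnreal

theorem IsHamiltonian.ecdControlled_of_isPositive (hH : IsHamiltonian H)
    (hE : groundEnergy H < (E : EReal)) {r : R} (hr : ‖r‖ = 1) {ρ : TraceClass A}
    (hρ : (ρ : A →L[ℂ] A).IsPositive) : EcdControlled B R H E ρ := by
  refine EcdControlled.of_approx fun ε hε => ?_
  obtain ⟨S, hS, hSρ⟩ := exists_adjoint_comp_self hρ
  obtain ⟨F, hF⟩ := exists_finset_traceNorm_sub_le (stdBasis A) hS hSρ ρ.2
    (ENNReal.coe_pos.2 hε)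
  refine ⟨∑ i ∈ F, tcRankOne (S (stdBasis A i)) (S (stdBasis A i)),
    EcdControlled.sum F fun i _ => hH.ecdControlled_tcRankOne hE hr _, ?_⟩
  rw [Submodule.coe_sub, AddSubmonoidClass.coe_finsetSum]
  exact hF

end Controlled

/-! ### Discrete spectrum: spectral projectors and the tail estimate for the energy. -/

section DiscreteEnergy

variable {A : Type u} [NormedAddCommGroup A] [InnerProductSpace ℂ A] [CompleteSpace A]

theorem trace_sum_coe {ι : Type*} (F : Finset ι) (T : ι → TraceClass A) :
    trace ((∑ i ∈ F, T i : TraceClass A) : A →L[ℂ] A) = ∑ i ∈ F, trace (T i : A →L[ℂ] A) := by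
  classical
  induction F using Finset.induction_on with
  | empty => simp [trace]
  | insert i F hi ih =>
    rw [Finset.sum_insert hi, Finset.sum_insert hi, Submodule.coe_add,
      trace_add (TraceClass.traceNorm_lt_top _) (TraceClass.traceNorm_lt_top _), ih]

variable {H : A →ₗ.[ℂ] A} {τ : HilbertBasis ℕ ℂ A} {e : ℕ → ℝ}

theorem IsHamiltonian.inner_eigenvector (hH : IsHamiltonian H)
    (hτ : ∀ k, (τ k, (e k : ℂ) • τ k) ∈ H.graph) {x y : A} (hxy : (x, y) ∈ H.graph) (k : ℕ) :
    ⟪τ k, y⟫_ℂ = e k * ⟪τ k, x⟫_ℂ := by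
  rw [← hH.inner_graph_comm (hτ k) hxy, inner_smul_left, Complex.conj_ofReal]

theorem eigenvector_sum_mem_graph (hτ : ∀ k, (τ k, (e k : ℂ) • τ k) ∈ H.graph) (F : Finset ℕ)
    (c : ℕ → ℂ) : (∑ k ∈ F, c k • τ k, ∑ k ∈ F, (e k * c k) • τ k) ∈ H.graph := by
  have h : (∑ k ∈ F, c k • τ k, ∑ k ∈ F, (e k * c k) • τ k) =
      ∑ k ∈ F, c k • (τ k, (e k : ℂ) • τ k) := by
    ext
    · simp [Prod.fst_sum]
    · simp only [Prod.snd_sum, Prod.smul_mk, smul_smul, mul_comm]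
  rw [h]
  exact H.graph.sum_mem fun k _ => H.graph.smul_mem _ (hτ k)

theorem re_inner_basisProj (F : Finset ℕ) (x : A) (c : ℕ → ℝ) :
    (⟪basisProj τ F x, ∑ k ∈ F, ((c k : ℂ) * ⟪τ k, x⟫_ℂ) • τ k⟫_ℂ).re =
      ∑ k ∈ F, c k * ‖⟪τ k, x⟫_ℂ‖ ^ 2 := by
  rw [inner_sum, Complex.re_sum]
  refine Finset.sum_congr rfl fun k hk => ?_
  rw [inner_smul_right, ← inner_conj_symm (basisProj τ F x), inner_basisProj, if_pos hk, mul_assoc,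
    Complex.re_ofReal_mul, Complex.mul_conj, Complex.ofReal_re, Complex.normSq_eq_norm_sq]

/-- All conditions are read off coefficients in the eigenbasis. This exhibits an actual term of the
supremum defining `energy`, so that an energy bound carries information. -/
theorem IsHamiltonian.isSpectralProjector_basisProj (hH : IsHamiltonian H)
    (hτ : ∀ k, (τ k, (e k : ℂ) • τ k) ∈ H.graph) {t : ℝ} {F : Finset ℕ}
    (hF : ∀ k, k ∈ F ↔ e k ≤ t) : IsSpectralProjector H t (basisProj τ F) where
  isStarProjection := by
    constructor
    · refine ContinuousLinearMap.ext fun x => ?_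
      change basisProj τ F (basisProj τ F x) = basisProj τ F x
      rw [basisProj_apply τ F (basisProj τ F x), basisProj_apply τ F x]
      refine Finset.sum_congr rfl fun k hk => ?_
      rw [← basisProj_apply τ F x, inner_basisProj, if_pos hk]
    · rw [IsSelfAdjoint, ContinuousLinearMap.star_eq_adjoint, adjoint_basisProj]
  commutes x y hxy := by
    rw [basisProj_apply, basisProj_apply]
    simp_rw [hH.inner_eigenvector hτ hxy]
    exact eigenvector_sum_mem_graph hτ F _
  le_on_range x := by
    refine ⟨_, basisProj_apply τ F x ▸ eigenvector_sum_mem_graph hτ F fun k => ⟪τ k, x⟫_ℂ, ?_⟩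
    have h1 : ‖basisProj τ F x‖ ^ 2 = ∑ k ∈ F, 1 * ‖⟪τ k, x⟫_ℂ‖ ^ 2 := by
      rw [← re_inner_basisProj F x fun _ => 1, ← inner_self_eq_norm_sq (𝕜 := ℂ)]
      simp [basisProj_apply]
    rw [re_inner_basisProj, h1, Finset.mul_sum]
    refine Finset.sum_le_sum fun k hk => ?_
    rw [one_mul]
    exact mul_le_mul_of_nonneg_right ((hF k).1 hk) (sq_nonneg _)
  lt_off_range x y hxy hP hx := by
    have h0 : ∀ k ∈ F, ⟪τ k, x⟫_ℂ = 0 := fun k hk => by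
      have := inner_basisProj τ F k x
      rw [hP, inner_zero_right, if_pos hk] at this
      exact this.symm
    have h1 : HasSum (fun k => ‖⟪τ k, x⟫_ℂ‖ ^ 2) (‖x‖ ^ 2) := by
      have h := Complex.hasSum_re (τ.hasSum_inner_mul_inner x x)
      convert h using 1
      · funext k
        rw [← inner_conj_symm x (τ k), mul_comm, Complex.mul_conj, Complex.ofReal_re,
          Complex.normSq_eq_norm_sq]
      · exact (inner_self_eq_norm_sq (𝕜 := ℂ) x).symm
    have h2 : HasSum (fun k => e k * ‖⟪τ k, x⟫_ℂ‖ ^ 2) (⟪x, y⟫_ℂ).re := by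
      have h := Complex.hasSum_re (τ.hasSum_inner_mul_inner x y)
      convert h using 1
      funext k
      rw [hH.inner_eigenvector hτ hxy, ← inner_conj_symm x (τ k), mul_left_comm,
        Complex.re_ofReal_mul, mul_comm (starRingEnd ℂ _), Complex.mul_conj, Complex.ofReal_re,
        Complex.normSq_eq_norm_sq]
    obtain ⟨k, hk⟩ : ∃ k, ⟪τ k, x⟫_ℂ ≠ 0 := by
      by_contra hcon
      push Not at hcon
      exact hx (τ.eq_zero_of_forall_inner x hcon)
    -- Strictness comes from one nonzero coefficient: its index lies outside `F`, so its eigenvalue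
    -- is strictly above `t`.
    refine hasSum_lt (i := k) (fun j => ?_) ?_ (h1.mul_left t) h2
    · by_cases hj : j ∈ F
      · simp [h0 j hj]
      · exact mul_le_mul_of_nonneg_right (not_le.1 fun h => hj ((hF j).2 h)).le (sq_nonneg _)
    · have hkF : k ∉ F := fun h => hk (h0 k h)
      exact mul_lt_mul_of_pos_right (not_le.1 fun h => hkF ((hF k).2 h))
        (by positivity)

theorem exists_finset_le (he : Filter.Tendsto e Filter.atTop Filter.atTop) (t : ℝ) :
    ∃ F : Finset ℕ, ∀ k, k ∈ F ↔ e k ≤ t := by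
  have h := (Nat.cofinite_eq_atTop ▸ he.eventually_gt_atTop t : ∀ᶠ k in Filter.cofinite, t < e k)
  rw [Filter.eventually_cofinite] at h
  refine ⟨h.toFinset, fun k => ?_⟩
  rw [Set.Finite.mem_toFinset, Set.mem_ofPred_eq, not_lt]

theorem IsHamiltonian.sum_le_of_energy_le (hH : IsHamiltonian H)
    (hτ : ∀ k, (τ k, (e k : ℂ) • τ k) ∈ H.graph) {E : ℝ} (hE : 0 ≤ E) {ω : TraceClass A}
    (hω : energy H ω ≤ ENNReal.ofReal E) {n : ℕ} {F : Finset ℕ} (hF : ∀ k, k ∈ F ↔ e k ≤ n) :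
    ∑ k ∈ F, e k * (⟪τ k, (ω : A →L[ℂ] A) (τ k)⟫_ℂ).re ≤ E := by
  let K : A →L[ℂ] A := ∑ k ∈ F, (e k : ℂ) • InnerProductSpace.rankOne ℂ (τ k) (τ k)
  have hK : ∀ x, (basisProj τ F x, K x) ∈ H.graph := by
    intro x
    have h := eigenvector_sum_mem_graph hτ F fun k => ⟪τ k, x⟫_ℂ
    rw [← basisProj_apply] at h
    convert h using 2
    simp only [K, _root_.sum_apply, _root_.smul_apply, InnerProductSpace.rankOne_apply, smul_smul]
  have h1 : ENNReal.ofReal (trace (K ∘L (ω : A →L[ℂ] A))).re ≤ ENNReal.ofReal E := by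
    refine le_trans ?_ hω
    refine le_iSup_of_le n (le_iSup_of_le (basisProj τ F) (le_iSup_of_le K ?_))
    exact le_iSup₂_of_le (hH.isSpectralProjector_basisProj hτ hF) hK le_rfl
  -- `|τ k⟩⟨τ k| ω = |τ k⟩⟨ω† τ k|`, which makes the trace a finite sum of inner products.
  have h2 : K ∘L (ω : A →L[ℂ] A) = ((∑ k ∈ F, (e k : ℂ) •
      tcRankOne (τ k) (ContinuousLinearMap.adjoint (ω : A →L[ℂ] A) (τ k)) : TraceClass A) :
        A →L[ℂ] A) := by
    rw [AddSubmonoidClass.coe_finsetSum]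
    ext x
    simp [K, tcRankOne_coe, ContinuousLinearMap.adjoint_inner_left]
  have h3 : (trace (K ∘L (ω : A →L[ℂ] A))).re =
      ∑ k ∈ F, e k * (⟪τ k, (ω : A →L[ℂ] A) (τ k)⟫_ℂ).re := by
    rw [h2, trace_sum_coe, Complex.re_sum]
    refine Finset.sum_congr rfl fun k _ => ?_
    rw [Submodule.coe_smul, trace_smul, tcRankOne_coe, trace_rankOne, Complex.re_ofReal_mul,
      ContinuousLinearMap.adjoint_inner_left]
  rw [← h3]
  exact (ENNReal.ofReal_le_ofReal_iff hE).1 h1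

/-- Markov's inequality for the energy distribution `⟨τ k, ω τ k⟩`. -/
theorem IsHamiltonian.sum_tail_le (hH : IsHamiltonian H)
    (hτ : ∀ k, (τ k, (e k : ℂ) • τ k) ∈ H.graph)
    (he : Filter.Tendsto e Filter.atTop Filter.atTop) {E : ℝ} (hE : 0 ≤ E) {ω : TraceClass A}
    (hω : energy H ω ≤ ENNReal.ofReal E)
    (hpos : ∀ k, 0 ≤ (⟪τ k, (ω : A →L[ℂ] A) (τ k)⟫_ℂ).re) {N : ℝ} (hN : 0 < N) (G : Finset ℕ)
    (hG : ∀ k ∈ G, N ≤ e k) :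
    ∑ k ∈ G, (⟪τ k, (ω : A →L[ℂ] A) (τ k)⟫_ℂ).re ≤ E / N := by
  have he0 : ∀ k, 0 ≤ e k := fun k => by
    have h := hH.re_inner_graph_nonneg (hτ k)
    rwa [inner_smul_right, inner_self_eq_one_of_norm_eq_one (τ.orthonormal.1 k), mul_one,
      Complex.ofReal_re] at h
  -- Eigenvalues are nonnegative, so the sum over `G` bounds each one and the cutoff `n` includes
  -- all of `G`.
  obtain ⟨n, hn⟩ := exists_nat_ge (∑ k ∈ G, e k)
  obtain ⟨F, hF⟩ := exists_finset_le he n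
  have hGF : G ⊆ F := fun k hk =>
    (hF k).2 ((Finset.single_le_sum (fun j _ => he0 j) hk).trans hn)
  rw [le_div_iff₀ hN, mul_comm, Finset.mul_sum]
  refine le_trans ?_ (hH.sum_le_of_energy_le hτ hE hω hF)
  refine (Finset.sum_le_sum fun k hk => mul_le_mul_of_nonneg_right (hG k hk) (hpos k)).trans ?_
  exact Finset.sum_le_sum_of_subset_of_nonneg hGF fun k _ _ => mul_nonneg (he0 k) (hpos k)

end DiscreteEnergy

/-! ### Energy truncation of bipartite states. -/

section Truncation

variable {A : Type u} [NormedAddCommGroup A] [InnerProductSpace ℂ A] [CompleteSpace A]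
variable {B : Type v} [NormedAddCommGroup B] [InnerProductSpace ℂ B] [CompleteSpace B]
variable {R : Type w} [NormedAddCommGroup R] [InnerProductSpace ℂ R] [CompleteSpace R]

theorem adjoint_opTensor (X : A →L[ℂ] A) (Y : R →L[ℂ] R) :
    ContinuousLinearMap.adjoint (opTensor X Y) =
      opTensor (ContinuousLinearMap.adjoint X) (ContinuousLinearMap.adjoint Y) := by
  refine ext_inner_simple fun a r b s => ?_
  rw [ContinuousLinearMap.adjoint_inner_right, opTensor_simple, opTensor_simple, inner_simple,
    inner_simple, ContinuousLinearMap.adjoint_inner_right, ContinuousLinearMap.adjoint_inner_right]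

/-- Truncating `ρ = S²` by `P` changes it by at most `2δ` if `S` is `δ`-small off `P`. -/
theorem traceNorm_sub_truncation_le {H : Type*} [NormedAddCommGroup H] [InnerProductSpace ℂ H]
    [CompleteSpace H] {ρ S P : H →L[ℂ] H} (hS : ContinuousLinearMap.adjoint S = S)
    (hρ : S ∘L S = ρ) (hP : ContinuousLinearMap.adjoint P = P) (h1 : hsSq S ≤ 1)
    (hSP : hsSq (S ∘L P) ≤ 1) {δ : ℝ≥0∞}
    (hδ : hsSq (S ∘L (ContinuousLinearMap.id ℂ H - P)) ≤ δ ^ 2) :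
    traceNorm (ρ - P ∘L ρ ∘L P) ≤ 2 * δ := by
  let Q : H →L[ℂ] H := ContinuousLinearMap.id ℂ H - P
  have hQ : ContinuousLinearMap.adjoint Q = Q := by
    rw [map_sub, hP, ContinuousLinearMap.adjoint_id]
  -- This is `ρ - PρP = Qρ + PρQ`. Each term has a factor `S Q`, so Hölder bounds each by `δ`.
  have hid : ρ - P ∘L ρ ∘L P = ContinuousLinearMap.adjoint (S ∘L Q) ∘L S +
      ContinuousLinearMap.adjoint (S ∘L P) ∘L (S ∘L Q) := by
    rw [ContinuousLinearMap.adjoint_comp, ContinuousLinearMap.adjoint_comp, hS, hQ, hP, ← hρ]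
    ext x
    simp [Q]
  have h2 : traceNorm (ContinuousLinearMap.adjoint (S ∘L Q) ∘L S) ≤ δ := by
    refine (ENNReal.pow_le_pow_left_iff two_ne_zero).1 ((traceNorm_adjoint_comp_sq_le _ _).trans ?_)
    calc _ ≤ δ ^ 2 * 1 := by gcongr
      _ = _ := mul_one _
  have h3 : traceNorm (ContinuousLinearMap.adjoint (S ∘L P) ∘L (S ∘L Q)) ≤ δ := by
    refine (ENNReal.pow_le_pow_left_iff two_ne_zero).1 ((traceNorm_adjoint_comp_sq_le _ _).trans ?_)
    calc _ ≤ 1 * δ ^ 2 := by gcongr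
      _ = _ := one_mul _
  rw [hid, two_mul]
  exact (traceNorm_add_le _ _).trans (add_le_add h2 h3)

/-- Translates diagonal elements of the marginal into Hilbert-Schmidt mass of `S = √ρ` on `a ⊗ R`.
Positivity of these elements is part of the conclusion because `ω` is known only through the partial
trace. -/
theorem hsSq_comp_tensorLeft_eq {ρ : TraceClass (HilbertTensor A R)} {ω : TraceClass A}
    (hρω : IsPartialTrace ρ ω) {S : HilbertTensor A R →L[ℂ] HilbertTensor A R}
    (hS : ContinuousLinearMap.adjoint S = S) (hρ : S ∘L S = ρ) (a : A) :
    (0 ≤ (⟪a, (ω : A →L[ℂ] A) a⟫_ℂ).re) ∧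
      hsSq (S ∘L tensorLeft R a) = ENNReal.ofReal (⟪a, (ω : A →L[ℂ] A) a⟫_ℂ).re := by
  have h1 : ContinuousLinearMap.adjoint (tensorLeft R a) ∘L
      (ρ : HilbertTensor A R →L[ℂ] HilbertTensor A R) ∘L tensorLeft R a =
      ContinuousLinearMap.adjoint (S ∘L tensorLeft R a) ∘L (S ∘L tensorLeft R a) := by
    rw [ContinuousLinearMap.adjoint_comp, hS, ← hρ]; rfl
  have h2 := hρω a a
  have h3 : traceNorm (ContinuousLinearMap.adjoint (tensorLeft R a) ∘L
      (ρ : HilbertTensor A R →L[ℂ] HilbertTensor A R) ∘L tensorLeft R a) < ⊤ :=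
    traceNorm_compression_lt_top ρ.2 _ _
  rw [h1] at h2 h3
  rw [h2, trace_of_isPositive (ContinuousLinearMap.isPositive_adjoint_comp_self _),
    Complex.ofReal_re, ENNReal.ofReal_toReal h3.ne, traceNorm_adjoint_comp_self]
  exact ⟨ENNReal.toReal_nonneg, rfl⟩

theorem truncation_eq_sum {ι : Type*} (τ : HilbertBasis ι ℂ A) (F : Finset ι)
    (ρ : TraceClass (HilbertTensor A R)) :
    opTensor (basisProj τ F) (ContinuousLinearMap.id ℂ R) ∘L
      (ρ : HilbertTensor A R →L[ℂ] HilbertTensor A R) ∘L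
        opTensor (basisProj τ F) (ContinuousLinearMap.id ℂ R) =
      ((∑ k ∈ F, ∑ l ∈ F, tcTensor (tcRankOne (τ k) (τ l))
        (compression (tensorLeft R (τ k)) (tensorLeft R (τ l)) ρ) :
          TraceClass (HilbertTensor A R)) : HilbertTensor A R →L[ℂ] HilbertTensor A R) := by
  have hP : ContinuousLinearMap.adjoint (opTensor (basisProj τ F) (ContinuousLinearMap.id ℂ R)) =
      opTensor (basisProj τ F) (ContinuousLinearMap.id ℂ R) := by
    rw [adjoint_opTensor, adjoint_basisProj, ContinuousLinearMap.adjoint_id]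
  have hsum : ∀ (a : A) (r : R), simple (basisProj τ F a) r =
      ∑ k ∈ F, ⟪τ k, a⟫_ℂ • simple (τ k) r := fun a r => by
    simp only [← tensorRight_apply, basisProj_apply, map_sum, map_smul]
  refine ext_inner_simple fun a r b s => ?_
  rw [ContinuousLinearMap.comp_apply, ← hP, ContinuousLinearMap.adjoint_inner_right, hP,
    ContinuousLinearMap.comp_apply, opTensor_simple, opTensor_simple, ContinuousLinearMap.id_apply,
    ContinuousLinearMap.id_apply, hsum, hsum, sum_inner, AddSubmonoidClass.coe_finsetSum,
    _root_.sum_apply, inner_sum]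
  refine Finset.sum_congr rfl fun k _ => ?_
  rw [map_sum, inner_sum, AddSubmonoidClass.coe_finsetSum, _root_.sum_apply, inner_sum]
  refine Finset.sum_congr rfl fun l _ => ?_
  have h : ((tcTensor (tcRankOne (τ k) (τ l)) (compression (tensorLeft R (τ k))
      (tensorLeft R (τ l)) ρ) : TraceClass (HilbertTensor A R)) :
        HilbertTensor A R →L[ℂ] HilbertTensor A R) (simple a r) =
      simple (⟪τ l, a⟫_ℂ • τ k) (ContinuousLinearMap.adjoint (tensorLeft R (τ k))
        (ρ.1 (tensorLeft R (τ l) r))) := opTensor_simple _ _ _ _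
  rw [h, inner_simple, ContinuousLinearMap.adjoint_inner_right, tensorLeft_apply, tensorLeft_apply,
    map_smul, inner_smul_left, inner_smul_right, inner_smul_right, inner_conj_symm]
  ring

/-- Each admissible state is its cutoff to `F` plus a remainder of trace norm at most `2δ`. The
cutoff is a finite sum of product operators whose reference factors have trace norm at most 1; the
diamond norm controls the remainder. -/
theorem IsHamiltonian.ecdNorm_le_of_discrete {H : A →ₗ.[ℂ] A} {τ : HilbertBasis ℕ ℂ A}
    {e : ℕ → ℝ} (hH : IsHamiltonian H) (hτ : ∀ k, (τ k, (e k : ℂ) • τ k) ∈ H.graph)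
    (he : Filter.Tendsto e Filter.atTop Filter.atTop) {E : ℝ} (hE : 0 ≤ E) {N : ℝ} (hN : 0 < N)
    {F : Finset ℕ} (hF : ∀ k, k ∉ F → N ≤ e k) {δ : ℝ≥0∞} (hδ : ENNReal.ofReal (E / N) ≤ δ ^ 2)
    {C : ℝ≥0∞} {Φ : Superoperator A B} (hΦ : diamondNorm R Φ ≤ C) :
    ecdNorm R H E Φ ≤
      ∑ k ∈ F, ∑ l ∈ F, traceNorm (Φ (tcRankOne (τ k) (τ l)) : B →L[ℂ] B) + C * (2 * δ) := by
  classical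
  refine iSup₂_le fun ρ hρ => iSup_le fun ⟨ω, hρω, hω⟩ => ?_
  obtain ⟨S, hS, hSρ⟩ := exists_adjoint_comp_self hρ.1
  let P : HilbertTensor A R →L[ℂ] HilbertTensor A R :=
    opTensor (basisProj τ F) (ContinuousLinearMap.id ℂ R)
  have hP : ContinuousLinearMap.adjoint P = P := by
    rw [adjoint_opTensor, adjoint_basisProj, ContinuousLinearMap.adjoint_id]
  have hPb : ∀ k r, P (simple (τ k) r) = if k ∈ F then simple (τ k) r else 0 := by
    intro k r
    rw [opTensor_simple, basisProj_self, ContinuousLinearMap.id_apply]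
    split_ifs
    · rfl
    · rw [← tensorRight_apply, map_zero]
  have h1 : hsSq S = 1 := by
    rw [← traceNorm_adjoint_comp_self, hS, hSρ, hρ.traceNorm_eq]
  have hSP : hsSq (S ∘L P) ≤ 1 := by
    rw [← h1, hsSq_eq (productBasis τ (stdBasis R)), hsSq_eq (productBasis τ (stdBasis R))]
    refine ENNReal.tsum_le_tsum fun p => ?_
    rw [productBasis_apply, ContinuousLinearMap.comp_apply, hPb]
    split_ifs
    · exact le_rfl
    · simp
  -- Computed in a product basis, this mass is the sum of `⟨τ k, ω τ k⟩` over `k ∉ F`, and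
  -- `sum_tail_le` bounds its finite partial sums.
  have hSQ : hsSq (S ∘L (ContinuousLinearMap.id ℂ _ - P)) ≤ δ ^ 2 := by
    refine le_trans ?_ hδ
    rw [hsSq_eq (productBasis τ (stdBasis R)), ENNReal.tsum_prod', ENNReal.tsum_eq_iSup_sum]
    refine iSup_le fun G => ?_
    have h2 : ∀ k, ∑' j, ‖(S ∘L (ContinuousLinearMap.id ℂ _ - P))
        (productBasis τ (stdBasis R) (k, j))‖ₑ ^ 2 =
        if k ∈ F then 0 else ENNReal.ofReal (⟪τ k, (ω : A →L[ℂ] A) (τ k)⟫_ℂ).re := by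
      intro k
      have h3 : ∀ j, (S ∘L (ContinuousLinearMap.id ℂ _ - P))
          (productBasis τ (stdBasis R) (k, j)) =
          if k ∈ F then 0 else (S ∘L tensorLeft R (τ k)) (stdBasis R j) := by
        intro j
        rw [productBasis_apply, ContinuousLinearMap.comp_apply, _root_.sub_apply, hPb,
          ContinuousLinearMap.id_apply]
        split_ifs
        · rw [sub_self, map_zero]
        · rw [sub_zero]; rfl
      simp_rw [h3]
      split_ifs
      · simp
      · exact (hsSq_comp_tensorLeft_eq hρω hS hSρ (τ k)).2
    have h4 := hH.sum_tail_le hτ he hE hω (fun k => (hsSq_comp_tensorLeft_eq hρω hS hSρ (τ k)).1)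
      hN (G.filter (· ∉ F)) (fun k hk => hF k (Finset.mem_filter.1 hk).2)
    simp_rw [h2]
    have h5 : ∑ k ∈ G, (if k ∈ F then 0 else
        ENNReal.ofReal (⟪τ k, (ω : A →L[ℂ] A) (τ k)⟫_ℂ).re) =
        ∑ k ∈ G.filter (· ∉ F), ENNReal.ofReal (⟪τ k, (ω : A →L[ℂ] A) (τ k)⟫_ℂ).re := by
      rw [Finset.sum_filter]
      refine Finset.sum_congr rfl fun k _ => ?_
      split_ifs <;> rfl
    rw [h5, ← ENNReal.ofReal_sum_of_nonneg fun k _ => (hsSq_comp_tensorLeft_eq hρω hS hSρ (τ k)).1]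
    exact ENNReal.ofReal_le_ofReal h4
  have h6 := traceNorm_sub_truncation_le hS hSρ hP h1.le hSP hSQ
  set ρ' : TraceClass (HilbertTensor A R) := ∑ k ∈ F, ∑ l ∈ F, tcTensor (tcRankOne (τ k) (τ l))
    (compression (tensorLeft R (τ k)) (tensorLeft R (τ l)) ρ) with hρ'
  have h7 : P ∘L (ρ : HilbertTensor A R →L[ℂ] HilbertTensor A R) ∘L P =
      (ρ' : HilbertTensor A R →L[ℂ] HilbertTensor A R) := truncation_eq_sum τ F ρ
  -- The diamond norm bound, known for states, extends to Hermitian operators with the same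
  -- constant.
  have h8 : IsSelfAdjoint ((ρ - ρ' : TraceClass (HilbertTensor A R)) :
      HilbertTensor A R →L[ℂ] HilbertTensor A R) := by
    rw [Submodule.coe_sub, ← h7]
    refine hρ.1.isSelfAdjoint.sub ?_
    have h9 := (hρ.1.conj_adjoint P).isSelfAdjoint
    rwa [hP] at h9
  have h10 : ρ = ρ' + (ρ - ρ') := by abel
  rw [h10]
  refine (ampliationNorm_add_le _ _ _).trans (add_le_add ?_ ?_)
  · refine (ampliationNorm_sum_le _ _ _).trans (Finset.sum_le_sum fun k _ => ?_)
    refine (ampliationNorm_sum_le _ _ _).trans (Finset.sum_le_sum fun l _ => ?_)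
    refine (ampliationNorm_tcTensor_le _ _ _).trans ?_
    have hone : ∀ k, ‖tensorLeft R (τ k)‖ₑ ≤ 1 := fun k => by
      refine (enorm_tensorLeft_le _).trans ?_
      rw [← ofReal_norm, τ.orthonormal.1 k, ENNReal.ofReal_one]
    have h11 : traceNorm (compression (tensorLeft R (τ k)) (tensorLeft R (τ l)) ρ : R →L[ℂ] R) ≤
        1 := by
      refine (traceNorm_compression_le _ _ _).trans ?_
      rw [hρ.traceNorm_eq, mul_one]
      exact mul_le_one' (hone k) (hone l)
    calc _ ≤ traceNorm (Φ (tcRankOne (τ k) (τ l)) : B →L[ℂ] B) * 1 := by gcongr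
      _ = _ := mul_one _
  · refine (ampliationNorm_le_mul_traceNorm hΦ _ h8).trans ?_
    gcongr
    rw [Submodule.coe_sub, ← h7]
    exact h6

end Truncation

/-! ### Positive semidefinite forms and their representation on a completion. -/

section Form

/-- Polarization: positivity makes `q` real on the diagonal, in particular at `u + v` and `u + i v`.
-/
theorem form_conj_symm {V : Type*} [AddCommGroup V] [Module ℂ V] (q : V →ₗ⋆[ℂ] V →ₗ[ℂ] ℂ)
    (hq : ∀ u, 0 ≤ q u u) (u v : V) : (starRingEnd ℂ) (q v u) = q u v := by
  have him : ∀ x, (q x x).im = 0 := fun x => (Complex.le_def.1 (hq x)).2.symm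
  have h1 := him (u + v)
  have h2 := him (u + Complex.I • v)
  simp only [map_add, LinearMap.add_apply, map_smulₛₗ, LinearMap.smul_apply, smul_eq_mul,
    Complex.add_im, him, Complex.mul_im, Complex.conj_I, Complex.neg_re, Complex.neg_im,
    Complex.I_re, Complex.I_im, RingHom.id_apply, Complex.add_re, Complex.mul_re] at h1 h2
  apply Complex.ext
  · rw [Complex.conj_re]; linarith
  · rw [Complex.conj_im]; linarith

theorem form_norm_sq_le {V : Type*} [AddCommGroup V] [Module ℂ V] (q : V →ₗ⋆[ℂ] V →ₗ[ℂ] ℂ)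
    (hq : ∀ u, 0 ≤ q u u) (u v : V) : ‖q u v‖ ^ 2 ≤ (q u u).re * (q v v).re := by
  let c : PreInnerProductSpace.Core ℂ V :=
    { inner := fun u v => q u v
      conj_inner_symm := form_conj_symm q hq
      re_inner_nonneg := fun u => (Complex.le_def.1 (hq u)).1
      add_left := fun x y z => by simp
      smul_left := fun x y r => by simp }
  have h := @InnerProductSpace.Core.inner_mul_inner_self_le ℂ V _ _ _ c u v
  change ‖q u v‖ * ‖q v u‖ ≤ (q u u).re * (q v v).re at h
  rwa [← form_conj_symm q hq v u, RCLike.norm_conj, ← sq] at h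

variable {V : Type*} [NormedAddCommGroup V] [InnerProductSpace ℂ V]

/-- A bounded positive form on `V` is represented by a positive operator on the completion. -/
theorem exists_isPositive_of_form (q : V →ₗ⋆[ℂ] V →ₗ[ℂ] ℂ) (hq : ∀ u, 0 ≤ q u u)
    {C : ℝ} (hC : 0 ≤ C) (hb : ∀ u, (q u u).re ≤ C * ‖u‖ ^ 2) :
    ∃ σ : UniformSpace.Completion V →L[ℂ] UniformSpace.Completion V, σ.IsPositive ∧
      ∀ u v : V, ⟪(u : UniformSpace.Completion V), σ v⟫_ℂ = q u v := by
  have hbound : ∀ u v, ‖q u v‖ ≤ C * ‖u‖ * ‖v‖ := by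
    intro u v
    refine (sq_le_sq₀ (norm_nonneg _) (by positivity)).1 ((form_norm_sq_le q hq u v).trans ?_)
    calc _ ≤ (C * ‖u‖ ^ 2) * (C * ‖v‖ ^ 2) := by
          refine mul_le_mul (hb u) (hb v) (Complex.le_def.1 (hq v)).1 (by positivity)
      _ = _ := by ring
  let ι : V →ₗ[ℂ] UniformSpace.Completion V :=
    (UniformSpace.Completion.toComplL : V →L[ℂ] UniformSpace.Completion V).toLinearMap
  have hd : DenseRange ι := UniformSpace.Completion.denseRange_coe
  have hι : ∀ v, ‖ι v‖ = ‖v‖ := fun v => UniformSpace.Completion.norm_coe v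
  have hqι : ∀ u v, ‖q u v‖ ≤ C * ‖u‖ * ‖ι v‖ := fun u v => by rw [hι]; exact hbound u v
  have hf : ∀ u v, (q u).extendOfNorm ι (ι v) = q u v := fun u v =>
    LinearMap.extendOfNorm_eq hd ⟨_, hqι u⟩ v
  have hT : ∀ u v, ⟪(InnerProductSpace.toDual ℂ _).symm ((q u).extendOfNorm ι), ι v⟫_ℂ = q u v :=
    fun u v => by rw [InnerProductSpace.toDual_symm_apply, hf]
  have hext : ∀ x y : UniformSpace.Completion V, (∀ v, ⟪x, ι v⟫_ℂ = ⟪y, ι v⟫_ℂ) → x = y := by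
    intro x y h
    refine ext_inner_right ℂ fun z => ?_
    exact hd.induction_on (p := fun z => ⟪x, z⟫_ℂ = ⟪y, z⟫_ℂ) z
      (isClosed_eq (by fun_prop) (by fun_prop)) h
  -- `T u` is the Riesz vector of the extension of `q u` to the completion. It is linear in `u`,
  -- since both `q` and the Riesz map are conjugate linear.
  let T : V →ₗ[ℂ] UniformSpace.Completion V :=
    { toFun := fun u => (InnerProductSpace.toDual ℂ _).symm ((q u).extendOfNorm ι)
      map_add' := fun x y => hext _ _ fun v => by
        rw [inner_add_left, hT, hT, hT, map_add, LinearMap.add_apply]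
      map_smul' := fun c x => hext _ _ fun v => by
        rw [inner_smul_left, hT, hT, map_smulₛₗ, LinearMap.smul_apply]; rfl }
  have hTq : ∀ u v, ⟪T u, ι v⟫_ℂ = q u v := hT
  have hTb : ∀ u, ‖T u‖ ≤ C * ‖ι u‖ := by
    intro u
    rw [hι]
    change ‖(InnerProductSpace.toDual ℂ _).symm ((q u).extendOfNorm ι)‖ ≤ _
    rw [LinearIsometryEquiv.norm_map]
    exact LinearMap.opNorm_extendOfNorm_le hd (by positivity) (hqι u)
  let σ : UniformSpace.Completion V →L[ℂ] UniformSpace.Completion V := T.extendOfNorm ι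
  have hσ : ∀ u, σ (ι u) = T u := fun u => LinearMap.extendOfNorm_eq hd ⟨_, hTb⟩ u
  have hpos : ∀ x, 0 ≤ ⟪σ x, x⟫_ℂ := by
    intro x
    have := Complex.orderClosedTopology
    refine hd.induction_on (p := fun z => 0 ≤ ⟪σ z, z⟫_ℂ) x
      (isClosed_le continuous_const (by fun_prop)) fun u => ?_
    rw [hσ, hTq]
    exact hq u
  have hσpos : σ.IsPositive := by
    refine (ContinuousLinearMap.isPositive_iff_complex _).2 fun x => ⟨?_, ?_⟩
    · exact (Complex.eq_re_of_ofReal_le (r := 0) (by simpa using hpos x)).symm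
    · exact (Complex.le_def.1 (hpos x)).1
  refine ⟨σ, hσpos, fun u v => ?_⟩
  rw [← hσpos.inner_left_eq_inner_right]
  change ⟪σ (ι u), ι v⟫_ℂ = _
  rw [hσ, hTq]

end Form

/-! ### Channels have diamond norm at most one. -/

section Channel

variable {A : Type u} [NormedAddCommGroup A] [InnerProductSpace ℂ A] [CompleteSpace A]
variable {B : Type v} [NormedAddCommGroup B] [InnerProductSpace ℂ B] [CompleteSpace B]
variable {R : Type w} [NormedAddCommGroup R] [InnerProductSpace ℂ R] [CompleteSpace R]

theorem entry_add_left (r r' s : R) (T : TraceClass (HilbertTensor A R)) :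
    entry (r + r') s T = entry r s T + entry r' s T :=
  Subtype.ext (by
    simp only [entry, Submodule.coe_add, tensorRight_add, map_add, ContinuousLinearMap.add_comp])

theorem entry_smul_left (r s : R) (c : ℂ) (T : TraceClass (HilbertTensor A R)) :
    entry (c • r) s T = (starRingEnd ℂ c) • entry r s T :=
  Subtype.ext (by
    simp only [entry, Submodule.coe_smul, tensorRight_smul, map_smulₛₗ,
      ContinuousLinearMap.smul_comp])

/-- The block form at `x` is the quadratic form of `ρ` at the vector `∑ x i ⊗ r i`. -/
theorem blockPositive_entry {ρ : TraceClass (HilbertTensor A R)}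
    (hρ : (ρ : HilbertTensor A R →L[ℂ] HilbertTensor A R).IsPositive) {n : ℕ} (r : Fin n → R) :
    BlockPositive (fun i j => (entry (r i) (r j) ρ : A →L[ℂ] A)) := by
  intro x
  have h : ∑ i, ∑ j, ⟪x i, (entry (r i) (r j) ρ : A →L[ℂ] A) (x j)⟫_ℂ =
      ⟪∑ i, tensorRight A (r i) (x i), (ρ : HilbertTensor A R →L[ℂ] HilbertTensor A R)
        (∑ j, tensorRight A (r j) (x j))⟫_ℂ := by
    rw [map_sum, sum_inner]
    refine Finset.sum_congr rfl fun i _ => ?_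
    rw [inner_sum]
    refine Finset.sum_congr rfl fun j _ => ?_
    rw [← ContinuousLinearMap.adjoint_inner_right]
    rfl
  rw [h]
  exact hρ.inner_nonneg_right _

/-- The form `(b ⊗ r, c ⊗ s) ↦ ⟨b, Φ(ρ_rs) c⟩` on the algebraic tensor product. -/
def ampliationForm (Φ : Superoperator A B) (ρ : TraceClass (HilbertTensor A R)) :
    (B ⊗[ℂ] R) →ₗ⋆[ℂ] (B ⊗[ℂ] R) →ₗ[ℂ] ℂ :=
  TensorProduct.lift (LinearMap.mk₂'ₛₗ (starRingEnd ℂ) (starRingEnd ℂ)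
    (fun b r => TensorProduct.lift (LinearMap.mk₂ ℂ
      (fun c s => ⟪b, (Φ (entry r s ρ) : B →L[ℂ] B) c⟫_ℂ)
      (fun c c' s => by rw [map_add, inner_add_right])
      (fun z c s => by rw [map_smul, inner_smul_right]; rfl)
      (fun c s s' => by
        rw [entry_add_right, map_add, Submodule.coe_add, _root_.add_apply, inner_add_right])
      (fun z c s => by
        rw [entry_smul_right, map_smul, Submodule.coe_smul, _root_.smul_apply, inner_smul_right]
        rfl)))
    (fun b b' r => TensorProduct.ext' fun c s => by
      simp)
    (fun z b r => TensorProduct.ext' fun c s => by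
      simp [mul_comm])
    (fun b r r' => TensorProduct.ext' fun c s => by
      simp [entry_add_left])
    (fun z b r => TensorProduct.ext' fun c s => by
      simp [entry_smul_left]))

theorem ampliationForm_tmul (Φ : Superoperator A B) (ρ : TraceClass (HilbertTensor A R))
    (b c : B) (r s : R) :
    ampliationForm Φ ρ (b ⊗ₜ r) (c ⊗ₜ s) = ⟪b, (Φ (entry r s ρ) : B →L[ℂ] B) c⟫_ℂ := rfl

/-- Only a finite-dimensional subspace of `R` is involved. Orthonormality of the second factors is
what turns `‖u‖²` into `∑ ‖b i‖²`. -/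
theorem exists_orthonormal_representation (u : B ⊗[ℂ] R) :
    ∃ (n : ℕ) (r : Fin n → R) (b : Fin n → B), Orthonormal ℂ r ∧ u = ∑ i, b i ⊗ₜ[ℂ] r i := by
  obtain ⟨M, N, hM, hN, h⟩ := TensorProduct.exists_finite_submodule_of_setFinite {u}
    (Set.finite_singleton u)
  obtain ⟨y, rfl⟩ := Set.singleton_subset_iff.1 h
  let f := stdOrthonormalBasis ℂ N
  refine ⟨_, fun i => (f i : R), ?_⟩
  suffices hs : ∃ b : Fin _ → B, TensorProduct.mapIncl M N y = ∑ i, b i ⊗ₜ[ℂ] (f i : R) by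
    obtain ⟨b, hb⟩ := hs
    exact ⟨b, f.orthonormal.comp_linearIsometry N.subtypeₗᵢ, hb⟩
  induction y using TensorProduct.induction_on with
  | zero => exact ⟨0, by simp⟩
  | tmul m n =>
    refine ⟨fun i => ⟪f i, n⟫_ℂ • (m : B), ?_⟩
    have hn : (n : R) = ∑ i, ⟪f i, n⟫_ℂ • (f i : R) := by
      conv_lhs => rw [← f.sum_repr' n]
      simp
    change (m : B) ⊗ₜ[ℂ] (n : R) = _
    conv_lhs => rw [hn]
    rw [TensorProduct.tmul_sum]
    simp_rw [TensorProduct.tmul_smul, TensorProduct.smul_tmul']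
  | add y z hy hz =>
    obtain ⟨b, hb⟩ := hy (by simp)
    obtain ⟨c, hc⟩ := hz (by simp)
    exact ⟨b + c, by
      rw [map_add, hb, hc, ← Finset.sum_add_distrib]
      simp [TensorProduct.add_tmul]⟩

theorem norm_sq_sum_tmul {n : ℕ} {r : Fin n → R} (hr : Orthonormal ℂ r) (b : Fin n → B) :
    ‖∑ i, b i ⊗ₜ[ℂ] r i‖ ^ 2 = ∑ i, ‖b i‖ ^ 2 := by
  have h : ⟪∑ i, b i ⊗ₜ[ℂ] r i, ∑ i, b i ⊗ₜ[ℂ] r i⟫_ℂ = ∑ i, ⟪b i, b i⟫_ℂ := by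
    rw [sum_inner]
    refine Finset.sum_congr rfl fun i _ => ?_
    rw [inner_sum]
    simp_rw [TensorProduct.inner_tmul, orthonormal_iff_ite.1 hr i]
    simp
  have h2 := congrArg Complex.re h
  rw [Complex.re_sum] at h2
  have h3 : ∀ i, (⟪b i, b i⟫_ℂ).re = ‖b i‖ ^ 2 := fun i => inner_self_eq_norm_sq (𝕜 := ℂ) (b i)
  simp_rw [h3] at h2
  rw [← h2]
  exact (inner_self_eq_norm_sq (𝕜 := ℂ) _).symm

theorem isPositive_iff_blockPositive (T : A →L[ℂ] A) :
    T.IsPositive ↔ BlockPositive (fun _ _ : Fin 1 => T) := by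
  constructor
  · intro h x
    simpa using h.inner_nonneg_right (x 0)
  · intro h
    refine (ContinuousLinearMap.isPositive_iff_complex _).2 fun x => ?_
    have h1 : 0 ≤ ⟪x, T x⟫_ℂ := by simpa using h fun _ => x
    have h2 : 0 ≤ ⟪T x, x⟫_ℂ := by
      rw [← inner_conj_symm]
      exact star_nonneg_iff.2 h1
    exact ⟨(Complex.eq_re_of_ofReal_le (r := 0) (by simpa using h2)).symm,
      (Complex.le_def.1 h2).1⟩

theorem IsChannel.isPositive_map {Φ : Superoperator A B} (hΦ : IsChannel Φ) {T : TraceClass A}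
    (hT : (T : A →L[ℂ] A).IsPositive) : (Φ T : B →L[ℂ] B).IsPositive :=
  (isPositive_iff_blockPositive _).2
    (hΦ.1 1 (fun _ _ => T) ((isPositive_iff_blockPositive _).1 hT))

theorem IsChannel.traceNorm_map {Φ : Superoperator A B} (hΦ : IsChannel Φ) {T : TraceClass A}
    (hT : (T : A →L[ℂ] A).IsPositive) :
    traceNorm (Φ T : B →L[ℂ] B) = traceNorm (T : A →L[ℂ] A) := by
  have h := hΦ.2 T
  rw [trace_of_isPositive hT, trace_of_isPositive (hΦ.isPositive_map hT)] at h
  have h2 : (traceNorm (Φ T : B →L[ℂ] B)).toReal = (traceNorm (T : A →L[ℂ] A)).toReal := by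
    exact_mod_cast h
  exact (ENNReal.toReal_eq_toReal_iff' (ne_of_lt (Φ T).2) (ne_of_lt T.2)).1 h2

theorem isPositive_entry {ρ : TraceClass (HilbertTensor A R)}
    (hρ : (ρ : HilbertTensor A R →L[ℂ] HilbertTensor A R).IsPositive) (r : R) :
    (entry r r ρ : A →L[ℂ] A).IsPositive := hρ.adjoint_conj (tensorRight A r)

/-- The trace norm of a positive operator on a composite system is the sum of those of its diagonal
blocks. -/
theorem traceNorm_eq_tsum_block {T : HilbertTensor A R →L[ℂ] HilbertTensor A R}
    (hT : T.IsPositive) {κ : Type*} (c : HilbertBasis κ ℂ R) :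
    traceNorm T = ∑' j, traceNorm (ContinuousLinearMap.adjoint (tensorRight A (c j)) ∘L T ∘L
      tensorRight A (c j)) := by
  rw [traceNorm_of_isPositive hT (productBasis (stdBasis A) c), ENNReal.tsum_prod',
    ENNReal.tsum_comm]
  congr 1
  funext j
  rw [traceNorm_of_isPositive (hT.adjoint_conj (tensorRight A (c j))) (stdBasis A)]
  congr 1
  funext i
  rw [productBasis_apply, ContinuousLinearMap.comp_apply,
    ContinuousLinearMap.adjoint_inner_right]
  rfl

theorem sum_traceNorm_entry_le {ρ : TraceClass (HilbertTensor A R)}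
    (hρ : (ρ : HilbertTensor A R →L[ℂ] HilbertTensor A R).IsPositive) {n : ℕ} {r : Fin n → R}
    (hr : Orthonormal ℂ r) : ∑ i, traceNorm (entry (r i) (r i) ρ : A →L[ℂ] A) ≤
      traceNorm (ρ : HilbertTensor A R →L[ℂ] HilbertTensor A R) := by
  -- The family `r` is completed to a Hilbert basis; its terms are then part of the full sum over
  -- diagonal blocks.
  obtain ⟨W, c, hW, hc⟩ := (hr.toSubtypeRange).exists_hilbertBasis_extension
  rw [traceNorm_eq_tsum_block hρ c, ← tsum_fintype (L := .unconditional _)]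
  have hinj : Function.Injective (fun i => (⟨r i, hW ⟨i, rfl⟩⟩ : W)) := fun i j h =>
    hr.linearIndependent.injective (congrArg Subtype.val h)
  refine le_trans (le_of_eq ?_) (ENNReal.tsum_comp_le_tsum_of_injective hinj _)
  congr 1
  funext i
  rw [hc]
  rfl

theorem IsChannel.ampliationForm_self {Φ : Superoperator A B} (hΦ : IsChannel Φ)
    {ρ : TraceClass (HilbertTensor A R)}
    (hρ : (ρ : HilbertTensor A R →L[ℂ] HilbertTensor A R).IsPositive) (u : B ⊗[ℂ] R) :
    0 ≤ ampliationForm Φ ρ u u := by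
  obtain ⟨n, r, b, -, rfl⟩ := exists_orthonormal_representation u
  have h := hΦ.1 n (fun i j => entry (r i) (r j) ρ) (blockPositive_entry hρ r) b
  refine h.trans_eq ?_
  simp only [map_sum, LinearMap.sum_apply, ampliationForm_tmul]
  exact Finset.sum_comm

/-- With `t i` the trace of the `i`-th diagonal entry of `ρ`, Cauchy-Schwarz for the form bounds its
`(i, j)` term by `√(t i) ‖b i‖ √(t j) ‖b j‖`. A second Cauchy-Schwarz and `∑ t i ≤ ‖ρ‖₁` finish. -/
theorem IsChannel.re_ampliationForm_le {Φ : Superoperator A B} (hΦ : IsChannel Φ)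
    {ρ : TraceClass (HilbertTensor A R)}
    (hρ : (ρ : HilbertTensor A R →L[ℂ] HilbertTensor A R).IsPositive) (u : B ⊗[ℂ] R) :
    (ampliationForm Φ ρ u u).re ≤
      (traceNorm (ρ : HilbertTensor A R →L[ℂ] HilbertTensor A R)).toReal * ‖u‖ ^ 2 := by
  obtain ⟨n, r, b, hr, rfl⟩ := exists_orthonormal_representation u
  set q := ampliationForm Φ ρ with hq
  have hqpos := hΦ.ampliationForm_self hρ
  let t : Fin n → ℝ := fun i => (traceNorm (entry (r i) (r i) ρ : A →L[ℂ] A)).toReal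
  have ht0 : ∀ i, 0 ≤ t i := fun i => ENNReal.toReal_nonneg
  have hdiag : ∀ i, (q (b i ⊗ₜ r i) (b i ⊗ₜ r i)).re ≤ t i * ‖b i‖ ^ 2 := by
    intro i
    refine (Complex.re_le_norm _).trans ?_
    rw [hq, ampliationForm_tmul]
    have h := enorm_inner_le_traceNorm (Φ (entry (r i) (r i) ρ) : B →L[ℂ] B) (b i) (b i)
    rw [hΦ.traceNorm_map (isPositive_entry hρ _)] at h
    have h2 := ENNReal.toReal_mono (ENNReal.mul_ne_top (ENNReal.mul_ne_top enorm_ne_top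
      enorm_ne_top) (TraceClass.traceNorm_lt_top _).ne) h
    rw [ENNReal.toReal_mul, ENNReal.toReal_mul, toReal_enorm, toReal_enorm] at h2
    calc _ ≤ ‖b i‖ * ‖b i‖ * t i := h2
      _ = _ := by ring
  have hoff : ∀ i j, ‖q (b i ⊗ₜ r i) (b j ⊗ₜ r j)‖ ≤ (√(t i) * ‖b i‖) * (√(t j) * ‖b j‖) := by
    intro i j
    refine (sq_le_sq₀ (norm_nonneg _) (by positivity)).1 ((form_norm_sq_le q hqpos _ _).trans ?_)
    calc _ ≤ (t i * ‖b i‖ ^ 2) * (t j * ‖b j‖ ^ 2) :=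
          mul_le_mul (hdiag i) (hdiag j) (Complex.le_def.1 (hqpos _)).1
            (mul_nonneg (ht0 i) (sq_nonneg _))
      _ = _ := by
        rw [mul_pow, mul_pow, mul_pow, Real.sq_sqrt (ht0 i), Real.sq_sqrt (ht0 j)]
  have hsum : ∑ i, t i ≤ (traceNorm (ρ : HilbertTensor A R →L[ℂ] HilbertTensor A R)).toReal := by
    rw [← ENNReal.toReal_sum fun i _ => (TraceClass.traceNorm_lt_top _).ne]
    exact ENNReal.toReal_mono (ne_of_lt ρ.2) (sum_traceNorm_entry_le hρ hr)
  calc (q (∑ i, b i ⊗ₜ[ℂ] r i) (∑ i, b i ⊗ₜ[ℂ] r i)).re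
      ≤ ‖q (∑ i, b i ⊗ₜ[ℂ] r i) (∑ i, b i ⊗ₜ[ℂ] r i)‖ := Complex.re_le_norm _
    _ = ‖∑ i, ∑ j, q (b i ⊗ₜ[ℂ] r i) (b j ⊗ₜ[ℂ] r j)‖ := by
        simp only [map_sum, LinearMap.sum_apply]
        rw [Finset.sum_comm]
    _ ≤ ∑ i, ∑ j, (√(t i) * ‖b i‖) * (√(t j) * ‖b j‖) :=
        (norm_sum_le _ _).trans (Finset.sum_le_sum fun i _ =>
          (norm_sum_le _ _).trans (Finset.sum_le_sum fun j _ => hoff i j))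
    _ = (∑ i, √(t i) * ‖b i‖) ^ 2 := by rw [sq, Finset.sum_mul_sum]
    _ ≤ (∑ i, √(t i) ^ 2) * ∑ i, ‖b i‖ ^ 2 := Finset.sum_mul_sq_le_sq_mul_sq _ _ _
    _ = (∑ i, t i) * ‖∑ i, b i ⊗ₜ[ℂ] r i‖ ^ 2 := by
        simp_rw [Real.sq_sqrt (ht0 _)]
        rw [norm_sq_sum_tmul hr]
    _ ≤ _ := by gcongr

/-- The operator representing the form is the ampliation. Its trace is the sum over diagonal blocks,
each preserved by `Φ`, hence equals the trace of `ρ`. -/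
theorem IsChannel.diamondNorm_le {Φ : Superoperator A B} (hΦ : IsChannel Φ) :
    diamondNorm R Φ ≤ 1 := by
  refine iSup₂_le fun ρ hρ => ?_
  obtain ⟨σ, hσ, hσq⟩ := exists_isPositive_of_form (ampliationForm Φ ρ)
    (hΦ.ampliationForm_self hρ.1) ENNReal.toReal_nonneg (hΦ.re_ampliationForm_le hρ.1)
  have hentry : ∀ r s : R, ContinuousLinearMap.adjoint (tensorRight B r) ∘L σ ∘L
      tensorRight B s = (Φ (entry r s ρ) : B →L[ℂ] B) := by
    intro r s
    refine ContinuousLinearMap.ext fun c => ext_inner_left ℂ fun b => ?_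
    rw [ContinuousLinearMap.comp_apply, ContinuousLinearMap.adjoint_inner_right]
    exact hσq (b ⊗ₜ r) (c ⊗ₜ s)
  have hnorm : traceNorm σ = 1 := by
    rw [traceNorm_eq_tsum_block hσ (stdBasis R), ← hρ.traceNorm_eq,
      traceNorm_eq_tsum_block hρ.1 (stdBasis R)]
    congr 1
    funext j
    rw [hentry, hΦ.traceNorm_map (isPositive_entry hρ.1 _)]
    rfl
  have hfin : traceNorm σ < ⊤ := hnorm ▸ ENNReal.one_lt_top
  exact (ampliationNorm_le (σ := ⟨σ, hfin⟩) fun r s => Subtype.ext (hentry r s)).trans_eq hnorm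

end Channel

/-! ### Comparison of the two topologies and the final statements. -/

section Main

variable {A : Type u} [NormedAddCommGroup A] [InnerProductSpace ℂ A] [CompleteSpace A]
variable {B : Type v} [NormedAddCommGroup B] [InnerProductSpace ℂ B] [CompleteSpace B]
variable {R : Type w} [NormedAddCommGroup R] [InnerProductSpace ℂ R] [CompleteSpace R]
variable {H : A →ₗ.[ℂ] A} {E : ℝ}

theorem exists_norm_eq_one (hR : ¬ FiniteDimensional ℂ R) : ∃ r : R, ‖r‖ = 1 := by
  have : Nontrivial R := by
    by_contra h
    rw [not_nontrivial_iff_subsingleton] at h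
    exact hR inferInstance
  obtain ⟨x, hx⟩ := exists_ne (0 : R)
  exact ⟨((‖x‖⁻¹ : ℝ) : ℂ) • x, by
    rw [norm_smul, Complex.norm_real, norm_inv, norm_norm, inv_mul_cancel₀ (norm_ne_zero_iff.2 hx)]⟩

theorem IsHamiltonian.energy_nonneg (hH : IsHamiltonian H) (hE : groundEnergy H < (E : EReal)) :
    0 ≤ E := by
  obtain ⟨x, y, hxy, -, h⟩ := hH.exists_inner_lt hE
  exact (hH.re_inner_graph_nonneg hxy).trans h.le

theorem OpNormLE.sub {Φ Ψ : Superoperator A B} {C D : ℝ≥0∞} (hΦ : OpNormLE Φ C)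
    (hΨ : OpNormLE Ψ D) : OpNormLE (Φ - Ψ) (C + D) := fun T =>
  (traceNorm_sub_le _ _).trans ((add_le_add (hΦ T) (hΨ T)).trans_eq (add_mul _ _ _).symm)

theorem IsHamiltonian.eq_zero_of_ecdNorm_eq_zero (hH : IsHamiltonian H)
    (hE : groundEnergy H < (E : EReal)) {r : R} (hr : ‖r‖ = 1) {Φ : Superoperator A B}
    {C : NNReal} (hΦ : OpNormLE Φ C) (h0 : ecdNorm R H E Φ = 0) : Φ = 0 := by
  have h : ∀ ρ : TraceClass A, IsState ρ → Φ ρ = 0 := by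
    intro ρ hρ
    refine Subtype.ext (eq_zero_of_traceNorm_eq_zero ?_)
    refine le_antisymm (ENNReal.le_of_forall_pos_le_add fun ε hε _ => ?_) zero_le
    have hC : 0 < C + 1 := by positivity
    obtain ⟨M, hM⟩ := hH.ecdControlled_of_isPositive (B := B) hE hr hρ.1 (ε / (C + 1))
      (div_pos hε hC)
    refine (hM Φ C hΦ).trans ?_
    rw [h0, mul_zero]
    gcongr
    rw [← ENNReal.coe_mul, ENNReal.coe_le_coe, mul_div_assoc', div_le_iff₀ hC, mul_comm]
    gcongr
    exact le_add_of_nonneg_right zero_le_one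
  have hspan : Submodule.span ℂ {ρ : TraceClass A | IsState ρ} ≤ LinearMap.ker Φ :=
    Submodule.span_le.2 fun ρ hρ => h ρ hρ
  rw [span_isState_eq_top] at hspan
  exact LinearMap.ker_eq_top.1 (top_le_iff.1 hspan)

/-- On operator-norm bounded sets, the trace norm of the image of a state is dominated by the
energy-constrained diamond norm up to an arbitrarily small error. -/
theorem IsHamiltonian.exists_traceNorm_le (hH : IsHamiltonian H)
    (hE : groundEnergy H < (E : EReal)) {r : R} (hr : ‖r‖ = 1) {ρ : TraceClass A}
    (hρ : IsState ρ) (C : NNReal) {ε : ℝ≥0∞} (hε : 0 < ε) :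
    ∃ δ : ℝ≥0∞, 0 < δ ∧ ∀ Φ : Superoperator A B, OpNormLE Φ C → ecdNorm R H E Φ < δ →
      traceNorm (Φ ρ : B →L[ℂ] B) < ε := by
  obtain ⟨η, hη, hηε⟩ := ENNReal.lt_iff_exists_nnreal_btwn.1 hε
  have hη : 0 < η := by simpa using hη
  have hC : 0 < C + 1 := by positivity
  obtain ⟨M, hM⟩ := hH.ecdControlled_of_isPositive (B := B) hE hr hρ.1 (η / 2 / (C + 1))
    (div_pos (half_pos hη) hC)
  have hM1 : 0 < M + 1 := by positivity
  refine ⟨(η / 2 / (M + 1) : NNReal), ENNReal.coe_pos.2 (div_pos (half_pos hη) hM1),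
    fun Φ hΦ h => ?_⟩
  refine lt_of_le_of_lt ((hM Φ C hΦ).trans ?_) hηε
  calc (M : ℝ≥0∞) * ecdNorm R H E Φ + C * ((η / 2 / (C + 1) : NNReal) : ℝ≥0∞)
      ≤ M * ((η / 2 / (M + 1) : NNReal) : ℝ≥0∞) + C * ((η / 2 / (C + 1) : NNReal) : ℝ≥0∞) := by
        gcongr
    _ = ((M * (η / 2 / (M + 1)) + C * (η / 2 / (C + 1)) : NNReal) : ℝ≥0∞) := by push_cast; rfl
    _ ≤ ((η / 2 + η / 2 : NNReal) : ℝ≥0∞) := by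
        rw [ENNReal.coe_le_coe]
        gcongr
        · rw [mul_div_assoc', div_le_iff₀ hM1, mul_comm]
          gcongr
          exact le_add_of_nonneg_right zero_le_one
        · rw [mul_div_assoc', div_le_iff₀ hC, mul_comm]
          gcongr
          exact le_add_of_nonneg_right zero_le_one
    _ = η := by rw [add_halves]

/-- On diamond-norm bounded sets, the energy-constrained diamond norm is dominated by finitely many
of the seminorms defining the strong topology up to an arbitrarily small error. -/
theorem IsHamiltonian.exists_ecdNorm_le (hH : IsHamiltonian H)
    (hE : groundEnergy H < (E : EReal)) (hd : HasDiscreteSpectrum H) (C : NNReal) {ε : ℝ≥0∞}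
    (hε : 0 < ε) :
    ∃ (F : Finset (TraceClass A)) (δ : ℝ≥0∞), (∀ ρ ∈ F, IsState ρ) ∧ 0 < δ ∧
      ∀ Φ : Superoperator A B, diamondNorm R Φ ≤ C → (∀ ρ ∈ F, traceNorm (Φ ρ : B →L[ℂ] B) < δ) →
        ecdNorm R H E Φ < ε := by
  classical
  obtain ⟨τ, e, hτ, he⟩ := hd
  obtain ⟨η, hη, hηε⟩ := ENNReal.lt_iff_exists_nnreal_btwn.1 hε
  have hη : 0 < η := by simpa using hη
  have hE0 := hH.energy_nonneg hE
  have hC : 0 < C + 1 := by positivity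
  -- Chosen so that the truncation error `C * (2 * d)` is at most `η / 2`.
  set d : NNReal := η / 2 / (C + 1) / 2 with hd
  have hd0 : 0 < d := half_pos (div_pos (half_pos hη) hC)
  -- Gives `E / N ≤ d²`; the `+ 1` keeps `N` positive when `E = 0`.
  set N : ℝ := (E + 1) / (d : ℝ) ^ 2 with hN
  have hdR : (0 : ℝ) < (d : ℝ) ^ 2 := pow_pos (NNReal.coe_pos.2 hd0) 2
  have hN0 : 0 < N := div_pos (by linarith) hdR
  obtain ⟨F, hF⟩ := exists_finset_le he N
  have hEN : ENNReal.ofReal (E / N) ≤ (d : ℝ≥0∞) ^ 2 := by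
    rw [← ENNReal.coe_pow, ← ENNReal.ofReal_coe_nnreal]
    refine ENNReal.ofReal_le_ofReal ?_
    rw [NNReal.coe_pow, div_le_iff₀ hN0, hN, mul_div_cancel₀ _ hdR.ne']
    linarith
  choose G M hG hM using fun k l => exists_finset_isState.{v, u} (tcRankOne (τ k) (τ l))
  obtain ⟨G', hG'⟩ : ∃ G' : Finset (TraceClass A), ∀ ρ, ρ ∈ G' ↔ ∃ k ∈ F, ∃ l ∈ F, ρ ∈ G k l :=
    ⟨F.biUnion fun k => F.biUnion fun l => G k l, fun ρ => Finset.mem_biUnion.trans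
      (exists_congr fun k => and_congr_right fun _ => Finset.mem_biUnion)⟩
  -- If every seminorm in `G'` is below `δ`, the finite double sum is at most `S * δ`.
  obtain ⟨S, hS⟩ : ∃ S : NNReal, S = ∑ k ∈ F, ∑ l ∈ F, M k l * (G k l).card := ⟨_, rfl⟩
  have hS1 : 0 < S + 1 := by positivity
  refine ⟨G', (η / 2 / (S + 1) : NNReal), ?_, ENNReal.coe_pos.2 (div_pos (half_pos hη) hS1), ?_⟩
  · intro ρ hρ
    obtain ⟨k, -, l, -, h⟩ := (hG' ρ).1 hρ
    exact hG k l ρ h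
  intro Φ hΦ hδ
  refine lt_of_le_of_lt ((hH.ecdNorm_le_of_discrete hτ he hE0 hN0
    (fun k hk => (not_le.1 (mt (hF k).2 hk)).le) hEN hΦ).trans ?_) hηε
  set δ : NNReal := η / 2 / (S + 1) with hδdef
  have hsum : ∑ k ∈ F, ∑ l ∈ F, traceNorm (Φ (tcRankOne (τ k) (τ l)) : B →L[ℂ] B) ≤
      ((S * δ : NNReal) : ℝ≥0∞) := by
    rw [hS, Finset.sum_mul]
    simp_rw [Finset.sum_mul]
    push_cast
    refine Finset.sum_le_sum fun k hk => Finset.sum_le_sum fun l hl => ?_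
    refine (hM k l Φ).trans ?_
    rw [mul_assoc]
    gcongr
    rw [← nsmul_eq_mul]
    exact Finset.sum_le_card_nsmul _ _ _ fun ρ hρ => (hδ ρ ((hG' ρ).2 ⟨k, hk, l, hl, hρ⟩)).le
  calc _ ≤ ((S * δ : NNReal) : ℝ≥0∞) + C * (2 * (d : ℝ≥0∞)) := by gcongr
    _ = ((S * δ + C * (2 * d) : NNReal) : ℝ≥0∞) := by push_cast; rfl
    _ ≤ ((η / 2 + η / 2 : NNReal) : ℝ≥0∞) := by
        rw [ENNReal.coe_le_coe]
        gcongr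
        · rw [hδdef, mul_div_assoc', div_le_iff₀ hS1, mul_comm]
          gcongr
          exact le_add_of_nonneg_right zero_le_one
        · rw [hd, mul_div_cancel₀ _ two_ne_zero, mul_div_assoc', div_le_iff₀ hC, mul_comm]
          gcongr
          exact le_add_of_nonneg_right zero_le_one
    _ = η := by rw [add_halves]

theorem IsHamiltonian.strongConvergence_of_ecdConvergence (hH : IsHamiltonian H)
    (hE : groundEnergy H < (E : EReal)) {r : R} (hr : ‖r‖ = 1) {C : NNReal}
    {Φ : ℕ → Superoperator A B} {Φ₀ : Superoperator A B} (hΦ : ∀ n, OpNormLE (Φ n) C)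
    (hΦ₀ : OpNormLE Φ₀ C) (h : EcdConvergence R H E Φ Φ₀) : StrongConvergence Φ Φ₀ := by
  intro ρ hρ
  refine ENNReal.tendsto_nhds_zero.2 fun ε hε => ?_
  obtain ⟨δ, hδ, hδε⟩ := hH.exists_traceNorm_le (B := B) hE hr hρ (C + C) hε
  filter_upwards [h.eventually (gt_mem_nhds hδ)] with n hn
  exact (hδε (Φ n - Φ₀) ((hΦ n).sub hΦ₀) hn).le

theorem IsHamiltonian.ecdConvergence_of_strongConvergence (hH : IsHamiltonian H)
    (hE : groundEnergy H < (E : EReal)) (hd : HasDiscreteSpectrum H) {C : NNReal}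
    {Φ : ℕ → Superoperator A B} {Φ₀ : Superoperator A B} (hΦ : ∀ n, diamondNorm R (Φ n) ≤ C)
    (hΦ₀ : diamondNorm R Φ₀ ≤ C) (h : StrongConvergence Φ Φ₀) : EcdConvergence R H E Φ Φ₀ := by
  refine ENNReal.tendsto_nhds_zero.2 fun ε hε => ?_
  obtain ⟨F, δ, hF, hδ, hδε⟩ := hH.exists_ecdNorm_le (B := B) (R := R) hE hd (C + C) hε
  filter_upwards [(Filter.eventually_all_finset F).2 fun ρ hρ =>
    (h ρ (hF ρ hρ)).eventually (gt_mem_nhds hδ)] with n hn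
  exact (hδε (Φ n - Φ₀) ((diamondNorm_sub_le _ _).trans (add_le_add (hΦ n) hΦ₀)) hn).le

/-- The center `Φ₀` of a subbasic open set need not lie in `𝓢`, so the comparison bounds are applied
only to differences `Ψ - Φ` of members. The gap between `ε` and the distance from `Φ` to `Φ₀` leaves
room for the triangle inequality. -/
theorem IsHamiltonian.sameTopologyOn (hH : IsHamiltonian H)
    (hE : groundEnergy H < (E : EReal)) (hd : HasDiscreteSpectrum H) {r : R} (hr : ‖r‖ = 1)
    {C : NNReal} {𝓢 : Set (Superoperator A B)} (h𝓢 : ∀ Φ ∈ 𝓢, diamondNorm R Φ ≤ C) :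
    SameTopologyOn R H E 𝓢 := by
  have hop : ∀ Φ ∈ 𝓢, OpNormLE Φ (2 * C : NNReal) := fun Φ hΦ => by
    simpa using opNormLE_of_diamondNorm_le hr (h𝓢 Φ hΦ)
  have hself : ∀ Φ : Superoperator A B, ecdNorm R H E (Φ - Φ) = 0 := fun Φ => by
    have := ecdNorm_smul (R := R) H E (0 : ℂ) Φ
    rw [zero_smul, enorm_zero, zero_mul] at this
    exact (congrArg (ecdNorm R H E) (sub_self Φ)).trans this
  have hself' : ∀ T : TraceClass B, traceNorm ((T - T : TraceClass B) : B →L[ℂ] B) = 0 :=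
    fun T => by
      have := traceNorm_smul_le (0 : ℂ) (T : B →L[ℂ] B)
      rw [zero_smul, enorm_zero, zero_mul] at this
      rw [sub_self]
      exact le_antisymm this zero_le
  refine le_antisymm ?_ ?_
  · refine continuous_iff_le_induced.1 (continuous_generateFrom_iff.2 ?_)
    rintro _ ⟨ρ, Φ₀, ε, hρ, hε, rfl⟩
    let _ : TopologicalSpace 𝓢 := .induced (↑) (ecdTopology B R H E)
    refine isOpen_iff_mem_nhds.2 fun Φ hΦ => ?_
    have hΦ : traceNorm ((Φ.1 ρ - Φ₀ ρ : TraceClass B) : B →L[ℂ] B) < ε := hΦ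
    obtain ⟨δ, hδ, hδε⟩ := hH.exists_traceNorm_le (B := B) hE hr hρ (2 * C + 2 * C)
      (tsub_pos_of_lt hΦ)
    have hopen : IsOpen ((↑) ⁻¹' {Ψ | ecdNorm R H E (Ψ - Φ.1) < δ} : Set 𝓢) :=
      ⟨_, TopologicalSpace.isOpen_generateFrom_of_mem ⟨Φ.1, δ, hδ, rfl⟩, rfl⟩
    refine Filter.mem_of_superset (hopen.mem_nhds ((hself Φ.1).trans_lt hδ)) fun Ψ hΨ => ?_
    have h1 := hδε (Ψ.1 - Φ.1) ((hop _ Ψ.2).sub (hop _ Φ.2)) hΨ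
    have h2 : (Ψ.1 ρ - Φ₀ ρ : TraceClass B) = (Ψ.1 - Φ.1) ρ + (Φ.1 ρ - Φ₀ ρ) := by
      rw [LinearMap.sub_apply]; abel
    change traceNorm ((Ψ.1 ρ - Φ₀ ρ : TraceClass B) : B →L[ℂ] B) < ε
    rw [h2]
    exact (traceNorm_add_le _ _).trans_lt (lt_tsub_iff_right.1 h1)
  · refine continuous_iff_le_induced.1 (continuous_generateFrom_iff.2 ?_)
    rintro _ ⟨Φ₀, ε, hε, rfl⟩
    let _ : TopologicalSpace 𝓢 := .induced (↑) (strongTopology A B)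
    refine isOpen_iff_mem_nhds.2 fun Φ hΦ => ?_
    have hΦ : ecdNorm R H E (Φ.1 - Φ₀) < ε := hΦ
    obtain ⟨F, δ, hF, hδ, hδε⟩ := hH.exists_ecdNorm_le (B := B) (R := R) hE hd (C + C)
      (tsub_pos_of_lt hΦ)
    have hmem : ∀ ρ ∈ F, (↑) ⁻¹' {Ψ : Superoperator A B |
        traceNorm ((Ψ ρ - Φ.1 ρ : TraceClass B) : B →L[ℂ] B) < δ} ∈ nhds Φ := fun ρ hρ => by
      have hopen : IsOpen ((↑) ⁻¹' {Ψ : Superoperator A B |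
          traceNorm ((Ψ ρ - Φ.1 ρ : TraceClass B) : B →L[ℂ] B) < δ} : Set 𝓢) :=
        ⟨_, TopologicalSpace.isOpen_generateFrom_of_mem ⟨ρ, Φ.1, δ, hF ρ hρ, hδ, rfl⟩, rfl⟩
      exact hopen.mem_nhds ((hself' (Φ.1 ρ)).trans_lt hδ)
    refine Filter.mem_of_superset ((Filter.biInter_finset_mem F).2 hmem) fun Ψ hΨ => ?_
    have h1 := hδε (Ψ.1 - Φ.1)
      ((diamondNorm_sub_le _ _).trans (add_le_add (h𝓢 _ Ψ.2) (h𝓢 _ Φ.2)))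
      fun ρ hρ => Set.mem_iInter₂.1 hΨ ρ hρ
    have h2 : Ψ.1 - Φ₀ = (Ψ.1 - Φ.1) + (Φ.1 - Φ₀) := by abel
    change ecdNorm R H E (Ψ.1 - Φ₀) < ε
    rw [h2]
    exact (ecdNorm_add_le _ _ _ _).trans_lt (lt_tsub_iff_right.1 h1)

theorem IsHamiltonian.ecdConvergence_iff (hH : IsHamiltonian H)
    (hE : groundEnergy H < (E : EReal)) (hd : HasDiscreteSpectrum H) {r : R} (hr : ‖r‖ = 1)
    {C : NNReal} {Φ : ℕ → Superoperator A B} {Φ₀ : Superoperator A B}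
    (hΦ : ∀ n, diamondNorm R (Φ n) ≤ C) (hΦ₀ : diamondNorm R Φ₀ ≤ C) :
    EcdConvergence R H E Φ Φ₀ ↔ StrongConvergence Φ Φ₀ := by
  have hop : ∀ Φ : Superoperator A B, diamondNorm R Φ ≤ C → OpNormLE Φ (2 * C : NNReal) :=
    fun Φ hΦ => by simpa using opNormLE_of_diamondNorm_le hr hΦ
  exact ⟨hH.strongConvergence_of_ecdConvergence hE hr (fun n => hop _ (hΦ n)) (hop _ hΦ₀),
    hH.ecdConvergence_of_strongConvergence hE hd hΦ hΦ₀⟩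

end Main

end ECD

end

theorem proposition4
    {A : Type*} [NormedAddCommGroup A] [InnerProductSpace ℂ A] [CompleteSpace A]
    [TopologicalSpace.SeparableSpace A]
    {B : Type*} [NormedAddCommGroup B] [InnerProductSpace ℂ B] [CompleteSpace B]
    [TopologicalSpace.SeparableSpace B]
    {R : Type*} [NormedAddCommGroup R] [InnerProductSpace ℂ R] [CompleteSpace R]
    [TopologicalSpace.SeparableSpace R] (hR : ¬ FiniteDimensional ℂ R)
    (H : A →ₗ.[ℂ] A) (hH : ECD.IsHamiltonian H)
    (E : ℝ) (hE : ECD.groundEnergy H < (E : EReal)) :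
    -- the ECD-norm is a norm on the bounded Hermitian-preserving superoperators
    -- (finite wherever the diamond norm is finite)
    ((∀ Φ Ψ : ECD.Superoperator A B, ECD.HermitianPreserving Φ → ECD.HermitianPreserving Ψ →
        ECD.ecdNorm R H E (Φ + Ψ) ≤ ECD.ecdNorm R H E Φ + ECD.ecdNorm R H E Ψ) ∧
      (∀ (c : ℝ) (Φ : ECD.Superoperator A B), ECD.HermitianPreserving Φ →
        ECD.ecdNorm R H E ((c : ℂ) • Φ) = ENNReal.ofReal |c| * ECD.ecdNorm R H E Φ) ∧
      (∀ Φ : ECD.Superoperator A B, ECD.HermitianPreserving Φ → ECD.diamondNorm R Φ < ⊤ →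
        ECD.ecdNorm R H E Φ < ⊤) ∧
      (∀ Φ : ECD.Superoperator A B, ECD.HermitianPreserving Φ →
        (∃ C : NNReal, ECD.OpNormLE Φ C) → ECD.ecdNorm R H E Φ = 0 → Φ = 0)) ∧
    -- part A, for channels
    (∀ (Φ : ℕ → ECD.Superoperator A B) (Φ₀ : ECD.Superoperator A B),
      (∀ n, ECD.IsChannel (Φ n)) → ECD.IsChannel Φ₀ →
        ECD.EcdConvergence R H E Φ Φ₀ → ECD.StrongConvergence Φ Φ₀) ∧
    -- part B, for channels: sequences and topologies
    (ECD.HasDiscreteSpectrum H →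
      (∀ (Φ : ℕ → ECD.Superoperator A B) (Φ₀ : ECD.Superoperator A B),
        (∀ n, ECD.IsChannel (Φ n)) → ECD.IsChannel Φ₀ →
          (ECD.EcdConvergence R H E Φ Φ₀ ↔ ECD.StrongConvergence Φ Φ₀)) ∧
      ECD.SameTopologyOn R H E {Φ : ECD.Superoperator A B | ECD.IsChannel Φ}) ∧
    -- part A, for operator-norm bounded sets of Hermitian-preserving superoperators
    (∀ (C : NNReal) (Φ : ℕ → ECD.Superoperator A B) (Φ₀ : ECD.Superoperator A B),
      (∀ n, ECD.HermitianPreserving (Φ n) ∧ ECD.OpNormLE (Φ n) C) →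
      ECD.HermitianPreserving Φ₀ → ECD.OpNormLE Φ₀ C →
        ECD.EcdConvergence R H E Φ Φ₀ → ECD.StrongConvergence Φ Φ₀) ∧
    -- part B, for diamond-norm bounded sets of Hermitian-preserving superoperators
    (ECD.HasDiscreteSpectrum H → ∀ (C : NNReal) (𝓢 : Set (ECD.Superoperator A B)),
      (∀ Φ ∈ 𝓢, ECD.HermitianPreserving Φ ∧ ECD.diamondNorm R Φ ≤ C) →
      (∀ (Φ : ℕ → ECD.Superoperator A B) (Φ₀ : ECD.Superoperator A B),
        (∀ n, Φ n ∈ 𝓢) → Φ₀ ∈ 𝓢 →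
          (ECD.EcdConvergence R H E Φ Φ₀ ↔ ECD.StrongConvergence Φ Φ₀)) ∧
      ECD.SameTopologyOn R H E 𝓢) := by
  obtain ⟨r, hr⟩ := ECD.exists_norm_eq_one hR
  have hch : ∀ Φ : ECD.Superoperator A B, ECD.IsChannel Φ →
      ECD.diamondNorm R Φ ≤ (1 : NNReal) := fun Φ hΦ => by simpa using hΦ.diamondNorm_le
  have hop : ∀ Φ : ECD.Superoperator A B, ECD.IsChannel Φ →
      ECD.OpNormLE Φ (2 : NNReal) := fun Φ hΦ => by
    simpa using ECD.opNormLE_of_diamondNorm_le hr (hch Φ hΦ)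
  refine ⟨⟨fun Φ Ψ _ _ => ECD.ecdNorm_add_le H E Φ Ψ, fun c Φ _ => ?_,
    fun Φ _ h => (ECD.ecdNorm_le_diamondNorm H E Φ).trans_lt h,
    fun Φ _ ⟨C, hC⟩ h0 => hH.eq_zero_of_ecdNorm_eq_zero hE hr hC h0⟩,
    fun Φ Φ₀ hΦ hΦ₀ => hH.strongConvergence_of_ecdConvergence hE hr (fun n => hop _ (hΦ n))
      (hop _ hΦ₀),
    fun hd => ⟨fun Φ Φ₀ hΦ hΦ₀ => hH.ecdConvergence_iff hE hd hr (fun n => hch _ (hΦ n))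
      (hch _ hΦ₀), hH.sameTopologyOn hE hd hr hch⟩,
    fun C Φ Φ₀ hΦ _ hΦ₀ => hH.strongConvergence_of_ecdConvergence hE hr (fun n => (hΦ n).2) hΦ₀,
    fun hd C 𝓢 h𝓢 => ⟨fun Φ Φ₀ hΦ hΦ₀ => hH.ecdConvergence_iff hE hd hr
      (fun n => (h𝓢 _ (hΦ n)).2) (h𝓢 _ hΦ₀).2,
      hH.sameTopologyOn hE hd hr fun Φ hΦ => (h𝓢 Φ hΦ).2⟩⟩
  rw [ECD.ecdNorm_smul, enorm_eq_nnnorm, Complex.nnnorm_real, ← enorm_eq_nnnorm,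
    Real.enorm_eq_ofReal_abs]
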